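/- Let $K$ be a connected compact Lie group with Lie algebra $\mathfrak{k}$, acting smoothly on a smooth manifold $X$ (Hausdorff, second countable, finite-dimensional, without boundary). For $\xi\in\mathfrak{k}$ let $\xi_X$ denote the fundamental vector field, $\xi_X(m)=\frac{d}{dt}\big|_{t=0}\exp(t\xi)\cdot m$. A smooth differential form $\omega$ on $X$ is called momentumly closed if $d(\iota_{\xi_X}\omega)=0$ for all $\xi\in\mathfrak{k}$. Let $W\subseteq X$ be a compact $K$-invariant (embedded) submanifold, and let $\omega_0,\omega_1$ be two $K$-invariant, momentumly closed, non-degenerate smooth two-forms on $X$ such that $\omega_0|_{T_pX}=\omega_1|_{T_pX}$ for every $p\in W$. Then there exist $K$-invariant open neighbourhoods $U_0,U_1$ of $W$ in $X$ and a $K$-equivariant diffeomorphism $\varphi:U_0\to U_1$ such that $\varphi(p)=p$ for all $p\in W$ and $$\iota_{\xi_X}\omega_0=\iota_{\xi_X}\varphi^*\omega_1\quad\text{on } U_0,\qquad\text{for all }\xi\in\mathfrak{k}.$$ -/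

import Mathlib

open scoped Manifold ContDiff Topology

noncomputable section

namespace MomentumDarboux

/-! ### Differential forms on a manifold without boundary modelled on a normed space `E` -/

section Forms

variable (E : Type*) [NormedAddCommGroup E] [NormedSpace ℝ E]
variable (X : Type*) [TopologicalSpace X] [ChartedSpace E X]

/-- A (not necessarily smooth) real differential `k`-form on `X`: an alternating `k`-linear form
on each tangent space. -/
abbrev DiffForm (k : ℕ) : Type _ :=
  (x : X) → TangentSpace 𝓘(ℝ, E) x [⋀^Fin k]→L[ℝ] ℝ

variable {E X}

/-- The local expression of `α` in the preferred chart `c` at `x₀`: the form `(c⁻¹)^* α`, which is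
meaningful on the open set `c.target ⊆ E`. -/
def DiffForm.inChart {k : ℕ} (α : DiffForm E X k) (x₀ : X) : E → E [⋀^Fin k]→L[ℝ] ℝ := fun y =>
  (α ((extChartAt 𝓘(ℝ, E) x₀).symm y)).compContinuousLinearMap
    (mfderiv 𝓘(ℝ, E) 𝓘(ℝ, E) (extChartAt 𝓘(ℝ, E) x₀).symm y)

/-- A form is smooth if its local expressions in the charts of `X` are smooth. -/
def DiffForm.IsSmooth {k : ℕ} (α : DiffForm E X k) : Prop :=
  ∀ x₀ : X, ContDiffOn ℝ ∞ (α.inChart x₀) (extChartAt 𝓘(ℝ, E) x₀).target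

/-- The exterior differential `dα`, computed at `x` in the preferred chart `c` at `x`:
`(dα)_x = (c^* d((c⁻¹)^* α))_x`. For smooth `α` this does not depend on the chart. -/
def DiffForm.d {k : ℕ} (α : DiffForm E X k) : DiffForm E X (k + 1) := fun x =>
  (extDeriv (α.inChart x) (extChartAt 𝓘(ℝ, E) x x)).compContinuousLinearMap
    (mfderiv 𝓘(ℝ, E) 𝓘(ℝ, E) (extChartAt 𝓘(ℝ, E) x) x)

/-- The contraction `ι_V α = α(V, ·, …, ·)` of a form with a vector field. -/
def DiffForm.contract {k : ℕ} (V : (x : X) → TangentSpace 𝓘(ℝ, E) x) (α : DiffForm E X (k + 1)) :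
    DiffForm E X k := fun x =>
  ContinuousAlternatingMap.curryLeft (E := E) (α x) (V x)

theorem DiffForm.contract_apply {k : ℕ} (V : (x : X) → TangentSpace 𝓘(ℝ, E) x)
    (α : DiffForm E X (k + 1)) (x : X) (w : Fin k → TangentSpace 𝓘(ℝ, E) x) :
    α.contract V x w = α x (Matrix.vecCons (V x) w) := rfl

/-- The pullback `f^* α`; it is meaningful at the points where `f` is differentiable. -/
def DiffForm.pullback {k : ℕ} (f : X → X) (α : DiffForm E X k) : DiffForm E X k := fun x =>
  (α (f x)).compContinuousLinearMap (mfderiv 𝓘(ℝ, E) 𝓘(ℝ, E) f x)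

/-- A two-form is non-degenerate if `α_x(v, ·) = 0` only for `v = 0`, at every point `x`. -/
def DiffForm.Nondegenerate (α : DiffForm E X 2) : Prop :=
  ∀ (x : X) (v : TangentSpace 𝓘(ℝ, E) x),
    (∀ w : TangentSpace 𝓘(ℝ, E) x, α x ![v, w] = 0) → v = 0

/-- `W ⊆ X` is an (embedded, boundaryless, smooth) submanifold: around each point of `W` there is
a chart of the smooth structure of `X` in which `W` is a linear subspace. -/
def IsSubmanifold (E : Type*) [NormedAddCommGroup E] [NormedSpace ℝ E]
    {X : Type*} [TopologicalSpace X] [ChartedSpace E X] (W : Set X) : Prop :=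
  ∀ p ∈ W, ∃ c ∈ IsManifold.maximalAtlas 𝓘(ℝ, E) ∞ X, p ∈ c.source ∧
    ∃ S : Submodule ℝ E, c '' (W ∩ c.source) = (S : Set E) ∩ c.target

end Forms

/-! ### Smooth actions of a Lie group -/

section Action

variable {F : Type*} [NormedAddCommGroup F] [NormedSpace ℝ F]
variable {K : Type*} [TopologicalSpace K] [ChartedSpace F K] [Group K]
variable {E : Type*} [NormedAddCommGroup E] [NormedSpace ℝ E]
variable {X : Type*} [TopologicalSpace X] [ChartedSpace E X] [MulAction K X]

/-- The fundamental vector field `ξ_X` generated by `ξ ∈ 𝔨 = T_1 K`: the value at `m` is the image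
of `ξ` under the differential at `1` of the orbit map `k ↦ k • m`. By
`hasMFDerivAt_smul_of_velocity` below it is the velocity at `t = 0` of `t ↦ γ(t) • m` for every
curve `γ` in `K` with `γ(0) = 1` and `γ'(0) = ξ`, in particular for `γ(t) = exp(tξ)`. -/
def fundamentalField (E : Type*) [NormedAddCommGroup E] [NormedSpace ℝ E]
    {X : Type*} [TopologicalSpace X] [ChartedSpace E X] [MulAction K X]
    (ξ : GroupLieAlgebra 𝓘(ℝ, F) K) (m : X) : TangentSpace 𝓘(ℝ, E) m :=
  (mfderiv 𝓘(ℝ, F) 𝓘(ℝ, E) (fun k : K => k • m) 1 ξ : E)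

theorem hasMFDerivAt_smul_of_velocity [ContMDiffSMul 𝓘(ℝ, F) 𝓘(ℝ, E) ∞ K X]
    (ξ : GroupLieAlgebra 𝓘(ℝ, F) K) (m : X) (γ : ℝ → K) (h0 : γ 0 = 1)
    (hγ : MDifferentiableAt 𝓘(ℝ, ℝ) 𝓘(ℝ, F) γ 0)
    (hξ : (mfderiv 𝓘(ℝ, ℝ) 𝓘(ℝ, F) γ 0 (1 : ℝ) : F) = (ξ : F)) :
    MDifferentiableAt 𝓘(ℝ, ℝ) 𝓘(ℝ, E) (fun t => γ t • m) 0 ∧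
      (mfderiv 𝓘(ℝ, ℝ) 𝓘(ℝ, E) (fun t => γ t • m) 0 (1 : ℝ) : E) =
        (fundamentalField E ξ m : E) := by
  have hs : ContMDiff 𝓘(ℝ, F) 𝓘(ℝ, E) ∞ (fun k : K => k • m) :=
    ContMDiff.smul (I := 𝓘(ℝ, F)) contMDiff_id contMDiff_const
  have hd : MDifferentiableAt 𝓘(ℝ, F) 𝓘(ℝ, E) (fun k : K => k • m) (γ 0) :=
    hs.mdifferentiableAt (by simp)
  refine ⟨hd.comp (0 : ℝ) hγ, ?_⟩
  have hc := mfderiv_comp (0 : ℝ) hd hγ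
  have h1 : (mfderiv 𝓘(ℝ, F) 𝓘(ℝ, E) (fun k : K => k • m) (γ 0) : F →L[ℝ] E) =
      (mfderiv 𝓘(ℝ, F) 𝓘(ℝ, E) (fun k : K => k • m) 1 : F →L[ℝ] E) := by rw [h0]
  exact (congrArg (fun L : ℝ →L[ℝ] E => L 1) hc).trans
    ((congrArg (fun L : F →L[ℝ] E => L _) h1).trans
      (congrArg (mfderiv 𝓘(ℝ, F) 𝓘(ℝ, E) (fun k : K => k • m) 1 : F →L[ℝ] E) hξ))

/-- `α` is `K`-invariant: `k^* α = α` for all `k ∈ K`. -/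
def IsInvariantForm (K : Type*) [Group K] {E : Type*} [NormedAddCommGroup E] [NormedSpace ℝ E]
    {X : Type*} [TopologicalSpace X] [ChartedSpace E X] [MulAction K X]
    {k : ℕ} (α : DiffForm E X k) : Prop :=
  ∀ g : K, α.pullback (fun x => g • x) = α

/-- `α` is momentumly closed: `d(ι_{ξ_X} α) = 0` for all `ξ ∈ 𝔨`. -/
def IsMomentumlyClosed (F : Type*) [NormedAddCommGroup F] [NormedSpace ℝ F]
    (K : Type*) [TopologicalSpace K] [ChartedSpace F K] [Group K]
    {E : Type*} [NormedAddCommGroup E] [NormedSpace ℝ E]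
    {X : Type*} [TopologicalSpace X] [ChartedSpace E X] [MulAction K X]
    {k : ℕ} (α : DiffForm E X (k + 1)) : Prop :=
  ∀ ξ : GroupLieAlgebra 𝓘(ℝ, F) K, (α.contract (fundamentalField E ξ)).d = 0

/-- A set is `K`-invariant if it is mapped into itself by every `k ∈ K`. -/
def IsInvariantSet (K : Type*) [Group K] {X : Type*} [MulAction K X] (S : Set X) : Prop :=
  ∀ (k : K), ∀ x ∈ S, k • x ∈ S

end Action

end MomentumDarboux

end

open MomentumDarboux

open scoped Manifold ContDiff Topology

noncomputable section

set_option maxSynthPendingDepth 3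
set_option linter.unusedSectionVars false

namespace MomentumDarboux

open Set Filter Function

universe u v

/-! The proof is an equivariant Moser argument. Near `W` take a scaling retraction `r s`, with `r 1`
the identity and `r 0` a projection onto `W`. Its homotopy operator turns `σ = ω₁ - ω₀` into a
one-form `β`. Put `ω_t = ω₀ + t σ`, define `X_t` by `ω_t (X_t, ·) = -β`, and let `φ` be the time-one
map of `X_t`.

The forms need not be closed, so `dβ = σ` may fail and `φ^* ω₁ = ω₀` cannot be expected. The
contractions survive. Let `f` and `g` be local primitives of `ι_ξ ω₀` and `ι_ξ σ`. If `r s`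
preserves the fundamental field, the integrand of `β(ξ_X)` is the `s`-derivative of `-g(r s y)`.
Since `σ` vanishes along `W`, `g` is locally constant there, so `β(ξ_X) = g(y₀) - g`
(`LocalModel.β_apply_symmetry`). Therefore `f + t (g - g(y₀))`, a primitive of `ι_ξ ω_t`, is
constant along the flow lines (`LocalModel.primitive_φ`). Differentiating the relation between its
values at times `0` and `1`, and using that `φ` preserves `ξ_X`, gives the claim.

Equivariance comes from averaging. A map `i` on `X` yields `J x = (k ↦ i (k⁻¹ x))` in an `L²` space
over `K`, and `⟪J x, J y⟫` is `K`-invariant; finitely many such maps give an immersion along `W`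
(`exists_invariant_immersion`). The foot point `p y` in `W` is characterised by `J y - J (p y)`
being orthogonal to the image of the tangent space of `W`, and `r s y` by its covector `⟪J (r s y) -
J (p y), DJ (p y) ·⟫` being `s` times that of `y` (`nonempty_tube`). These are locally unique
solutions of equations in inner products alone, so local diffeomorphisms preserving `W` and the
inner products commute with `r s`; if they also preserve both forms, they commute with `φ`
(`LocalModel.IsMorphism.r_eq`, `LocalModel.IsMorphism.φ_eq`). Applied to group elements read in two
charts, this gives at once independence of the chart and equivariance.

The analysis rests on superposition operators on `C(K, E)` being smooth (`contDiff_superpose`). The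
flow is found by the inverse function theorem on paths (`LocalModel.nonempty_flow`): `β`, hence
`X_t`, has vanishing value and derivative at the base point, so the linearised problem is the
identity, and so is the derivative of `φ` there. Finally the local maps have equal germs along `W`,
glue to one map (`exists_eventuallyEq_of_germs`), and restrict to an equivariant diffeomorphism of
invariant neighbourhoods (`exists_equivariant_openPartialHomeomorph`). -/

/-! ### Superposition operators on spaces of continuous functions -/

section Superposition

/-- A family `f k : E → G`, `k ∈ K`, of smooth functions all of whose derivatives are continuous
in both variables. -/
structure IsSmoothFamily {K : Type*} [TopologicalSpace K] {E : Type*} [NormedAddCommGroup E]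
    [NormedSpace ℝ E] {G : Type*} [NormedAddCommGroup G] [NormedSpace ℝ G] (f : K → E → G) :
    Prop where
  contDiff : ∀ k, ContDiff ℝ ∞ (f k)
  continuous : ∀ n : ℕ, Continuous fun p : K × E => iteratedFDeriv ℝ n (f p.1) p.2

variable {K : Type*} [TopologicalSpace K]
variable {E : Type*} [NormedAddCommGroup E] [NormedSpace ℝ E]
variable {G : Type*} [NormedAddCommGroup G] [NormedSpace ℝ G]

theorem IsSmoothFamily.continuous_uncurry {f : K → E → G} (hf : IsSmoothFamily f) :
    Continuous fun p : K × E => f p.1 p.2 := by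
  have h := (continuousMultilinearCurryFin0 ℝ E G).continuous.comp (hf.continuous 0)
  exact h.congr fun p => by simp

theorem IsSmoothFamily.fderiv {f : K → E → G} (hf : IsSmoothFamily f) :
    IsSmoothFamily fun k => fderiv ℝ (f k) where
  contDiff k := (hf.contDiff k).fderiv_right (m := ∞) (by simp)
  continuous n := by
    have h := (continuousMultilinearCurryRightEquiv' ℝ n E G).continuous.comp
      (hf.continuous (n + 1))
    refine h.congr fun p => ?_
    simp only [Function.comp_apply, iteratedFDeriv_succ_eq_comp_right,
      LinearIsometryEquiv.apply_symm_apply]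

/-- The superposition operator `γ ↦ (k ↦ f k (γ k))`. -/
def superpose {f : K → E → G} (hf : IsSmoothFamily f) (γ : C(K, E)) : C(K, G) :=
  ⟨fun k => f k (γ k), hf.continuous_uncurry.comp (continuous_id.prodMk γ.continuous)⟩

@[simp] theorem superpose_apply {f : K → E → G} (hf : IsSmoothFamily f) (γ : C(K, E)) (k : K) :
    superpose hf γ k = f k (γ k) := rfl

variable [CompactSpace K]

/-- Pointwise application of a continuous family of continuous linear maps. -/
def pointwiseApply : C(K, E →L[ℝ] G) →L[ℝ] C(K, E) →L[ℝ] C(K, G) :=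
  LinearMap.mkContinuous₂
    (LinearMap.mk₂ ℝ (fun (A : C(K, E →L[ℝ] G)) (h : C(K, E)) =>
      (⟨fun k => A k (h k), A.continuous.clm_apply h.continuous⟩ : C(K, G)))
      (fun A B h => by ext; simp) (fun c A h => by ext; simp)
      (fun A h h' => by ext; simp) (fun c A h => by ext; simp)) 1 (fun A h => by
        rw [one_mul]
        refine (ContinuousMap.norm_le _ (by positivity)).2 fun k => ?_
        exact ((A k).le_opNorm (h k)).trans
          (mul_le_mul (A.norm_coe_le_norm k) (h.norm_coe_le_norm k) (norm_nonneg (h k))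
            (norm_nonneg A)))

@[simp] theorem pointwiseApply_apply (A : C(K, E →L[ℝ] G)) (h : C(K, E)) (k : K) :
    pointwiseApply A h k = A k (h k) := rfl

/-- Compactness of `K` makes the continuity of `fderiv ℝ (f k)` at `γ k` uniform in `k`. The mean
value inequality then bounds the remainder with one `δ` for all `k`, as the sup norm demands. -/
theorem hasFDerivAt_superpose {f : K → E → G} (hf : IsSmoothFamily f) (γ : C(K, E)) :
    HasFDerivAt (superpose hf) (pointwiseApply (superpose hf.fderiv γ)) γ := by
  rw [hasFDerivAt_iff_isLittleO_nhds_zero, Asymptotics.isLittleO_iff]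
  intro ε hε
  have hcont : Continuous fun p : K × E =>
      ‖fderiv ℝ (f p.1) (γ p.1 + p.2) - fderiv ℝ (f p.1) (γ p.1)‖ := by
    have h1 : Continuous fun p : K × E => fderiv ℝ (f p.1) (γ p.1 + p.2) :=
      hf.fderiv.continuous_uncurry.comp
        (continuous_fst.prodMk ((γ.continuous.comp continuous_fst).add continuous_snd))
    have h2 : Continuous fun p : K × E => fderiv ℝ (f p.1) (γ p.1) :=
      hf.fderiv.continuous_uncurry.comp
        (continuous_fst.prodMk (γ.continuous.comp continuous_fst))
    exact (h1.sub h2).norm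
  have hunif : ∀ᶠ v : E in 𝓝 0, ∀ k ∈ (univ : Set K),
      ‖fderiv ℝ (f k) (γ k + v) - fderiv ℝ (f k) (γ k)‖ < ε := by
    refine isCompact_univ.eventually_forall_of_forall_eventually fun k _ => ?_
    have h0 : Tendsto (fun p : E × K =>
        ‖fderiv ℝ (f p.2) (γ p.2 + p.1) - fderiv ℝ (f p.2) (γ p.2)‖) (𝓝 (0, k)) (𝓝 0) := by
      have := (hcont.comp continuous_swap).tendsto ((0 : E), k)
      simp only [Function.comp_def, Prod.fst_swap, Prod.snd_swap, add_zero, sub_self,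
        norm_zero] at this
      exact this
    exact h0.eventually (gt_mem_nhds hε)
  obtain ⟨δ, hδ, hball⟩ := Metric.eventually_nhds_iff_ball.1 hunif
  filter_upwards [Metric.ball_mem_nhds (0 : C(K, E)) hδ] with h hh
  refine (ContinuousMap.norm_le _ (by positivity)).2 fun k => ?_
  have hk : ‖h k‖ < δ := (h.norm_coe_le_norm k).trans_lt (by simpa using hh)
  have hmv := (convex_ball (γ k) δ).norm_image_sub_le_of_norm_hasFDerivWithin_le'
    (f := f k) (f' := fun x => fderiv ℝ (f k) x) (φ := fderiv ℝ (f k) (γ k)) (C := ε)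
    (x := γ k) (y := γ k + h k)
    (fun x _ => (((hf.contDiff k).differentiable (by simp)) x).hasFDerivAt.hasFDerivWithinAt)
    (fun x hx => by
      have := hball (x - γ k) (by simpa [dist_eq_norm] using hx) k (mem_univ _)
      simpa using this.le)
    (Metric.mem_ball_self hδ) (by simpa using hk)
  simp only [ContinuousMap.sub_apply, superpose_apply, ContinuousMap.add_apply,
    pointwiseApply_apply]
  simp only [add_sub_cancel_left] at hmv
  exact hmv.trans (mul_le_mul_of_nonneg_left (h.norm_coe_le_norm k) hε.le)

end Superposition

/-- The derivative of a superposition operator is the superposition operator of `fderiv ℝ (f k)`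
followed by the bounded linear map `pointwiseApply`, which gives the induction. `E` and `G` share a
universe so that the induction can pass from `G` to `E →L[ℝ] G`. -/
theorem contDiff_superpose_nat {K : Type v} [TopologicalSpace K] [CompactSpace K]
    {E : Type u} [NormedAddCommGroup E] [NormedSpace ℝ E] (n : ℕ) :
    ∀ {G : Type u} [NormedAddCommGroup G] [NormedSpace ℝ G] {f : K → E → G}
      (hf : IsSmoothFamily f), ContDiff ℝ n (superpose hf) := by
  induction n with
  | zero =>
    intro G _ _ f hf
    exact contDiff_zero.2 (continuous_iff_continuousAt.2 fun γ =>
      (hasFDerivAt_superpose hf γ).continuousAt)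
  | succ n ih =>
    intro G _ _ f hf
    have : ((n + 1 : ℕ) : WithTop ℕ∞) = (n : WithTop ℕ∞) + 1 := by norm_cast
    rw [this]
    refine (contDiff_succ_iff_hasFDerivAt (n := n)).2
      ⟨fun γ => pointwiseApply (superpose hf.fderiv γ), ?_, hasFDerivAt_superpose hf⟩
    exact pointwiseApply.contDiff.comp (ih hf.fderiv)

/-- Superposition operators of smooth families are smooth. -/
theorem contDiff_superpose {K : Type v} [TopologicalSpace K] [CompactSpace K]
    {E : Type u} [NormedAddCommGroup E] [NormedSpace ℝ E]
    {G : Type u} [NormedAddCommGroup G] [NormedSpace ℝ G] {f : K → E → G}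
    (hf : IsSmoothFamily f) : ContDiff ℝ ∞ (superpose hf) :=
  contDiff_infty.2 fun n => contDiff_superpose_nat n hf

/-! ### Families that are locally the restriction of smooth functions of both variables -/

section Local

variable {P : Type*} [NormedAddCommGroup P] [NormedSpace ℝ P]
variable {K : Type*} [TopologicalSpace K]
variable {E : Type*} [NormedAddCommGroup E] [NormedSpace ℝ E]
variable {G : Type*} [NormedAddCommGroup G] [NormedSpace ℝ G]

/-- The next partial derivative is the joint derivative of the previous one composed with `inr`.
This supplies the continuity clause of `IsSmoothFamily`. -/
theorem contDiffAt_iteratedFDeriv_slice {g : P × E → G} {z : P × E} (hg : ContDiffAt ℝ ∞ g z)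
    (n : ℕ) :
    ContDiffAt ℝ ∞ (fun w : P × E => iteratedFDeriv ℝ n (fun x => g (w.1, x)) w.2) z := by
  induction n with
  | zero =>
    have := (continuousMultilinearCurryFin0 ℝ E G).symm.contDiff.contDiffAt.comp z hg
    exact this.congr_of_eventuallyEq (Eventually.of_forall fun w => rfl)
  | succ n ih =>
    set D : P × E → E [×n]→L[ℝ] G := fun w => iteratedFDeriv ℝ n (fun x => g (w.1, x)) w.2 with hD
    have h1 : ContDiffAt ℝ ∞ (fderiv ℝ D) z := ih.fderiv_right (m := ∞) (by simp)
    have h2 : ContDiffAt ℝ ∞ (fun w => (fderiv ℝ D w).comp (ContinuousLinearMap.inr ℝ P E)) z :=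
      h1.clm_comp contDiffAt_const
    have h3 := (continuousMultilinearCurryLeftEquiv ℝ (fun _ : Fin (n + 1) => E)
      G).symm.contDiff.contDiffAt.comp z h2
    have h4 : ∀ᶠ w in 𝓝 z, DifferentiableAt ℝ D w := by
      have : ∀ᶠ w in 𝓝 z, ContDiffAt ℝ 1 D w :=
        (ih.of_le (by exact_mod_cast le_top)).eventually (by simp)
      exact this.mono fun w hw => hw.differentiableAt (by simp)
    refine h3.congr_of_eventuallyEq (h4.mono fun w hw => ?_)
    have h5 : HasFDerivAt (fun x => iteratedFDeriv ℝ n (fun x => g (w.1, x)) x)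
        ((fderiv ℝ D w).comp (ContinuousLinearMap.inr ℝ P E)) w.2 := by
      have := HasFDerivAt.comp (g := D) w.2 (f := fun x => (w.1, x))
        (by exact hw.hasFDerivAt) (hasFDerivAt_prodMk_right w.1 w.2)
      exact this
    simp only [iteratedFDeriv_succ_eq_comp_left, Function.comp_apply, h5.fderiv]

/-- Near `(k₀, x₀)` the family `f` is the composition of a function `P × E → G`, smooth at the
relevant point, with a continuous map `K → P`. -/
def SmoothFamilyAt (P : Type*) [NormedAddCommGroup P] [NormedSpace ℝ P]
    {K : Type*} [TopologicalSpace K] {E : Type*} [NormedAddCommGroup E] [NormedSpace ℝ E]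
    {G : Type*} [NormedAddCommGroup G] [NormedSpace ℝ G] (f : K → E → G) (k₀ : K) (x₀ : E) :
    Prop :=
  ∃ (c : K → P) (g : P × E → G), ContinuousAt c k₀ ∧ ContDiffAt ℝ ∞ g (c k₀, x₀) ∧
    ∀ᶠ z : K × E in 𝓝 (k₀, x₀), f z.1 z.2 = g (c z.1, z.2)

/-- Continuity of `c` suffices because smooth families are only asked to be continuous in `k`. Later
`P` is `ℝ` for the unit interval and the model space `F` for the Lie group. -/
theorem isSmoothFamily_of_forall_smoothFamilyAt {f : K → E → G}
    (hf : ∀ k x, SmoothFamilyAt P f k x) : IsSmoothFamily f where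
  contDiff k := contDiff_iff_contDiffAt.2 fun x => by
    obtain ⟨c, g, _, hg, he⟩ := hf k x
    have h1 : ContDiffAt ℝ ∞ (fun y => g (c k, y)) x :=
      ContDiffAt.comp x hg (contDiffAt_const.prodMk contDiffAt_id)
    refine h1.congr_of_eventuallyEq ?_
    exact (Continuous.prodMk_right k).continuousAt.eventually he
  continuous n := continuous_iff_continuousAt.2 fun ⟨k, x⟩ => by
    obtain ⟨c, g, hc, hg, he⟩ := hf k x
    have h1 := (contDiffAt_iteratedFDeriv_slice hg n).continuousAt
    have h2 : ContinuousAt (fun z : K × E => (c z.1, z.2)) (k, x) :=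
      (ContinuousAt.comp (f := Prod.fst) (x := (k, x)) hc continuousAt_fst).prodMk continuousAt_snd
    have h3 := ContinuousAt.comp (f := fun z : K × E => (c z.1, z.2)) (x := (k, x)) h1 h2
    refine h3.congr ?_
    filter_upwards [eventually_eventually_nhds.2 he] with z hz
    have h4 : f z.1 =ᶠ[𝓝 z.2] fun x => g (c z.1, x) :=
      (Continuous.prodMk_right z.1).continuousAt.eventually hz
    exact (h4.iteratedFDeriv ℝ n).eq_of_nhds.symm

/-- Near a point, a family that is smooth over an open set agrees with a globally smooth family. -/
theorem exists_isSmoothFamily_eventuallyEq [FiniteDimensional ℝ E] {f : K → E → G} {U : Set E}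
    (hU : IsOpen U) (hf : ∀ k, ∀ x ∈ U, SmoothFamilyAt P f k x) {x₀ : E} (hx₀ : x₀ ∈ U) :
    ∃ f' : K → E → G, IsSmoothFamily f' ∧ ∀ᶠ x in 𝓝 x₀, ∀ k, f' k x = f k x := by
  obtain ⟨χ, hχ⟩ : ∃ χ : ContDiffBump x₀, tsupport χ ⊆ U := by
    obtain ⟨ε, hε, hb⟩ := Metric.isOpen_iff.1 hU x₀ hx₀
    refine ⟨⟨ε / 4, ε / 2, by positivity, by linarith⟩, ?_⟩
    rw [ContDiffBump.tsupport_eq]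
    exact (Metric.closedBall_subset_ball (by simp only; linarith)).trans hb
  refine ⟨fun k x => χ x • f k x, isSmoothFamily_of_forall_smoothFamilyAt (P := P) fun k x => ?_,
    ?_⟩
  · by_cases hx : x ∈ U
    · obtain ⟨c, g, hc, hg, he⟩ := hf k x hx
      refine ⟨c, fun z => χ z.2 • g z, hc, ?_, he.mono fun z hz => by simp only [hz]⟩
      exact (ContDiffAt.comp (c k, x) χ.contDiff.contDiffAt contDiffAt_snd).smul hg
    -- Outside `U` nothing is known about `f`, but there the cutoff vanishes near the point.
    · refine ⟨fun _ => 0, fun _ => 0, continuousAt_const, contDiffAt_const, ?_⟩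
      have h0 : ∀ᶠ y in 𝓝 x, χ y = 0 := by
        have := notMem_tsupport_iff_eventuallyEq.1 (fun h => hx (hχ h))
        exact this
      exact (continuousAt_snd.eventually h0).mono fun z hz => by simp only [hz, zero_smul]
  · filter_upwards [χ.eventuallyEq_one] with x hx k
    simp only [hx, Pi.one_apply, one_smul]

end Local

/-! ### Integration of continuous functions on the unit interval -/

section Volterra

variable {E : Type*} [NormedAddCommGroup E] [NormedSpace ℝ E]

/-- The Volterra operator `u ↦ (t ↦ ∫₀ᵗ u)` on continuous functions on `[0, 1]`. -/
def volterra : C(unitInterval, E) →L[ℝ] C(unitInterval, E) :=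
  LinearMap.mkContinuous
    { toFun := fun u => ⟨fun t => ∫ s in (0 : ℝ)..t, u (projIcc 0 1 zero_le_one s), by
        have : Continuous fun t : ℝ => ∫ s in (0 : ℝ)..t, u (projIcc 0 1 zero_le_one s) :=
          intervalIntegral.continuous_primitive
            (fun a b => (u.continuous.comp continuous_projIcc).intervalIntegrable a b) 0
        exact this.comp continuous_subtype_val⟩
      map_add' := fun u v => by
        ext t
        exact intervalIntegral.integral_add
          ((u.continuous.comp continuous_projIcc).intervalIntegrable _ _)
          ((v.continuous.comp continuous_projIcc).intervalIntegrable _ _)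
      map_smul' := fun c u => by
        ext t
        exact intervalIntegral.integral_smul c _ } 1 (fun u => by
    rw [one_mul]
    refine (ContinuousMap.norm_le _ (norm_nonneg _)).2 fun t => ?_
    have h := intervalIntegral.norm_integral_le_of_norm_le_const (a := 0) (b := (t : ℝ))
      (f := fun s => u (projIcc 0 1 zero_le_one s)) (C := ‖u‖) (fun s _ => u.norm_coe_le_norm _)
    refine h.trans ?_
    rw [sub_zero, abs_of_nonneg t.2.1]
    exact mul_le_of_le_one_right (norm_nonneg _) t.2.2)

theorem volterra_apply (u : C(unitInterval, E)) (t : unitInterval) :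
    volterra u t = ∫ s in (0 : ℝ)..t, u (projIcc 0 1 zero_le_one s) := rfl

variable [CompleteSpace E]

/-- A path on the unit interval satisfies an integral equation iff it has the prescribed starting
point and velocity. -/
theorem eq_const_add_volterra_iff (η u : C(unitInterval, E)) (x : E) :
    η = ContinuousMap.const _ x + volterra u ↔ η 0 = x ∧ ∀ t : unitInterval,
      HasDerivWithinAt (fun s => η (projIcc 0 1 zero_le_one s)) (u t) (Icc 0 1) t := by
  have hu : Continuous fun s : ℝ => u (projIcc 0 1 zero_le_one s) :=
    u.continuous.comp continuous_projIcc
  have hv : ∀ t : ℝ, HasDerivAt (fun t : ℝ => ∫ s in (0 : ℝ)..t, u (projIcc 0 1 zero_le_one s))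
      (u (projIcc 0 1 zero_le_one t)) t := fun t =>
    intervalIntegral.integral_hasDerivAt_right (hu.intervalIntegrable _ _)
      (hu.stronglyMeasurableAtFilter _ _) hu.continuousAt
  constructor
  · intro h
    refine ⟨by rw [h]; simp [volterra_apply], fun t => ?_⟩
    have h1 := ((hv t).const_add x).hasDerivWithinAt (s := Icc 0 1)
    rw [projIcc_val] at h1
    refine h1.congr_of_mem (fun s hs => ?_) t.2
    rw [h]
    simp [volterra_apply, projIcc_of_mem _ hs]
  · rintro ⟨h0, hd⟩
    ext t
    have hder : ∀ s ∈ Ico (0 : ℝ) 1, HasDerivWithinAt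
        (fun s => η (projIcc 0 1 zero_le_one s)) (u (projIcc 0 1 zero_le_one s)) (Ici s) s := by
      intro s hs
      have h1 := hd ⟨s, hs.1, hs.2.le⟩
      have h2 : u (projIcc 0 1 zero_le_one s) = u ⟨s, hs.1, hs.2.le⟩ := by
        rw [projIcc_of_mem _ ⟨hs.1, hs.2.le⟩]
      rw [h2]
      exact h1.mono_of_mem_nhdsWithin
        (mem_of_superset (Icc_mem_nhdsGE_of_mem hs) subset_rfl)
    have hder2 : ∀ s ∈ Ico (0 : ℝ) 1, HasDerivWithinAt
        (fun t : ℝ => x + ∫ s in (0 : ℝ)..t, u (projIcc 0 1 zero_le_one s))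
        (u (projIcc 0 1 zero_le_one s)) (Ici s) s := fun s _ =>
      ((hv s).const_add x).hasDerivWithinAt
    have key := eq_of_derivWithin_eq (f := fun s => η (projIcc 0 1 zero_le_one s))
      (g := fun t : ℝ => x + ∫ s in (0 : ℝ)..t, u (projIcc 0 1 zero_le_one s))
      (a := 0) (b := 1)
      (fun s hs => (hd ⟨s, hs⟩).differentiableWithinAt)
      (fun s hs => ((hv s).const_add x).differentiableAt.differentiableWithinAt)
      (fun s hs => by
        have hs' : s ∈ Icc (0 : ℝ) 1 := ⟨hs.1, hs.2.le⟩
        have hU : UniqueDiffWithinAt ℝ (Icc (0 : ℝ) 1) s := uniqueDiffOn_Icc one_pos s hs'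
        rw [(hd ⟨s, hs'⟩).derivWithin hU, ((hv s).const_add x).hasDerivWithinAt.derivWithin hU,
          projIcc_of_mem _ hs'])
      (by
        simp [h0])
    have := key t t.2
    simp only [projIcc_val] at this
    simpa [volterra_apply] using this

end Volterra

/-! ### The inverse function theorem for smooth maps -/

/-- The source is cut down to the open set where the derivative is invertible, so that the inverse
is smooth on the whole target and not only near `f a`. Banach spaces are allowed because the lemma
is also applied to a space of paths. -/
theorem exists_smooth_localInverse {E : Type*} [NormedAddCommGroup E] [NormedSpace ℝ E]
    [CompleteSpace E] {F : Type*} [NormedAddCommGroup F] [NormedSpace ℝ F] [CompleteSpace F]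
    {f : E → F} {T : Set E} (hT : IsOpen T) (hf : ContDiffOn ℝ ∞ f T) {a : E} (ha : a ∈ T)
    (f' : E ≃L[ℝ] F) (hf' : HasFDerivAt f (f' : E →L[ℝ] F) a) :
    ∃ Φ : OpenPartialHomeomorph E F, a ∈ Φ.source ∧ Φ.source ⊆ T ∧ (∀ x, Φ x = f x) ∧
      ContDiffOn ℝ ∞ Φ.symm Φ.target ∧ HasFDerivAt Φ.symm (f'.symm : F →L[ℝ] E) (f a) := by
  have hfa : ContDiffAt ℝ ∞ f a := hf.contDiffAt (hT.mem_nhds ha)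
  have hstrict : HasStrictFDerivAt f (f' : E →L[ℝ] F) a :=
    hfa.hasStrictFDerivAt' hf' (by simp)
  let Ψ := hstrict.toOpenPartialHomeomorph f
  have hΨ : ∀ x, Ψ x = f x := fun x => rfl
  let U : Set E := T ∩ fderiv ℝ f ⁻¹' range ((↑) : (E ≃L[ℝ] F) → E →L[ℝ] F)
  have hU : IsOpen U :=
    (hf.continuousOn_fderiv_of_isOpen hT (by simp)).isOpen_inter_preimage hT
      (ContinuousLinearEquiv.isOpen)
  have haU : a ∈ U := ⟨ha, f', hf'.fderiv.symm⟩
  refine ⟨Ψ.restrOpen U hU, ⟨hstrict.mem_toOpenPartialHomeomorph_source, haU⟩, fun x hx => hx.2.1,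
    hΨ, ?_, ?_⟩
  · intro y hy
    have hy' := (Ψ.restrOpen U hU).map_target hy
    obtain ⟨e, he⟩ := hy'.2.2
    refine ContDiffAt.contDiffWithinAt ?_
    have hd : DifferentiableAt ℝ f ((Ψ.restrOpen U hU).symm y) :=
      (hf.contDiffAt (hT.mem_nhds hy'.2.1)).differentiableAt (by simp)
    refine (Ψ.restrOpen U hU).contDiffAt_symm (f₀' := e) hy ?_
      (hf.contDiffAt (hT.mem_nhds hy'.2.1))
    rw [he]
    exact hd.hasFDerivAt
  · have := (Ψ.restrOpen U hU).hasFDerivAt_symm (f' := f') (a := f a) ?_ ?_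
    · exact this
    · exact (Ψ.restrOpen U hU).map_source ⟨hstrict.mem_toOpenPartialHomeomorph_source, haU⟩
    · have h1 : (Ψ.restrOpen U hU).symm (f a) = a :=
        (Ψ.restrOpen U hU).left_inv ⟨hstrict.mem_toOpenPartialHomeomorph_source, haU⟩
      rw [h1]
      exact hf'

/-! ### Tubular neighbourhoods defined by an immersion into a Hilbert space -/

section Tube

variable {E : Type*} [NormedAddCommGroup E] [NormedSpace ℝ E]
variable {H : Type*} [NormedAddCommGroup H] [InnerProductSpace ℝ H]

/-- The covector `v ↦ ⟪J y - J w, DJ(w) v⟫` at `w`. -/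
def conormal (J : E → H) (w y : E) : E →L[ℝ] ℝ :=
  (innerSL ℝ (J y - J w)).comp (fderiv ℝ J w)

theorem conormal_apply (J : E → H) (w y v : E) :
    conormal J w y v = inner ℝ (J y - J w) (fderiv ℝ J w v) := rfl

@[simp] theorem conormal_self (J : E → H) (w : E) : conormal J w w = 0 := by
  ext v; simp [conormal_apply]

/-- A scaling retraction `r s`, `0 ≤ s ≤ 1`, of a neighbourhood `V` of `y₀` onto its intersection
with the subspace `S`, characterised by the conormal covectors of `J`. -/
structure Tube (S : Submodule ℝ E) (T : Set E) (J : E → H) (y₀ : E) where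
  r : ℝ → E → E
  p : E → E
  V : Set E
  O : Set E
  isOpen_V : IsOpen V
  isOpen_O : IsOpen O
  mem_V : y₀ ∈ V
  V_subset : V ⊆ O
  O_subset : O ⊆ T
  -- The open interval leaves room around `[0, 1]` for two-sided derivatives in `s`.
  contDiffOn_r : ContDiffOn ℝ ∞ (uncurry r) (Ioo (-1) 2 ×ˢ V)
  continuousOn_p : ContinuousOn p V
  p_mem : ∀ y ∈ V, p y ∈ S
  p_mem_O : ∀ y ∈ V, p y ∈ O
  conormal_p : ∀ y ∈ V, ∀ v ∈ S, conormal J (p y) y v = 0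
  r_mem_O : ∀ y ∈ V, ∀ s ∈ Ioo (-1 : ℝ) 2, r s y ∈ O
  conormal_r : ∀ y ∈ V, ∀ s ∈ Ioo (-1 : ℝ) 2, conormal J (p y) (r s y) = s • conormal J (p y) y
  -- The two uniqueness clauses make `p` and `r` canonical; all naturality statements rest on them.
  unique_p : ∀ y ∈ O, ∀ w ∈ O, ∀ w' ∈ O, w ∈ S → w' ∈ S → (∀ v ∈ S, conormal J w y v = 0) →
    (∀ v ∈ S, conormal J w' y v = 0) → w = w'
  unique_r : ∀ w ∈ O, ∀ y ∈ O, ∀ y' ∈ O, conormal J w y = conormal J w y' → y = y'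

namespace Tube

variable {S : Submodule ℝ E} {T : Set E} {J : E → H} {y₀ : E} (τ : Tube S T J y₀)

theorem p_eq_self {y : E} (hy : y ∈ τ.V) (hyS : y ∈ S) : τ.p y = y :=
  τ.unique_p y (τ.V_subset hy) _ (τ.p_mem_O y hy) y (τ.V_subset hy) (τ.p_mem y hy) hyS
    (τ.conormal_p y hy) (by simp)

theorem r_one {y : E} (hy : y ∈ τ.V) : τ.r 1 y = y :=
  τ.unique_r _ (τ.p_mem_O y hy) _ (τ.r_mem_O y hy 1 (by norm_num)) _ (τ.V_subset hy)
    (by rw [τ.conormal_r y hy 1 (by norm_num), one_smul])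

theorem r_zero {y : E} (hy : y ∈ τ.V) : τ.r 0 y = τ.p y :=
  τ.unique_r _ (τ.p_mem_O y hy) _ (τ.r_mem_O y hy 0 (by norm_num)) _ (τ.p_mem_O y hy)
    (by rw [τ.conormal_r y hy 0 (by norm_num), zero_smul, conormal_self])

theorem r_eq_self {y : E} (hy : y ∈ τ.V) (hyS : y ∈ S) {s : ℝ} (hs : s ∈ Ioo (-1 : ℝ) 2) :
    τ.r s y = y :=
  τ.unique_r _ (τ.p_mem_O y hy) _ (τ.r_mem_O y hy s hs) _ (τ.V_subset hy)
    (by rw [τ.conormal_r y hy s hs, τ.p_eq_self hy hyS, conormal_self, smul_zero])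

end Tube

/-! ### Construction of tubes by the inverse function theorem -/

theorem contDiffOn_conormal {J : E → H} {T : Set E} (hT : IsOpen T) (hJ : ContDiffOn ℝ ∞ J T) :
    ContDiffOn ℝ ∞ (fun z : E × E => conormal J z.1 z.2) (T ×ˢ T) := by
  have h1 : ContDiffOn ℝ ∞ (fun z : E × E => J z.1) (T ×ˢ T) :=
    hJ.comp contDiff_fst.contDiffOn fun z hz => hz.1
  have h2 : ContDiffOn ℝ ∞ (fun z : E × E => J z.2) (T ×ˢ T) :=
    hJ.comp contDiff_snd.contDiffOn fun z hz => hz.2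
  have h3 : ContDiffOn ℝ ∞ (fun z : E × E => fderiv ℝ J z.1) (T ×ˢ T) :=
    (hJ.fderiv_of_isOpen hT (m := ∞) (by simp)).comp contDiff_fst.contDiffOn fun z hz => hz.1
  exact ((innerSL ℝ).contDiff.comp_contDiffOn (h2.sub h1)).clm_comp h3

/-- The bilinear form induced on `E` by a linear map to a Hilbert space. -/
def inducedForm (A : E →L[ℝ] H) : E →L[ℝ] E →L[ℝ] ℝ :=
  ((ContinuousLinearMap.compL ℝ E H ℝ).flip A).comp ((innerSL ℝ).comp A)

theorem inducedForm_apply (A : E →L[ℝ] H) (u v : E) : inducedForm A u v = inner ℝ (A u) (A v) :=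
  rfl

theorem eq_zero_of_inducedForm_self {A : E →L[ℝ] H} (hA : Injective A) {v : E}
    (hv : inducedForm A v v = 0) : v = 0 := by
  rw [inducedForm_apply, inner_self_eq_zero] at hv
  exact hA (by rw [hv, map_zero])

/-- On the diagonal the factor `J y - J w` vanishes, so the second derivative of `J` drops out. -/
theorem hasFDerivAt_conormal {J : E → H} {T : Set E} (hT : IsOpen T) (hJ : ContDiffOn ℝ ∞ J T)
    {y₀ : E} (hy₀ : y₀ ∈ T) :
    HasFDerivAt (fun z : E × E => conormal J z.1 z.2)
      ((inducedForm (fderiv ℝ J y₀)).comp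
        (ContinuousLinearMap.snd ℝ E E - ContinuousLinearMap.fst ℝ E E)) (y₀, y₀) := by
  have hJ0 : ContDiffAt ℝ ∞ J y₀ := hJ.contDiffAt (hT.mem_nhds hy₀)
  have hd : HasFDerivAt J (fderiv ℝ J y₀) y₀ := (hJ0.differentiableAt (by simp)).hasFDerivAt
  have h1 : HasFDerivAt (fun z : E × E => J z.1)
      ((fderiv ℝ J y₀).comp (ContinuousLinearMap.fst ℝ E E)) (y₀, y₀) :=
    HasFDerivAt.comp (g := J) (y₀, y₀) hd hasFDerivAt_fst
  have h2 : HasFDerivAt (fun z : E × E => J z.2)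
      ((fderiv ℝ J y₀).comp (ContinuousLinearMap.snd ℝ E E)) (y₀, y₀) :=
    HasFDerivAt.comp (g := J) (y₀, y₀) hd hasFDerivAt_snd
  have hDD : DifferentiableAt ℝ (fderiv ℝ J) y₀ :=
    ((hJ0.fderiv_right (m := ∞) (by simp)).differentiableAt (by simp))
  have h3 : HasFDerivAt (fun z : E × E => fderiv ℝ J z.1)
      ((fderiv ℝ (fderiv ℝ J) y₀).comp (ContinuousLinearMap.fst ℝ E E)) (y₀, y₀) :=
    HasFDerivAt.comp (g := fderiv ℝ J) (y₀, y₀) hDD.hasFDerivAt hasFDerivAt_fst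
  have h4 := ((innerSL ℝ (E := H)).hasFDerivAt.comp (y₀, y₀) (h2.sub h1)).clm_comp h3
  refine h4.congr_fderiv ?_
  ext z v <;> simp [inducedForm_apply] <;> rfl

variable [FiniteDimensional ℝ E]

theorem finrank_clm_real (V : Type*) [NormedAddCommGroup V] [NormedSpace ℝ V]
    [FiniteDimensional ℝ V] : Module.finrank ℝ (V →L[ℝ] ℝ) = Module.finrank ℝ V := by
  rw [← (LinearMap.toContinuousLinearMap (𝕜 := ℝ) (E := V) (F' := ℝ)).finrank_eq]
  exact Subspace.dual_finrank_eq

/-- An injective continuous linear map between spaces of the same finite dimension. -/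
def clmEquivOfInjective {V V' : Type*} [NormedAddCommGroup V] [NormedSpace ℝ V]
    [FiniteDimensional ℝ V] [NormedAddCommGroup V'] [NormedSpace ℝ V'] [FiniteDimensional ℝ V']
    (A : V →L[ℝ] V') (hA : Injective A) (hd : Module.finrank ℝ V = Module.finrank ℝ V') :
    V ≃L[ℝ] V' :=
  (LinearMap.linearEquivOfInjective (A : V →ₗ[ℝ] V') hA hd).toContinuousLinearEquiv

theorem coe_clmEquivOfInjective {V V' : Type*} [NormedAddCommGroup V] [NormedSpace ℝ V]
    [FiniteDimensional ℝ V] [NormedAddCommGroup V'] [NormedSpace ℝ V'] [FiniteDimensional ℝ V']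
    (A : V →L[ℝ] V') (hA : Injective A) (hd : Module.finrank ℝ V = Module.finrank ℝ V') :
    (clmEquivOfInjective A hA hd : V →L[ℝ] V') = A := by
  ext v; rfl

/-- The linearisation `(a, b) ↦ (a, ⟪A (b - a), A ·⟫)` is injective because `A` is, and the
dimensions agree. The inverse recovers a point from a base point and a conormal covector, which is
how `r` is defined. -/
theorem exists_conormal_localInverse {T : Set E} {J : E → H} (hT : IsOpen T)
    (hJ : ContDiffOn ℝ ∞ J T) {y₀ : E} (hy₀ : y₀ ∈ T) (hinj : Injective (fderiv ℝ J y₀)) :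
    ∃ Φ : OpenPartialHomeomorph (E × E) (E × (E →L[ℝ] ℝ)), (y₀, y₀) ∈ Φ.source ∧
      Φ.source ⊆ T ×ˢ T ∧ (∀ z, Φ z = (z.1, conormal J z.1 z.2)) ∧
      ContDiffOn ℝ ∞ Φ.symm Φ.target := by
  set A := fderiv ℝ J y₀
  let L : E × E →L[ℝ] E × (E →L[ℝ] ℝ) := (ContinuousLinearMap.fst ℝ E E).prod
    ((inducedForm A).comp (ContinuousLinearMap.snd ℝ E E - ContinuousLinearMap.fst ℝ E E))
  have hL : Injective L := by
    rw [injective_iff_map_eq_zero]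
    rintro ⟨a, b⟩ h
    have h1 : a = 0 := congrArg Prod.fst h
    have h2 : inducedForm A (b - a) = 0 := congrArg Prod.snd h
    rw [h1, sub_zero] at h2
    have h3 : b = 0 := eq_zero_of_inducedForm_self hinj (by rw [h2]; rfl)
    rw [h1, h3]; rfl
  have hdim : Module.finrank ℝ (E × E) = Module.finrank ℝ (E × (E →L[ℝ] ℝ)) := by
    rw [Module.finrank_prod, Module.finrank_prod, finrank_clm_real]
  have hder : HasFDerivAt (fun z : E × E => (z.1, conormal J z.1 z.2))
      (clmEquivOfInjective L hL hdim : E × E →L[ℝ] E × (E →L[ℝ] ℝ)) (y₀, y₀) := by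
    rw [coe_clmEquivOfInjective]
    exact hasFDerivAt_fst.prodMk (hasFDerivAt_conormal hT hJ hy₀)
  obtain ⟨Φ, h1, h2, h3, h4, -⟩ := exists_smooth_localInverse (hT.prod hT)
    (contDiff_fst.contDiffOn.prodMk (contDiffOn_conormal hT hJ)) (a := (y₀, y₀)) ⟨hy₀, hy₀⟩ _ hder
  exact ⟨Φ, h1, h2, h3, h4⟩

/-- In the direction of `V` the linearisation is minus the inner product induced by `A`, which is
definite. The inverse at `(0, y)` yields the foot point of `y` when `V` is the subspace `S`. -/
theorem exists_projection_localInverse {V : Type*} [NormedAddCommGroup V] [NormedSpace ℝ V]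
    [FiniteDimensional ℝ V] (i : V →L[ℝ] E) (hi : Injective i) {T : Set E} {J : E → H}
    (hT : IsOpen T) (hJ : ContDiffOn ℝ ∞ J T) (y₀ : V) (hy₀ : i y₀ ∈ T)
    (hinj : Injective (fderiv ℝ J (i y₀))) :
    ∃ Φ : OpenPartialHomeomorph (V × E) ((V →L[ℝ] ℝ) × E), (y₀, i y₀) ∈ Φ.source ∧
      (∀ z : V × E, Φ z = ((conormal J (i z.1) z.2).comp i, z.2)) ∧
      ContDiffOn ℝ ∞ Φ.symm Φ.target := by
  set A := fderiv ℝ J (i y₀)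
  let ι : V × E →L[ℝ] E × E := i.prodMap (ContinuousLinearMap.id ℝ E)
  let R : (E →L[ℝ] ℝ) →L[ℝ] (V →L[ℝ] ℝ) := (ContinuousLinearMap.compL ℝ V E ℝ).flip i
  let L : V × E →L[ℝ] (V →L[ℝ] ℝ) × E := (R.comp (((inducedForm A).comp
    (ContinuousLinearMap.snd ℝ E E - ContinuousLinearMap.fst ℝ E E)).comp ι)).prod
      (ContinuousLinearMap.snd ℝ V E)
  have hL : Injective L := by
    rw [injective_iff_map_eq_zero]
    rintro ⟨a, b⟩ h
    have h1 : b = 0 := congrArg Prod.snd h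
    have h2 : (inducedForm A (b - i a)).comp i = 0 := congrArg Prod.fst h
    have h3 : inducedForm A (b - i a) (i a) = 0 := congrArg (fun B : V →L[ℝ] ℝ => B a) h2
    rw [h1, zero_sub, map_neg, _root_.neg_apply, neg_eq_zero] at h3
    have h4 : a = 0 := hi (by rw [eq_zero_of_inducedForm_self hinj h3, map_zero])
    rw [h1, h4]; rfl
  have hdim : Module.finrank ℝ (V × E) = Module.finrank ℝ ((V →L[ℝ] ℝ) × E) := by
    rw [Module.finrank_prod, Module.finrank_prod, finrank_clm_real]
  have hder : HasFDerivAt (fun z : V × E => ((conormal J (i z.1) z.2).comp i, z.2))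
      (clmEquivOfInjective L hL hdim : V × E →L[ℝ] (V →L[ℝ] ℝ) × E) (y₀, i y₀) := by
    rw [coe_clmEquivOfInjective]
    refine HasFDerivAt.prodMk ?_ hasFDerivAt_snd
    exact R.hasFDerivAt.comp (y₀, i y₀) (HasFDerivAt.comp (y₀, i y₀)
      (g := fun z : E × E => conormal J z.1 z.2) (f := ι)
      (hasFDerivAt_conormal hT hJ hy₀) ι.hasFDerivAt)
  have hsm : ContDiffOn ℝ ∞ (fun z : V × E => ((conormal J (i z.1) z.2).comp i, z.2))
      (ι ⁻¹' (T ×ˢ T)) := by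
    refine ContDiffOn.prodMk ?_ contDiff_snd.contDiffOn
    exact R.contDiff.comp_contDiffOn
      ((contDiffOn_conormal hT hJ).comp ι.contDiff.contDiffOn (fun z hz => hz))
  obtain ⟨Φ, h1, -, h3, h4, -⟩ := exists_smooth_localInverse
    ((hT.prod hT).preimage ι.continuous) hsm (a := (y₀, i y₀)) ⟨hy₀, hy₀⟩ _ hder
  exact ⟨Φ, h1, h3, h4⟩

theorem nonempty_tube (S : Submodule ℝ E) {T : Set E} {J : E → H} (hT : IsOpen T)
    (hJ : ContDiffOn ℝ ∞ J T) {y₀ : E} (hyS : y₀ ∈ S) (hy₀ : y₀ ∈ T)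
    (hinj : Injective (fderiv ℝ J y₀)) : Nonempty (Tube S T J y₀) := by
  obtain ⟨Φ, hΦ0, hΦT, hΦ, hΦs⟩ := exists_conormal_localInverse hT hJ hy₀ hinj
  obtain ⟨Ψ, hΨ0, hΨ, hΨs⟩ := exists_projection_localInverse S.subtypeL
    Subtype.val_injective hT hJ ⟨y₀, hyS⟩ hy₀ hinj
  -- a neighbourhood on which both maps are injective
  obtain ⟨O₁, hO₁, hO₁Φ⟩ : ∃ O₁ ∈ 𝓝 y₀, O₁ ×ˢ O₁ ⊆ Φ.source := by
    obtain ⟨a, ha, b, hb, hab⟩ := mem_nhds_prod_iff.1 (Φ.open_source.mem_nhds hΦ0)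
    exact ⟨a ∩ b, inter_mem ha hb, (prod_mono inter_subset_left inter_subset_right).trans hab⟩
  obtain ⟨O₂, hO₂, hO₂Ψ⟩ : ∃ O₂ ∈ 𝓝 y₀, ∀ w : S, (w : E) ∈ O₂ → ∀ y ∈ O₂,
      (w, y) ∈ Ψ.source := by
    obtain ⟨a, ha, b, hb, hab⟩ := mem_nhds_prod_iff.1 (Ψ.open_source.mem_nhds hΨ0)
    obtain ⟨a', ha', haa'⟩ := mem_nhds_induced ((↑) : S → E) (⟨y₀, hyS⟩ : S) a |>.1 ha
    exact ⟨a' ∩ b, inter_mem ha' hb, fun w hw y hy => hab ⟨haa' hw.1, hy.2⟩⟩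
  obtain ⟨O, hOsub, hO, hOy⟩ := mem_nhds_iff.1 (inter_mem hO₁ hO₂)
  -- the projection and the retraction
  let p : E → E := fun y => (Ψ.symm (0, y)).1
  let r : ℝ → E → E := fun s y => (Φ.symm (p y, s • conormal J (p y) y)).2
  have hΨy0 : Ψ (⟨y₀, hyS⟩, y₀) = (0, y₀) := by
    rw [hΨ]; simp
  have hp0 : p y₀ = y₀ := by
    have : Ψ.symm (0, y₀) = (⟨y₀, hyS⟩, y₀) := by
      rw [← hΨy0]; exact Ψ.left_inv hΨ0
    simp only [p, this]
  let V₁ : Set E := (fun y => ((0 : S →L[ℝ] ℝ), y)) ⁻¹' Ψ.target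
  have hV₁ : IsOpen V₁ := Ψ.open_target.preimage (Continuous.prodMk_right _)
  have hyV₁ : y₀ ∈ V₁ := by
    change (0, y₀) ∈ Ψ.target
    rw [← hΨy0]; exact Ψ.map_source hΨ0
  have hpV₁ : ContDiffOn ℝ ∞ p V₁ :=
    S.subtypeL.contDiff.comp_contDiffOn (contDiff_fst.comp_contDiffOn
      (hΨs.comp (contDiff_prodMk_right _).contDiffOn fun y hy => hy))
  let V₂ : Set E := (V₁ ∩ p ⁻¹' O) ∩ O
  have hV₂ : IsOpen V₂ := (hpV₁.continuousOn.isOpen_inter_preimage hV₁ hO).inter hO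
  have hyV₂ : y₀ ∈ V₂ := ⟨⟨hyV₁, by rw [mem_preimage, hp0]; exact hOy⟩, hOy⟩
  have hpy : ∀ y ∈ V₂, ∀ v ∈ S, conormal J (p y) y v = 0 := by
    intro y hy v hv
    have h1 := Ψ.right_inv hy.1.1
    rw [hΨ] at h1
    have h2 : (Ψ.symm (0, y)).2 = y := congrArg Prod.snd h1
    have h3 := congrArg Prod.fst h1
    simp only [h2] at h3
    exact congrArg (fun B : S →L[ℝ] ℝ => B ⟨v, hv⟩) h3
  let κ : ℝ × E → E × (E →L[ℝ] ℝ) := fun z => (p z.2, z.1 • conormal J (p z.2) z.2)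
  have hκ : ContDiffOn ℝ ∞ κ (univ ×ˢ V₂) := by
    have h1 : ContDiffOn ℝ ∞ (fun z : ℝ × E => p z.2) (univ ×ˢ V₂) :=
      hpV₁.comp contDiff_snd.contDiffOn fun z hz => hz.2.1.1
    refine h1.prodMk (contDiff_fst.contDiffOn.smul ?_)
    have hOT : O ⊆ T := fun y hy =>
      (hΦT (hO₁Φ (mk_mem_prod (hOsub hy).1 (hOsub hy).1))).1
    exact (contDiffOn_conormal hT hJ).comp (h1.prodMk contDiff_snd.contDiffOn)
      fun z hz => ⟨hOT hz.2.1.2, hOT hz.2.2⟩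
  let Q : Set (ℝ × E) := (univ ×ˢ V₂) ∩ κ ⁻¹' (Φ.target ∩ Φ.symm ⁻¹' (univ ×ˢ O))
  have hQ : IsOpen Q := hκ.continuousOn.isOpen_inter_preimage (isOpen_univ.prod hV₂)
    (Φ.symm.isOpen_inter_preimage (isOpen_univ.prod hO))
  have hQ0 : ∀ s : ℝ, (s, y₀) ∈ Q := by
    intro s
    have h1 : κ (s, y₀) = Φ (y₀, y₀) := by
      rw [hΦ]; simp [κ, hp0]
    refine ⟨⟨mem_univ _, hyV₂⟩, ?_⟩
    rw [mem_preimage, h1]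
    refine ⟨Φ.map_source hΦ0, ?_⟩
    rw [mem_preimage, Φ.left_inv hΦ0]
    exact ⟨mem_univ _, hOy⟩
  -- The whole segment over `y₀` lies in `Q`, since `y₀` is fixed by every `r s`; compactness of
  -- `[-1, 2]` provides one neighbourhood for all `s`.
  have hV₃ : ∀ᶠ y in 𝓝 y₀, ∀ s ∈ Icc (-1 : ℝ) 2, (s, y) ∈ Q := by
    refine isCompact_Icc.eventually_forall_of_forall_eventually fun s _ => ?_
    exact (continuous_swap.tendsto (y₀, s)).eventually (hQ.mem_nhds (hQ0 s))
  obtain ⟨V, hVsub, hV, hyV⟩ := mem_nhds_iff.1 hV₃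
  have hQV : Ioo (-1 : ℝ) 2 ×ˢ V ⊆ Q := fun z hz => hVsub hz.2 z.1 (Ioo_subset_Icc_self hz.1)
  have hVV₂ : V ⊆ V₂ := fun y hy => (hVsub hy 0 (by norm_num)).1.2
  exact ⟨{
    r := r
    p := p
    V := V
    O := O
    isOpen_V := hV
    isOpen_O := hO
    mem_V := hyV
    V_subset := fun y hy => (hVV₂ hy).2
    O_subset := fun y hy => (hΦT (hO₁Φ (mk_mem_prod (hOsub hy).1 (hOsub hy).1))).1
    contDiffOn_r := contDiff_snd.comp_contDiffOn (hΦs.comp (hκ.mono (hQV.trans inter_subset_left))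
      fun z hz => (hQV hz).2.1)
    continuousOn_p := hpV₁.continuousOn.mono fun y hy => (hVV₂ hy).1.1
    p_mem := fun y _ => (Ψ.symm (0, y)).1.2
    p_mem_O := fun y hy => (hVV₂ hy).1.2
    conormal_p := fun y hy => hpy y (hVV₂ hy)
    r_mem_O := fun y hy s hs => (hQV (mk_mem_prod hs hy)).2.2.2
    conormal_r := fun y hy s hs => by
      have h1 := Φ.right_inv (hQV (mk_mem_prod hs hy)).2.1
      rw [hΦ] at h1
      have h2 := congrArg Prod.fst h1
      have h3 := congrArg Prod.snd h1
      simp only [κ] at h2 h3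
      rw [h2] at h3
      exact h3
    unique_p := fun y hy w hw w' hw' hwS hwS' h h' => by
      have h1 : Ψ (⟨w, hwS⟩, y) = Ψ (⟨w', hwS'⟩, y) := by
        rw [hΨ, hΨ]
        refine Prod.ext ?_ rfl
        ext v
        simp only [ContinuousLinearMap.comp_apply, Submodule.subtypeL_apply, h v v.2, h' v v.2]
      have h2 := Ψ.injOn (hO₂Ψ ⟨w, hwS⟩ (hOsub hw).2 y (hOsub hy).2)
        (hO₂Ψ ⟨w', hwS'⟩ (hOsub hw').2 y (hOsub hy).2) h1
      exact congrArg (fun z : S × E => (z.1 : E)) h2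
    unique_r := fun w hw y hy y' hy' h => by
      have h1 : Φ (w, y) = Φ (w, y') := by rw [hΦ, hΦ, h]
      have h2 := Φ.injOn (hO₁Φ ⟨(hOsub hw).1, (hOsub hy).1⟩)
        (hO₁Φ ⟨(hOsub hw).1, (hOsub hy').1⟩) h1
      exact congrArg Prod.snd h2 }⟩

end Tube

/-! ### Integrals over the unit interval depending on a parameter -/

section ParametricIntegral

/-- Constant functions, as a continuous linear map. -/
def constCLM (K : Type*) [TopologicalSpace K] [CompactSpace K] (E : Type*) [NormedAddCommGroup E]
    [NormedSpace ℝ E] : E →L[ℝ] C(K, E) :=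
  LinearMap.mkContinuous
    { toFun := ContinuousMap.const K
      map_add' := fun _ _ => rfl
      map_smul' := fun _ _ => rfl } 1 (fun x => by
        rw [one_mul]
        exact (ContinuousMap.norm_le _ (norm_nonneg _)).2 fun _ => le_rfl)

@[simp] theorem constCLM_apply {K : Type*} [TopologicalSpace K] [CompactSpace K] {E : Type*}
    [NormedAddCommGroup E] [NormedSpace ℝ E] (x : E) (k : K) : constCLM K E x k = x := rfl

/-- Evaluation at a point, as a continuous linear map. -/
def evalAt {K : Type*} [TopologicalSpace K] [CompactSpace K] (E : Type*) [NormedAddCommGroup E]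
    [NormedSpace ℝ E] (k : K) : C(K, E) →L[ℝ] E :=
  ContinuousMap.evalCLM ℝ k

@[simp] theorem evalAt_apply {K : Type*} [TopologicalSpace K] [CompactSpace K] {E : Type*}
    [NormedAddCommGroup E] [NormedSpace ℝ E] (γ : C(K, E)) (k : K) : evalAt E k γ = γ k := rfl

variable {E : Type u} [NormedAddCommGroup E] [NormedSpace ℝ E]
variable {G : Type u} [NormedAddCommGroup G] [NormedSpace ℝ G]

theorem smoothFamilyAt_of_contDiffAt {g : ℝ × E → G} {t : unitInterval} {y : E}
    (hg : ContDiffAt ℝ ∞ g ((t : ℝ), y)) :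
    SmoothFamilyAt ℝ (fun (s : unitInterval) (x : E) => g ((s : ℝ), x)) t y :=
  ⟨Subtype.val, g, continuous_subtype_val.continuousAt, hg, Eventually.of_forall fun _ => rfl⟩

variable [FiniteDimensional ℝ E]

/-- The parameter integral becomes a superposition operator between bounded linear maps, evaluated
on constant paths. Its smoothness and its derivative then follow from the chain rule. -/
theorem exists_superpose_eq_integral {g : ℝ × E → G} {U : Set E} (hU : IsOpen U)
    (hg : ∀ s ∈ Icc (0 : ℝ) 1, ∀ y ∈ U, ContDiffAt ℝ ∞ g (s, y)) {y₀ : E} (hy₀ : y₀ ∈ U) :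
    ∃ (f : unitInterval → E → G) (hf : IsSmoothFamily f),
      (∀ᶠ y in 𝓝 y₀, ∀ s : unitInterval, f s y = g (s, y)) ∧
      (fun y => ∫ s in (0 : ℝ)..1, g (s, y)) =ᶠ[𝓝 y₀]
        fun y => evalAt G (1 : unitInterval) (volterra (superpose hf (constCLM _ E y))) := by
  obtain ⟨f, hf, hfg⟩ := exists_isSmoothFamily_eventuallyEq (P := ℝ)
    (f := fun (s : unitInterval) (x : E) => g ((s : ℝ), x)) hU
    (fun t y hy => smoothFamilyAt_of_contDiffAt (hg t t.2 y hy)) hy₀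
  refine ⟨f, hf, hfg, hfg.mono fun y hy => ?_⟩
  simp only [evalAt_apply, volterra_apply, superpose_apply, constCLM_apply]
  refine intervalIntegral.integral_congr fun s hs => ?_
  rw [uIcc_of_le zero_le_one] at hs
  simp only [hy, projIcc_of_mem zero_le_one hs]

theorem contDiffOn_integral {g : ℝ × E → G} {U : Set E} (hU : IsOpen U)
    (hg : ∀ s ∈ Icc (0 : ℝ) 1, ∀ y ∈ U, ContDiffAt ℝ ∞ g (s, y)) :
    ContDiffOn ℝ ∞ (fun y => ∫ s in (0 : ℝ)..1, g (s, y)) U := by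
  intro y hy
  obtain ⟨f, hf, -, h⟩ := exists_superpose_eq_integral hU hg hy
  refine (ContDiffAt.congr_of_eventuallyEq ?_ h).contDiffWithinAt
  exact ((evalAt G (1 : unitInterval)).contDiff.comp (volterra.contDiff.comp
    ((contDiff_superpose hf).comp (constCLM unitInterval E).contDiff))).contDiffAt

theorem hasFDerivAt_integral_zero {g : ℝ × E → G} {U : Set E} (hU : IsOpen U)
    (hg : ∀ s ∈ Icc (0 : ℝ) 1, ∀ y ∈ U, ContDiffAt ℝ ∞ g (s, y)) {y₀ : E} (hy₀ : y₀ ∈ U)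
    (h0 : ∀ s ∈ Icc (0 : ℝ) 1, HasFDerivAt (fun y => g (s, y)) (0 : E →L[ℝ] G) y₀) :
    HasFDerivAt (fun y => ∫ s in (0 : ℝ)..1, g (s, y)) (0 : E →L[ℝ] G) y₀ := by
  obtain ⟨f, hf, hfg, h⟩ := exists_superpose_eq_integral hU hg hy₀
  refine HasFDerivAt.congr_of_eventuallyEq ?_ h
  have h1 := (evalAt G (1 : unitInterval)).hasFDerivAt.comp y₀
    ((volterra (E := G)).hasFDerivAt.comp y₀
      ((hasFDerivAt_superpose hf _).comp y₀ (constCLM unitInterval E).hasFDerivAt))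
  refine h1.congr_fderiv ?_
  have h2 : superpose hf.fderiv (constCLM unitInterval E y₀) = 0 := by
    ext1 s
    have : f s =ᶠ[𝓝 y₀] fun y => g (s, y) := hfg.mono fun y hy => hy s
    rw [superpose_apply, constCLM_apply, this.fderiv_eq, (h0 s s.2).fderiv]
    rfl
  rw [h2, map_zero]
  ext v
  simp

end ParametricIntegral

/-! ### The local model -/

/-- Two non-degenerate two-forms on an open set `T` that agree on a linear subspace `S`, with an
immersion of `T` in a Hilbert space. -/
structure LocalModel (E : Type u) [NormedAddCommGroup E] [NormedSpace ℝ E]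
    (H : Type*) [NormedAddCommGroup H] [InnerProductSpace ℝ H] where
  S : Submodule ℝ E
  T : Set E
  J : E → H
  ω₀ : E → E →L[ℝ] E →L[ℝ] ℝ
  ω₁ : E → E →L[ℝ] E →L[ℝ] ℝ
  y₀ : E
  isOpen_T : IsOpen T
  mem_S : y₀ ∈ S
  mem_T : y₀ ∈ T
  contDiffOn_J : ContDiffOn ℝ ∞ J T
  injective_J : Injective (fderiv ℝ J y₀)
  contDiffOn_ω₀ : ContDiffOn ℝ ∞ ω₀ T
  contDiffOn_ω₁ : ContDiffOn ℝ ∞ ω₁ T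
  skew₀ : ∀ y u v, ω₀ y u v = -ω₀ y v u
  skew₁ : ∀ y u v, ω₁ y u v = -ω₁ y v u
  nondegenerate : ∀ u, (∀ v, ω₀ y₀ u v = 0) → u = 0
  eq_on : ∀ y ∈ T, y ∈ S → ω₀ y = ω₁ y

namespace LocalModel

variable {E : Type u} [NormedAddCommGroup E] [NormedSpace ℝ E] [FiniteDimensional ℝ E]
variable {H : Type*} [NormedAddCommGroup H] [InnerProductSpace ℝ H]
variable (M : LocalModel E H)

/-- A tube in the local model. -/
def tube : Tube M.S M.T M.J M.y₀ :=
  Classical.choice (nonempty_tube M.S M.isOpen_T M.contDiffOn_J M.mem_S M.mem_T M.injective_J)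

/-- The path of forms from `ω₀` to `ω₁`. -/
def ωt (t : ℝ) (y : E) : E →L[ℝ] E →L[ℝ] ℝ := M.ω₀ y + t • (M.ω₁ y - M.ω₀ y)

theorem ωt_skew (t : ℝ) (y u v : E) : M.ωt t y u v = -M.ωt t y v u := by
  have h0 := M.skew₀ y u v
  have h1 := M.skew₁ y u v
  simp only [ωt, _root_.add_apply, _root_.smul_apply, _root_.sub_apply, smul_eq_mul, h0, h1]
  ring

/-- The integrand of the homotopy operator applied to `ω₁ - ω₀`. -/
def integrand (z : ℝ × E) : E →L[ℝ] ℝ :=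
  ((M.ω₁ (M.tube.r z.1 z.2) - M.ω₀ (M.tube.r z.1 z.2))
    (fderiv ℝ (uncurry M.tube.r) z (1, 0))).comp
      ((fderiv ℝ (uncurry M.tube.r) z).comp (ContinuousLinearMap.inr ℝ ℝ E))

/-- The homotopy operator of the tube applied to `ω₁ - ω₀`. -/
def β (y : E) : E →L[ℝ] ℝ := ∫ s in (0 : ℝ)..1, M.integrand (s, y)

theorem isOpen_strip : IsOpen (Ioo (-1 : ℝ) 2 ×ˢ M.tube.V) := isOpen_Ioo.prod M.tube.isOpen_V

theorem contDiffOn_integrand : ContDiffOn ℝ ∞ M.integrand (Ioo (-1 : ℝ) 2 ×ˢ M.tube.V) := by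
  have hr := M.tube.contDiffOn_r
  have hD := hr.fderiv_of_isOpen M.isOpen_strip (m := ∞) (by simp)
  have hσ : ContDiffOn ℝ ∞ (fun y => M.ω₁ y - M.ω₀ y) M.T := M.contDiffOn_ω₁.sub M.contDiffOn_ω₀
  have h1 : ContDiffOn ℝ ∞ (fun z : ℝ × E => M.ω₁ (M.tube.r z.1 z.2) - M.ω₀ (M.tube.r z.1 z.2))
      (Ioo (-1 : ℝ) 2 ×ˢ M.tube.V) :=
    hσ.comp hr fun z hz => M.tube.O_subset (M.tube.r_mem_O z.2 hz.2 z.1 hz.1)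
  exact (h1.clm_apply (hD.clm_apply contDiffOn_const)).clm_comp (hD.clm_comp contDiffOn_const)

theorem Icc_subset_strip : Icc (0 : ℝ) 1 ⊆ Ioo (-1 : ℝ) 2 :=
  fun _ hs => ⟨by linarith [hs.1], by linarith [hs.2]⟩

theorem contDiffAt_integrand {s : ℝ} (hs : s ∈ Icc (0 : ℝ) 1) {y : E} (hy : y ∈ M.tube.V) :
    ContDiffAt ℝ ∞ M.integrand (s, y) :=
  M.contDiffOn_integrand.contDiffAt (M.isOpen_strip.mem_nhds ⟨Icc_subset_strip hs, hy⟩)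

theorem contDiffAt_r {s : ℝ} (hs : s ∈ Icc (0 : ℝ) 1) {y : E} (hy : y ∈ M.tube.V) :
    ContDiffAt ℝ ∞ (uncurry M.tube.r) (s, y) :=
  M.tube.contDiffOn_r.contDiffAt (M.isOpen_strip.mem_nhds ⟨Icc_subset_strip hs, hy⟩)

theorem hasDerivAt_r_left {s : ℝ} (hs : s ∈ Icc (0 : ℝ) 1) {y : E} (hy : y ∈ M.tube.V) :
    HasDerivAt (fun s => M.tube.r s y) (fderiv ℝ (uncurry M.tube.r) (s, y) (1, 0)) s := by
  have h1 := ((M.contDiffAt_r hs hy).differentiableAt (by simp)).hasFDerivAt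
  exact (h1.comp_hasDerivAt s ((hasDerivAt_id s).prodMk (hasDerivAt_const s y)))

theorem hasFDerivAt_r_right {s : ℝ} (hs : s ∈ Icc (0 : ℝ) 1) {y : E} (hy : y ∈ M.tube.V) :
    HasFDerivAt (M.tube.r s) ((fderiv ℝ (uncurry M.tube.r) (s, y)).comp
      (ContinuousLinearMap.inr ℝ ℝ E)) y := by
  have h1 := ((M.contDiffAt_r hs hy).differentiableAt (by simp)).hasFDerivAt
  exact HasFDerivAt.comp y h1 (hasFDerivAt_prodMk_right s y)

theorem integrand_apply {s : ℝ} {y a : E} {B : E →L[ℝ] E}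
    (hs : s ∈ Icc (0 : ℝ) 1) (hy : y ∈ M.tube.V) (ha : HasDerivAt (fun s => M.tube.r s y) a s)
    (hB : HasFDerivAt (M.tube.r s) B y) (v : E) :
    M.integrand (s, y) v =
      M.ω₁ (M.tube.r s y) a (B v) - M.ω₀ (M.tube.r s y) a (B v) := by
  rw [ha.unique (M.hasDerivAt_r_left hs hy), hB.unique (M.hasFDerivAt_r_right hs hy)]
  rfl

theorem contDiffOn_β : ContDiffOn ℝ ∞ M.β M.tube.V :=
  contDiffOn_integral M.tube.isOpen_V fun _ hs _ hy => M.contDiffAt_integrand hs hy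

theorem β_apply {y : E} (hy : y ∈ M.tube.V) (v : E) :
    M.β y v = ∫ s in (0 : ℝ)..1, M.integrand (s, y) v := by
  have hc : ContinuousOn (fun s : ℝ => M.integrand (s, y)) (uIcc 0 1) := by
    rw [uIcc_of_le zero_le_one]
    intro s hs
    exact (ContinuousAt.comp (f := fun s : ℝ => (s, y)) (M.contDiffAt_integrand hs hy).continuousAt
      (Continuous.prodMk_left y).continuousAt).continuousWithinAt
  exact ContinuousLinearMap.intervalIntegral_apply hc.intervalIntegrable v

theorem fderiv_r_of_mem {s : ℝ} (hs : s ∈ Icc (0 : ℝ) 1) {y : E} (hy : y ∈ M.tube.V)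
    (hyS : y ∈ M.S) : fderiv ℝ (uncurry M.tube.r) (s, y) (1, 0) = 0 := by
  refine (M.hasDerivAt_r_left hs hy).unique ?_
  refine (hasDerivAt_const s y).congr_of_eventuallyEq ?_
  filter_upwards [isOpen_Ioo.mem_nhds (Icc_subset_strip hs)] with s' hs'
  exact M.tube.r_eq_self hy hyS hs'

theorem integrand_of_mem {s : ℝ} (hs : s ∈ Icc (0 : ℝ) 1) {y : E} (hy : y ∈ M.tube.V)
    (hyS : y ∈ M.S) : M.integrand (s, y) = 0 := by
  rw [integrand, M.fderiv_r_of_mem hs hy hyS, map_zero, ContinuousLinearMap.zero_comp]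

theorem β_of_mem {y : E} (hy : y ∈ M.tube.V) (hyS : y ∈ M.S) : M.β y = 0 := by
  rw [β, intervalIntegral.integral_congr (g := fun _ => 0)]
  · simp
  · intro s hs
    rw [uIcc_of_le zero_le_one] at hs
    exact M.integrand_of_mem hs hy hyS

/-- The integrand contains two factors that vanish at `y₀`, namely `ω₁ - ω₀` and the `s`-derivative
of `r`, so it vanishes to second order. This makes the linearised flow trivial. -/
theorem hasFDerivAt_β_zero : HasFDerivAt M.β (0 : E →L[ℝ] E →L[ℝ] ℝ) M.y₀ := by
  have hy : M.y₀ ∈ M.tube.V := M.tube.mem_V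
  refine hasFDerivAt_integral_zero M.tube.isOpen_V
    (fun _ hs _ hy => M.contDiffAt_integrand hs hy) hy fun s hs => ?_
  have hr0 : M.tube.r s M.y₀ = M.y₀ := M.tube.r_eq_self hy M.mem_S (Icc_subset_strip hs)
  have hD : DifferentiableAt ℝ (fun y => fderiv ℝ (uncurry M.tube.r) (s, y)) M.y₀ := by
    have := ((M.contDiffAt_r hs hy).fderiv_right (m := ∞) (by simp)).differentiableAt (by simp)
    exact this.comp M.y₀ ((differentiableAt_const s).prodMk differentiableAt_id)
  have hσ : DifferentiableAt ℝ (fun y => M.ω₁ (M.tube.r s y) - M.ω₀ (M.tube.r s y)) M.y₀ := by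
    have h1 : DifferentiableAt ℝ (fun y => M.ω₁ y - M.ω₀ y) (M.tube.r s M.y₀) := by
      rw [hr0]
      exact ((M.contDiffOn_ω₁.sub M.contDiffOn_ω₀).contDiffAt
        (M.isOpen_T.mem_nhds M.mem_T)).differentiableAt (by simp)
    exact DifferentiableAt.comp M.y₀ (g := fun y => M.ω₁ y - M.ω₀ y) h1
      (M.hasFDerivAt_r_right hs hy).differentiableAt
  have hb := (hD.hasFDerivAt.clm_apply (hasFDerivAt_const ((1 : ℝ), (0 : E)) M.y₀))
  have hc := (hD.hasFDerivAt.clm_comp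
    (hasFDerivAt_const (ContinuousLinearMap.inr ℝ ℝ E) M.y₀))
  refine ((hσ.hasFDerivAt.clm_apply hb).clm_comp hc).congr_fderiv ?_
  have h1 := M.fderiv_r_of_mem hs hy M.mem_S
  have h2 : M.ω₁ (M.tube.r s M.y₀) - M.ω₀ (M.tube.r s M.y₀) = 0 := by
    rw [hr0, M.eq_on _ M.mem_T M.mem_S, sub_self]
  rw [h1, h2]
  ext v w
  simp

/-- The forms `ω t` are invertible near `y₀`. -/
theorem exists_isOpen_invertible : ∃ U : Set E, IsOpen U ∧ M.y₀ ∈ U ∧ U ⊆ M.tube.V ∧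
    ∀ y ∈ U, ∀ t ∈ Icc (0 : ℝ) 1,
      M.ωt t y ∈ range ((↑) : (E ≃L[ℝ] (E →L[ℝ] ℝ)) → E →L[ℝ] E →L[ℝ] ℝ) := by
  have hinj : Injective (M.ω₀ M.y₀) := by
    rw [injective_iff_map_eq_zero]
    intro u hu
    exact M.nondegenerate u fun v => by rw [hu]; rfl
  -- At `y₀` the two forms agree, so `ωt t M.y₀` is `ω₀` for every `t`. Invertibility is open, and
  -- compactness of `[0, 1]` makes the neighbourhood uniform in `t`.
  have h0 : ∀ t : ℝ, M.ωt t M.y₀ ∈ range ((↑) : (E ≃L[ℝ] (E →L[ℝ] ℝ)) → E →L[ℝ] E →L[ℝ] ℝ) := by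
    intro t
    refine ⟨clmEquivOfInjective (M.ω₀ M.y₀) hinj (finrank_clm_real E).symm, ?_⟩
    rw [coe_clmEquivOfInjective, ωt, M.eq_on _ M.mem_T M.mem_S, sub_self, smul_zero, add_zero]
  have hc : ∀ t : ℝ, ContinuousAt (fun z : E × ℝ => M.ωt z.2 z.1) (M.y₀, t) := by
    intro t
    have h1 : ContinuousAt (fun z : E × ℝ => M.ω₀ z.1) (M.y₀, t) :=
      ContinuousAt.comp (f := Prod.fst) (x := (M.y₀, t))
        (M.contDiffOn_ω₀.contDiffAt (M.isOpen_T.mem_nhds M.mem_T)).continuousAt continuousAt_fst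
    have h2 : ContinuousAt (fun z : E × ℝ => M.ω₁ z.1) (M.y₀, t) :=
      ContinuousAt.comp (f := Prod.fst) (x := (M.y₀, t))
        (M.contDiffOn_ω₁.contDiffAt (M.isOpen_T.mem_nhds M.mem_T)).continuousAt continuousAt_fst
    have h3 : ContinuousAt (fun z : E × ℝ => M.ω₁ z.1 - M.ω₀ z.1) (M.y₀, t) := h2.sub h1
    exact h1.add (continuousAt_snd.smul h3)
  have hev : ∀ᶠ y in 𝓝 M.y₀, ∀ t ∈ Icc (0 : ℝ) 1,
      M.ωt t y ∈ range ((↑) : (E ≃L[ℝ] (E →L[ℝ] ℝ)) → E →L[ℝ] E →L[ℝ] ℝ) :=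
    isCompact_Icc.eventually_forall_of_forall_eventually fun t _ =>
      (hc t).eventually (ContinuousLinearEquiv.isOpen.mem_nhds (h0 t))
  obtain ⟨U, hU, hUo, hyU⟩ := mem_nhds_iff.1
    (inter_mem (M.tube.isOpen_V.mem_nhds M.tube.mem_V) hev)
  exact ⟨U, hUo, hyU, fun y hy => (hU hy).1, fun y hy => (hU hy).2⟩

/-- The Moser vector field, determined by `ω t (X t) = -β`. -/
def X (t : ℝ) (y : E) : E := -(M.ωt t y).inverse (M.β y)

theorem ωt_X {t : ℝ} {y : E}
    (h : M.ωt t y ∈ range ((↑) : (E ≃L[ℝ] (E →L[ℝ] ℝ)) → E →L[ℝ] E →L[ℝ] ℝ)) :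
    M.ωt t y (M.X t y) = -M.β y := by
  obtain ⟨e, he⟩ := h
  rw [X, ← he, ContinuousLinearMap.inverse_equiv, map_neg]
  simp

theorem contDiffAt_ωt {t : ℝ} {y : E} (hy : y ∈ M.T) : ContDiffAt ℝ ∞ (uncurry M.ωt) (t, y) := by
  have h1 : ContDiffAt ℝ ∞ (fun z : ℝ × E => M.ω₀ z.2) (t, y) :=
    ContDiffAt.comp (t, y) (M.contDiffOn_ω₀.contDiffAt (M.isOpen_T.mem_nhds hy)) contDiffAt_snd
  have h2 : ContDiffAt ℝ ∞ (fun z : ℝ × E => M.ω₁ z.2) (t, y) :=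
    ContDiffAt.comp (t, y) (M.contDiffOn_ω₁.contDiffAt (M.isOpen_T.mem_nhds hy)) contDiffAt_snd
  have h3 : ContDiffAt ℝ ∞ (fun z : ℝ × E => M.ω₁ z.2 - M.ω₀ z.2) (t, y) := h2.sub h1
  exact h1.add (contDiffAt_fst.smul h3)

theorem tube_V_subset : M.tube.V ⊆ M.T := M.tube.V_subset.trans M.tube.O_subset

theorem contDiffAt_X {t : ℝ} {y : E} (hy : y ∈ M.tube.V)
    (h : M.ωt t y ∈ range ((↑) : (E ≃L[ℝ] (E →L[ℝ] ℝ)) → E →L[ℝ] E →L[ℝ] ℝ)) :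
    ContDiffAt ℝ ∞ (uncurry M.X) (t, y) := by
  obtain ⟨e, he⟩ := h
  have h1 : ContDiffAt ℝ ∞ (fun z : ℝ × E => (M.ωt z.1 z.2).inverse) (t, y) := by
    refine ContDiffAt.comp (t, y) (g := ContinuousLinearMap.inverse) (f := uncurry M.ωt) ?_
      (M.contDiffAt_ωt (M.tube_V_subset hy))
    change ContDiffAt ℝ ∞ ContinuousLinearMap.inverse (M.ωt t y)
    rw [← he]
    exact contDiffAt_map_inverse e
  have h2 : ContDiffAt ℝ ∞ (fun z : ℝ × E => M.β z.2) (t, y) :=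
    ContDiffAt.comp (t, y) (M.contDiffOn_β.contDiffAt (M.tube.isOpen_V.mem_nhds hy)) contDiffAt_snd
  exact (h1.clm_apply h2).neg

theorem X_of_mem {t : ℝ} {y : E} (hy : y ∈ M.tube.V) (hyS : y ∈ M.S) : M.X t y = 0 := by
  rw [X, M.β_of_mem hy hyS, map_zero, neg_zero]

theorem hasFDerivAt_X_zero {t : ℝ}
    (h : M.ωt t M.y₀ ∈ range ((↑) : (E ≃L[ℝ] (E →L[ℝ] ℝ)) → E →L[ℝ] E →L[ℝ] ℝ)) :
    HasFDerivAt (M.X t) (0 : E →L[ℝ] E) M.y₀ := by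
  obtain ⟨e, he⟩ := h
  have h1 : DifferentiableAt ℝ (fun y : E => (M.ωt t y).inverse) M.y₀ := by
    have h2 : DifferentiableAt ℝ ContinuousLinearMap.inverse (M.ωt t M.y₀) := by
      rw [← he]
      exact (contDiffAt_map_inverse (n := 1) e).differentiableAt (by simp)
    have h3 : DifferentiableAt ℝ (fun y : E => M.ωt t y) M.y₀ :=
      DifferentiableAt.comp M.y₀ (g := uncurry M.ωt) (f := fun y => (t, y))
        ((M.contDiffAt_ωt M.mem_T).differentiableAt (by simp))
        ((differentiableAt_const t).prodMk differentiableAt_id)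
    exact DifferentiableAt.comp M.y₀ (g := ContinuousLinearMap.inverse) h2 h3
  refine (h1.hasFDerivAt.clm_apply M.hasFDerivAt_β_zero).neg.congr_fderiv ?_
  rw [M.β_of_mem M.tube.mem_V M.mem_S]
  ext v
  simp

end LocalModel

/-! ### The flow of the Moser field, as an implicit function on paths -/

namespace LocalModel

variable {E : Type u} [NormedAddCommGroup E] [NormedSpace ℝ E] [FiniteDimensional ℝ E]
variable {H : Type*} [NormedAddCommGroup H] [InnerProductSpace ℝ H]

/-- `η` is an integral curve of the Moser vector field on the unit interval. -/
def IsFlowLine (M : LocalModel E H) (η : C(unitInterval, E)) : Prop :=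
  ∀ t : unitInterval,
    HasDerivWithinAt (fun s => η (projIcc 0 1 zero_le_one s)) (M.X t (η t)) (Icc 0 1) t

/-- The flow of the Moser vector field near the base point. -/
structure Flow (M : LocalModel E H) where
  O : Set E
  V : Set E
  γ : E → C(unitInterval, E)
  isOpen_O : IsOpen O
  isOpen_V : IsOpen V
  mem_V : M.y₀ ∈ V
  V_subset : V ⊆ O
  O_subset : O ⊆ M.tube.V
  invertible : ∀ y ∈ O, ∀ t ∈ Icc (0 : ℝ) 1,
    M.ωt t y ∈ range ((↑) : (E ≃L[ℝ] (E →L[ℝ] ℝ)) → E →L[ℝ] E →L[ℝ] ℝ)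
  γ_mem : ∀ y ∈ V, ∀ t, γ y t ∈ O
  γ_zero : ∀ y ∈ V, γ y 0 = y
  isFlowLine : ∀ y ∈ V, M.IsFlowLine (γ y)
  unique : ∀ y ∈ V, ∀ η : C(unitInterval, E), (∀ t, η t ∈ O) → η 0 = y → M.IsFlowLine η → η = γ y
  contDiffOn_γ : ContDiffOn ℝ ∞ γ V
  hasFDerivAt_γ : HasFDerivAt γ (constCLM unitInterval E) M.y₀

/-- Flow lines starting at `x` are the solutions of `F η = const x` with `F η = η - volterra
(superpose hf η)`. Since `X t` and its derivative vanish at `y₀`, the derivative of `F` at the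
constant path is the identity. The local inverse of `F`, restricted to constants, gives existence
and smooth dependence; its injectivity gives uniqueness. -/
theorem nonempty_flow (M : LocalModel E H) : Nonempty M.Flow := by
  obtain ⟨U, hU, hyU, hUV, hUinv⟩ := M.exists_isOpen_invertible
  -- The superposition operator needs a family smooth on all of `E`, so `X` is replaced by one
  -- agreeing with it near `y₀`.
  obtain ⟨f, hf, hfX⟩ := exists_isSmoothFamily_eventuallyEq (P := ℝ)
    (f := fun (t : unitInterval) (y : E) => M.X t y) hU
    (fun t y hy => smoothFamilyAt_of_contDiffAt (g := uncurry M.X)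
      (M.contDiffAt_X (hUV hy) (hUinv y hy t t.2))) hyU
  obtain ⟨U', hU'sub, hU', hyU'⟩ := mem_nhds_iff.1 (inter_mem (hU.mem_nhds hyU) hfX)
  let c₀ : C(unitInterval, E) := constCLM unitInterval E M.y₀
  let F : C(unitInterval, E) → C(unitInterval, E) := fun γ => γ - volterra (superpose hf γ)
  have hF : ContDiff ℝ ∞ F := contDiff_id.sub
    ((volterra (E := E)).contDiff.comp (contDiff_superpose hf))
  have hf0 : ∀ t, f t M.y₀ = 0 := fun t => by
    rw [(hU'sub hyU').2 t, M.X_of_mem (hUV hyU) M.mem_S]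
  have hF0 : F c₀ = c₀ := by
    have : superpose hf c₀ = 0 := by
      ext1 t
      exact hf0 t
    simp only [F, this, map_zero, sub_zero]
  have hF' : HasFDerivAt F
      ((ContinuousLinearEquiv.refl ℝ C(unitInterval, E) : _ ≃L[ℝ] _) :
        C(unitInterval, E) →L[ℝ] C(unitInterval, E)) c₀ := by
    have h1 := (hasFDerivAt_id c₀).sub
      ((volterra (E := E)).hasFDerivAt.comp c₀ (hasFDerivAt_superpose hf c₀))
    refine h1.congr_fderiv ?_
    have h2 : superpose hf.fderiv c₀ = 0 := by
      ext1 t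
      have h3 : f t =ᶠ[𝓝 M.y₀] M.X t := hfX.mono fun y hy => hy t
      change fderiv ℝ (f t) M.y₀ = 0
      rw [h3.fderiv_eq]
      exact (M.hasFDerivAt_X_zero (hUinv _ hyU t t.2)).fderiv
    rw [h2, map_zero, ContinuousLinearMap.comp_zero, sub_zero]
    rfl
  obtain ⟨Φ, hΦ0, -, hΦ, hΦs, hΦd⟩ := exists_smooth_localInverse isOpen_univ hF.contDiffOn
    (mem_univ c₀) _ hF'
  obtain ⟨ρ, hρ, hball⟩ := Metric.isOpen_iff.1 Φ.open_source c₀ hΦ0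
  -- Pointwise bounds are used only to give `≤` for the sup norm; half the radius restores a strict
  -- inequality.
  let O : Set E := Metric.ball M.y₀ (ρ / 2) ∩ U'
  have hO : IsOpen O := Metric.isOpen_ball.inter hU'
  have hOy : M.y₀ ∈ O := ⟨Metric.mem_ball_self (by positivity), hyU'⟩
  have hcurve : ∀ η : C(unitInterval, E), (∀ t, η t ∈ O) → η ∈ Φ.source := by
    intro η hη
    refine hball ?_
    rw [Metric.mem_ball, dist_eq_norm]
    refine lt_of_le_of_lt ((ContinuousMap.norm_le _ (by positivity : (0 : ℝ) ≤ ρ / 2)).2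
      fun t => ?_) (by linarith : ρ / 2 < ρ)
    have := (hη t).1
    rw [Metric.mem_ball, dist_eq_norm] at this
    exact this.le
  have hline : ∀ η : C(unitInterval, E), (∀ t, η t ∈ O) → ∀ x,
      F η = constCLM unitInterval E x ↔ η 0 = x ∧ M.IsFlowLine η := by
    intro η hη x
    have h1 := eq_const_add_volterra_iff η (superpose hf η) x
    have h2 : F η = constCLM unitInterval E x ↔
        η = ContinuousMap.const _ x + volterra (superpose hf η) := sub_eq_iff_eq_add
    rw [h2, h1]
    have h3 : ∀ t : unitInterval, superpose hf η t = M.X t (η t) := fun t =>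
      (hU'sub (hη t).2).2 t
    simp only [IsFlowLine, h3]
  let Q : Set C(unitInterval, E) := {η | ∀ t, η t ∈ O}
  have hQ : IsOpen Q := by
    have := ContinuousMap.isOpen_setOfPred_mapsTo (X := unitInterval) (Y := E) isCompact_univ hO
    simpa [MapsTo, Q] using this
  let V : Set E := O ∩ (constCLM unitInterval E) ⁻¹' (Φ.target ∩ Φ.symm ⁻¹' Q)
  have hV : IsOpen V := hO.inter
    ((Φ.symm.isOpen_inter_preimage hQ).preimage (constCLM unitInterval E).continuous)
  have hyV : M.y₀ ∈ V := by
    refine ⟨hOy, ?_⟩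
    have h1 : constCLM unitInterval E M.y₀ = Φ c₀ := by rw [hΦ, hF0]
    rw [mem_preimage, h1]
    refine ⟨Φ.map_source hΦ0, ?_⟩
    rw [mem_preimage, Φ.left_inv hΦ0]
    exact fun t => hOy
  have hγ : ∀ y ∈ V, F (Φ.symm (constCLM unitInterval E y)) = constCLM unitInterval E y := by
    intro y hy
    rw [← hΦ, Φ.right_inv hy.2.1]
  exact ⟨{
    O := O
    V := V
    γ := fun y => Φ.symm (constCLM unitInterval E y)
    isOpen_O := hO
    isOpen_V := hV
    mem_V := hyV
    V_subset := fun y hy => hy.1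
    O_subset := fun y hy => hUV (hU'sub hy.2).1
    invertible := fun y hy => hUinv y (hU'sub hy.2).1
    γ_mem := fun y hy => hy.2.2
    γ_zero := fun y hy => ((hline _ hy.2.2 y).1 (hγ y hy)).1
    isFlowLine := fun y hy => ((hline _ hy.2.2 y).1 (hγ y hy)).2
    unique := fun y hy η hη h0 hl => by
      refine Φ.injOn (hcurve η hη) (hcurve _ hy.2.2) ?_
      rw [hΦ, hΦ, hγ y hy]
      exact (hline η hη y).2 ⟨h0, hl⟩
    contDiffOn_γ := hΦs.comp (constCLM unitInterval E).contDiff.contDiffOn fun y hy => hy.2.1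
    hasFDerivAt_γ := by
      have h1 : HasFDerivAt Φ.symm (ContinuousLinearMap.id ℝ C(unitInterval, E))
          (constCLM unitInterval E M.y₀) := by
        have h2 : F c₀ = constCLM unitInterval E M.y₀ := hF0
        rw [← h2]
        exact hΦd
      exact h1.comp M.y₀ (constCLM unitInterval E).hasFDerivAt }⟩

variable (M : LocalModel E H)

/-- The flow of the Moser vector field near the base point. -/
def flow : M.Flow := Classical.choice M.nonempty_flow

/-- The time-one map of the Moser vector field. -/
def φ (y : E) : E := M.flow.γ y 1

theorem contDiffOn_φ : ContDiffOn ℝ ∞ M.φ M.flow.V :=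
  (evalAt E (1 : unitInterval)).contDiff.comp_contDiffOn M.flow.contDiffOn_γ

theorem hasFDerivAt_φ : HasFDerivAt M.φ (ContinuousLinearMap.id ℝ E) M.y₀ :=
  ((evalAt E (1 : unitInterval)).hasFDerivAt.comp M.y₀ M.flow.hasFDerivAt_γ)

theorem flow_V_subset_tube : M.flow.V ⊆ M.tube.V := M.flow.V_subset.trans M.flow.O_subset

theorem flow_V_subset : M.flow.V ⊆ M.T := M.flow_V_subset_tube.trans M.tube_V_subset

theorem γ_of_mem {y : E} (hy : y ∈ M.flow.V) (hyS : y ∈ M.S) :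
    M.flow.γ y = ContinuousMap.const _ y := by
  refine (M.flow.unique y hy _ (fun _ => M.flow.V_subset hy) rfl fun t => ?_).symm
  have h : M.X t ((ContinuousMap.const unitInterval y) t) = 0 :=
    M.X_of_mem (M.flow_V_subset_tube hy) hyS
  rw [h]
  exact hasDerivWithinAt_const _ _ _

theorem φ_of_mem {y : E} (hy : y ∈ M.flow.V) (hyS : y ∈ M.S) : M.φ y = y := by
  rw [φ, M.γ_of_mem hy hyS]; rfl

/-- Near a point of `S` all flow lines stay in a given neighbourhood. -/
theorem eventually_γ_mem {y : E} (hy : y ∈ M.flow.V) (hyS : y ∈ M.S) {C : Set E} (hC : C ∈ 𝓝 y) :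
    ∀ᶠ x in 𝓝 y, ∀ t, M.flow.γ x t ∈ C := by
  obtain ⟨C', hC', hC'o, hyC'⟩ := mem_nhds_iff.1 hC
  have h1 : ContinuousAt M.flow.γ y :=
    (M.flow.contDiffOn_γ.contDiffAt (M.flow.isOpen_V.mem_nhds hy)).continuousAt
  have hQ : IsOpen {η : C(unitInterval, E) | ∀ t, η t ∈ C'} := by
    have := ContinuousMap.isOpen_setOfPred_mapsTo (X := unitInterval) (Y := E) isCompact_univ hC'o
    simpa [MapsTo] using this
  have h2 : M.flow.γ y ∈ {η : C(unitInterval, E) | ∀ t, η t ∈ C'} := by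
    rw [M.γ_of_mem hy hyS]; exact fun _ => hyC'
  exact (h1.eventually (hQ.mem_nhds h2)).mono fun x hx t => hC' (hx t)

/-- Near a point of `S` the homotopy of the tube stays in a given neighbourhood. -/
theorem eventually_r_mem {y : E} (hy : y ∈ M.tube.V) (hyS : y ∈ M.S) {C : Set E} (hC : C ∈ 𝓝 y) :
    ∀ᶠ x in 𝓝 y, ∀ s ∈ Icc (0 : ℝ) 1, M.tube.r s x ∈ C := by
  refine isCompact_Icc.eventually_forall_of_forall_eventually fun s hs => ?_
  have h1 : ContinuousAt (fun z : E × ℝ => M.tube.r z.2 z.1) (y, s) :=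
    ContinuousAt.comp (f := Prod.swap) (x := (y, s)) (M.contDiffAt_r hs hy).continuousAt
      continuous_swap.continuousAt
  refine h1.eventually_mem ?_
  change C ∈ 𝓝 (M.tube.r s y)
  rwa [M.tube.r_eq_self hy hyS (Icc_subset_strip hs)]

/-! ### Naturality -/

/-- A local diffeomorphism between local models that preserves all their structure. -/
structure IsMorphism (M M' : LocalModel E H) (h : E → E) (B : Set E) : Prop where
  isOpen : IsOpen B
  subset : B ⊆ M.T
  mapsTo : MapsTo h B M'.T
  contDiffOn : ContDiffOn ℝ ∞ h B
  surjective : ∀ y ∈ B, Surjective (fderiv ℝ h y)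
  mem_S : ∀ y ∈ B, y ∈ M.S → h y ∈ M'.S
  surjective_S : ∀ y ∈ B, y ∈ M.S → ∀ v' ∈ M'.S, ∃ v ∈ M.S, fderiv ℝ h y v = v'
  -- Comparing inner products is enough, so no action of the group on `H` is ever needed.
  inner_J : ∀ a ∈ B, ∀ b ∈ B, inner ℝ (M'.J (h a)) (M'.J (h b)) = inner ℝ (M.J a) (M.J b)
  ω₀_eq : ∀ y ∈ B, ∀ u v, M'.ω₀ (h y) (fderiv ℝ h y u) (fderiv ℝ h y v) = M.ω₀ y u v
  ω₁_eq : ∀ y ∈ B, ∀ u v, M'.ω₁ (h y) (fderiv ℝ h y u) (fderiv ℝ h y v) = M.ω₁ y u v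

namespace IsMorphism

variable {M} {M' : LocalModel E H} {h : E → E} {B : Set E} (hh : IsMorphism M M' h B)

include hh

theorem hasFDerivAt {y : E} (hy : y ∈ B) : HasFDerivAt h (fderiv ℝ h y) y :=
  ((hh.contDiffOn.contDiffAt (hh.isOpen.mem_nhds hy)).differentiableAt (by simp)).hasFDerivAt

/-- Differentiate `inner_J` in one argument at `w`, keeping the other fixed at `y` and at `w`, and
subtract. -/
theorem conormal_eq {w y : E} (hw : w ∈ B) (hy : y ∈ B) (v : E) :
    conormal M'.J (h w) (h y) (fderiv ℝ h w v) = conormal M.J w y v := by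
  have hJ : HasFDerivAt M.J (fderiv ℝ M.J w) w :=
    ((M.contDiffOn_J.contDiffAt (M.isOpen_T.mem_nhds (hh.subset hw))).differentiableAt
      (by simp)).hasFDerivAt
  have hJ' : HasFDerivAt (fun a => M'.J (h a)) ((fderiv ℝ M'.J (h w)).comp (fderiv ℝ h w)) w :=
    HasFDerivAt.comp w ((M'.contDiffOn_J.contDiffAt
      (M'.isOpen_T.mem_nhds (hh.mapsTo hw))).differentiableAt (by simp)).hasFDerivAt
      (hh.hasFDerivAt hw)
  have key : ∀ b ∈ B, inner ℝ (M'.J (h b)) (fderiv ℝ M'.J (h w) (fderiv ℝ h w v)) =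
      inner ℝ (M.J b) (fderiv ℝ M.J w v) := by
    intro b hb
    have h1 := ((innerSL ℝ (M'.J (h b))).hasFDerivAt (x := M'.J (h w))).comp w hJ'
    have h2 := ((innerSL ℝ (M.J b)).hasFDerivAt (x := M.J w)).comp w hJ
    have h3 := h1.unique (h2.congr_of_eventuallyEq ?_)
    · exact congrArg (fun A : E →L[ℝ] ℝ => A v) h3
    · filter_upwards [hh.isOpen.mem_nhds hw] with a ha
      exact hh.inner_J b hb a ha
  rw [conormal_apply, conormal_apply, inner_sub_left, inner_sub_left, key y hy, key w hw]

/-- By `conormal_eq`, `h` transports the equations characterising `p` and `r`, so the uniqueness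
clauses of the target tube apply. Surjectivity of the derivative, on `S` and on `E`, turns tests on
image vectors into tests on all vectors. -/
theorem r_eq {y : E} (hy : y ∈ B) (hyV : y ∈ M.tube.V) (hp : M.tube.p y ∈ B) {s : ℝ}
    (hs : s ∈ Ioo (-1 : ℝ) 2) (hr : M.tube.r s y ∈ B) (hyV' : h y ∈ M'.tube.V)
    (hpO : h (M.tube.p y) ∈ M'.tube.O) (hrO : h (M.tube.r s y) ∈ M'.tube.O) :
    M'.tube.r s (h y) = h (M.tube.r s y) := by
  have hpS : M.tube.p y ∈ M.S := M.tube.p_mem y hyV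
  have h1 : M'.tube.p (h y) = h (M.tube.p y) := by
    refine M'.tube.unique_p _ (M'.tube.V_subset hyV') _ (M'.tube.p_mem_O _ hyV') _ hpO
      (M'.tube.p_mem _ hyV') (hh.mem_S _ hp hpS) (M'.tube.conormal_p _ hyV') fun v' hv' => ?_
    obtain ⟨v, hv, rfl⟩ := hh.surjective_S _ hp hpS v' hv'
    rw [hh.conormal_eq hp hy, M.tube.conormal_p y hyV v hv]
  refine M'.tube.unique_r _ (M'.tube.p_mem_O _ hyV') _ (M'.tube.r_mem_O _ hyV' s hs) _ hrO ?_
  rw [M'.tube.conormal_r _ hyV' s hs, h1]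
  ext v'
  obtain ⟨v, rfl⟩ := hh.surjective _ hp v'
  rw [hh.conormal_eq hp hr, M.tube.conormal_r y hyV s hs]
  simp only [_root_.smul_apply]
  rw [hh.conormal_eq hp hy]

/-- If the homotopies correspond under `h`, so do the one-forms `β`. -/
theorem β_eq {C : Set E} (hC : IsOpen C) (hCB : C ⊆ B) (hCV : C ⊆ M.tube.V)
    (hCV' : MapsTo h C M'.tube.V)
    (hr : ∀ y ∈ C, ∀ s ∈ Icc (0 : ℝ) 1, M.tube.r s y ∈ B ∧ M'.tube.r s (h y) = h (M.tube.r s y))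
    {y : E} (hy : y ∈ C) (v : E) : M'.β (h y) (fderiv ℝ h y v) = M.β y v := by
  rw [M.β_apply (hCV hy), M'.β_apply (hCV' hy)]
  -- The homotopies correspond only for `s` in `[0, 1]`; at interior `s` this is enough to compare
  -- derivatives in `s`.
  rw [intervalIntegral.integral_of_le zero_le_one, intervalIntegral.integral_of_le zero_le_one,
    MeasureTheory.integral_Ioc_eq_integral_Ioo, MeasureTheory.integral_Ioc_eq_integral_Ioo]
  refine MeasureTheory.setIntegral_congr_fun measurableSet_Ioo fun s hs => ?_
  have hs' : s ∈ Icc (0 : ℝ) 1 := Ioo_subset_Icc_self hs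
  have ha := M.hasDerivAt_r_left hs' (hCV hy)
  have hB := M.hasFDerivAt_r_right hs' (hCV hy)
  have ha' := M'.hasDerivAt_r_left hs' (hCV' hy)
  have hB' := M'.hasFDerivAt_r_right hs' (hCV' hy)
  set a := fderiv ℝ (uncurry M.tube.r) (s, y) (1, 0)
  set A := (fderiv ℝ (uncurry M.tube.r) (s, y)).comp (ContinuousLinearMap.inr ℝ ℝ E)
  set a' := fderiv ℝ (uncurry M'.tube.r) (s, h y) (1, 0)
  set A' := (fderiv ℝ (uncurry M'.tube.r) (s, h y)).comp (ContinuousLinearMap.inr ℝ ℝ E)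
  have hrB := (hr y hy s hs').1
  have e1 : a' = fderiv ℝ h (M.tube.r s y) a := by
    have h1 : HasDerivAt (fun s => h (M.tube.r s y)) (fderiv ℝ h (M.tube.r s y) a) s :=
      (hh.hasFDerivAt hrB).comp_hasDerivAt s ha
    refine ha'.unique (h1.congr_of_eventuallyEq ?_)
    filter_upwards [isOpen_Ioo.mem_nhds hs] with s' hs'
    exact (hr y hy s' (Ioo_subset_Icc_self hs')).2
  have e2 : A' (fderiv ℝ h y v) = fderiv ℝ h (M.tube.r s y) (A v) := by
    have h1 : HasFDerivAt (fun y => h (M.tube.r s y)) ((fderiv ℝ h (M.tube.r s y)).comp A) y :=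
      HasFDerivAt.comp y (hh.hasFDerivAt hrB) hB
    have h2 : HasFDerivAt (fun y => M'.tube.r s (h y)) (A'.comp (fderiv ℝ h y)) y :=
      HasFDerivAt.comp y hB' (hh.hasFDerivAt (hCB hy))
    have h3 := h2.unique (h1.congr_of_eventuallyEq (by
      filter_upwards [hC.mem_nhds hy] with x hx
      exact (hr x hx s hs').2))
    exact congrArg (fun L : E →L[ℝ] E => L v) h3
  rw [M.integrand_apply hs' (hCV hy) ha hB, M'.integrand_apply hs' (hCV' hy) ha' hB', e1, e2,
    (hr y hy s hs').2, hh.ω₀_eq _ hrB, hh.ω₁_eq _ hrB]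

theorem ωt_eq (t : ℝ) {y : E} (hy : y ∈ B) (u v : E) :
    M'.ωt t (h y) (fderiv ℝ h y u) (fderiv ℝ h y v) = M.ωt t y u v := by
  simp only [ωt, _root_.add_apply, _root_.smul_apply, _root_.sub_apply, hh.ω₀_eq y hy,
    hh.ω₁_eq y hy]

/-- If the homotopies correspond under `h`, so do the flows. -/
theorem φ_eq {C : Set E} (hC : IsOpen C) (hCB : C ⊆ B) (hCV : C ⊆ M.flow.O)
    (hCV' : MapsTo h C M'.flow.O)
    (hr : ∀ y ∈ C, ∀ s ∈ Icc (0 : ℝ) 1, M.tube.r s y ∈ B ∧ M'.tube.r s (h y) = h (M.tube.r s y))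
    {y : E} (hy : y ∈ M.flow.V) (hy' : h y ∈ M'.flow.V) (hγ : ∀ t, M.flow.γ y t ∈ C) :
    M'.φ (h y) = h (M.φ y) := by
  have hcont : Continuous fun t : unitInterval => h (M.flow.γ y t) :=
    (hh.contDiffOn.continuousOn.mono hCB).comp_continuous (M.flow.γ y).continuous hγ
  let η : C(unitInterval, E) := ⟨fun t => h (M.flow.γ y t), hcont⟩
  suffices η = M'.flow.γ (h y) by
    rw [φ, ← this]; rfl
  refine M'.flow.unique _ hy' η (fun t => hCV' (hγ t)) (congrArg h (M.flow.γ_zero y hy))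
    fun t => ?_
  have h1 := M.flow.isFlowLine y hy t
  have h2 : HasFDerivAt h (fderiv ℝ h (M.flow.γ y t))
      (M.flow.γ y (projIcc 0 1 zero_le_one (t : ℝ))) := by
    rw [projIcc_val]; exact hh.hasFDerivAt (hCB (hγ t))
  have h3 := h2.comp_hasDerivWithinAt (t : ℝ) h1
  refine h3.congr_deriv ?_
  have hinv' := M'.flow.invertible _ (hCV' (hγ t)) t t.2
  have hinv := M.flow.invertible _ (hCV (hγ t)) t t.2
  -- The two velocities are compared through `ωt`: both give the same covector, by `ωt_eq` and
  -- `β_eq`.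
  have hinj : Injective (M'.ωt t (h (M.flow.γ y t))) := by
    obtain ⟨e, he⟩ := hinv'
    rw [← he]; exact e.injective
  refine hinj ?_
  change _ = M'.ωt t (h (M.flow.γ y t)) (M'.X t (h (M.flow.γ y t)))
  rw [M'.ωt_X hinv']
  ext v'
  obtain ⟨v, rfl⟩ := hh.surjective _ (hCB (hγ t)) v'
  rw [hh.ωt_eq t (hCB (hγ t)), M.ωt_X hinv, _root_.neg_apply, _root_.neg_apply,
    hh.β_eq hC hCB (hCV.trans M.flow.O_subset)
      (hCV'.mono_right M'.flow.O_subset) hr (hγ t)]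

end IsMorphism

end LocalModel

namespace LocalModel

variable {E : Type u} [NormedAddCommGroup E] [NormedSpace ℝ E] [FiniteDimensional ℝ E]
variable {H : Type*} [NormedAddCommGroup H] [InnerProductSpace ℝ H]
variable (M : LocalModel E H)

/-! ### The time-one map intertwines the contractions of the two forms -/

/-- A primitive of the contraction of `ω₁ - ω₀` with a symmetry of the tube computes the pairing of
`β` with this symmetry. -/
theorem β_apply_symmetry {B : Set E} (hB : Convex ℝ B) (hBT : B ⊆ M.T) (hyB : M.y₀ ∈ B)
    {ξ : E → E} {g : E → ℝ}
    (hg : ∀ y ∈ B, HasFDerivAt g (M.ω₁ y (ξ y) - M.ω₀ y (ξ y)) y)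
    {y : E} (hy : y ∈ M.tube.V) (hr : ∀ s ∈ Icc (0 : ℝ) 1, M.tube.r s y ∈ B)
    (hξ : ∀ s ∈ Icc (0 : ℝ) 1,
      fderiv ℝ (uncurry M.tube.r) (s, y) (0, ξ y) = ξ (M.tube.r s y)) :
    M.β y (ξ y) = g M.y₀ - g y := by
  -- The derivative of `g` vanishes on the convex set `B ∩ S`, where both forms agree as full
  -- covectors, and `r 0 y` lies in `S`.
  have hgS : g (M.tube.r 0 y) = g M.y₀ := by
    have h0 : M.tube.r 0 y ∈ M.S := by rw [M.tube.r_zero hy]; exact M.tube.p_mem y hy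
    have h1 := (hB.inter M.S.convex).norm_image_sub_le_of_norm_hasFDerivWithin_le (f := g)
      (f' := fun y => M.ω₁ y (ξ y) - M.ω₀ y (ξ y)) (C := 0) (x := M.y₀) (y := M.tube.r 0 y)
      (fun x hx => (hg x hx.1).hasFDerivWithinAt)
      (fun x hx => by rw [M.eq_on x (hBT hx.1) hx.2, sub_self, norm_zero])
      ⟨hyB, M.mem_S⟩ ⟨hr 0 (by simp), h0⟩
    rw [zero_mul, norm_le_zero_iff, sub_eq_zero] at h1
    exact h1
  -- As `r s` carries `ξ y` to `ξ (r s y)`, skew-symmetry exhibits the integrand as the derivative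
  -- of `-g` along `s ↦ r s y`.
  have hd : ∀ s ∈ uIcc (0 : ℝ) 1, HasDerivAt (fun s => -g (M.tube.r s y))
      (M.integrand (s, y) (ξ y)) s := by
    intro s hs
    rw [uIcc_of_le zero_le_one] at hs
    have h1 := ((hg _ (hr s hs)).comp_hasDerivAt s (M.hasDerivAt_r_left hs hy)).neg
    refine h1.congr_deriv ?_
    rw [M.integrand_apply hs hy (M.hasDerivAt_r_left hs hy) (M.hasFDerivAt_r_right hs hy)]
    have h2 : ((fderiv ℝ (uncurry M.tube.r) (s, y)).comp (ContinuousLinearMap.inr ℝ ℝ E)) (ξ y) =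
        ξ (M.tube.r s y) := hξ s hs
    rw [h2, _root_.sub_apply, M.skew₁ _ (ξ _), M.skew₀ _ (ξ _)]
    ring
  have hint : IntervalIntegrable (fun s => M.integrand (s, y) (ξ y)) MeasureTheory.volume 0 1 := by
    refine ContinuousOn.intervalIntegrable ?_
    rw [uIcc_of_le zero_le_one]
    intro s hs
    have h1 : ContinuousAt (fun s : ℝ => M.integrand (s, y)) s :=
      ContinuousAt.comp (f := fun s : ℝ => (s, y)) (M.contDiffAt_integrand hs hy).continuousAt
        (Continuous.prodMk_left y).continuousAt
    exact (h1.clm_apply continuousAt_const).continuousWithinAt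
  rw [M.β_apply hy, intervalIntegral.integral_eq_sub_of_hasDerivAt hd hint, M.tube.r_one hy, hgS]
  ring

/-- Primitives of the contractions are intertwined by the time-one map. -/
theorem primitive_φ {B : Set E} (hB : Convex ℝ B) (hBT : B ⊆ M.T) (hyB : M.y₀ ∈ B)
    {ξ : E → E} {f g : E → ℝ} (hf : ∀ y ∈ B, HasFDerivAt f (M.ω₀ y (ξ y)) y)
    (hg : ∀ y ∈ B, HasFDerivAt g (M.ω₁ y (ξ y) - M.ω₀ y (ξ y)) y)
    {C : Set E} (hCB : C ⊆ B) (hCO : C ⊆ M.flow.O)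
    (hr : ∀ y ∈ C, ∀ s ∈ Icc (0 : ℝ) 1, M.tube.r s y ∈ B)
    (hξ : ∀ y ∈ C, ∀ s ∈ Icc (0 : ℝ) 1,
      fderiv ℝ (uncurry M.tube.r) (s, y) (0, ξ y) = ξ (M.tube.r s y))
    {y : E} (hy : y ∈ M.flow.V) (hγ : ∀ t, M.flow.γ y t ∈ C) :
    f (M.φ y) + g (M.φ y) = f y + g M.y₀ := by
  let η : ℝ → E := fun t => M.flow.γ y (projIcc 0 1 zero_le_one t)
  have hη : ∀ t (ht : t ∈ Icc (0 : ℝ) 1), η t = M.flow.γ y ⟨t, ht⟩ := fun t ht => by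
    simp only [η, projIcc_of_mem zero_le_one ht]
  -- The conserved quantity is a primitive of `ι_ξ ω_t`. Its explicit `t`-derivative `g - g y₀`
  -- cancels against `ω_t (ξ, X_t) = β ξ = g y₀ - g`.
  have hd : ∀ t ∈ Icc (0 : ℝ) 1, HasDerivWithinAt
      (fun t => f (η t) + t * (g (η t) - g M.y₀)) 0 (Icc 0 1) t := by
    intro t ht
    have hC := hγ ⟨t, ht⟩
    have h1 : HasDerivWithinAt η (M.X t (η t)) (Icc 0 1) t := by
      have := M.flow.isFlowLine y hy ⟨t, ht⟩
      rw [← hη t ht] at this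
      exact this
    rw [← hη t ht] at hC
    have h2 := (hf _ (hCB hC)).comp_hasDerivWithinAt t h1
    have h3 := (hg _ (hCB hC)).comp_hasDerivWithinAt t h1
    have h4 := h2.add ((hasDerivWithinAt_id t (Icc 0 1)).mul (h3.sub_const (g M.y₀)))
    refine h4.congr_deriv ?_
    have h5 := M.β_apply_symmetry hB hBT hyB hg (M.flow.O_subset (hCO hC)) (hr _ hC) (hξ _ hC)
    have h6 := congrArg (fun A : E →L[ℝ] ℝ => A (ξ (η t)))
      (M.ωt_X (M.flow.invertible _ (hCO hC) t ht))
    simp only [_root_.neg_apply, h5] at h6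
    rw [M.ωt_skew] at h6
    simp only [ωt, _root_.add_apply, _root_.smul_apply, _root_.sub_apply, smul_eq_mul] at h6
    simp only [_root_.sub_apply, id, one_mul]
    simp only [Function.comp_apply]
    linarith
  have h1 := norm_image_sub_le_of_norm_deriv_le_segment' hd (C := 0) (fun t _ => by simp) 1
    (by simp)
  rw [zero_mul, zero_mul, norm_le_zero_iff, sub_eq_zero] at h1
  have e0 : η 0 = y := by rw [hη 0 (by simp)]; exact M.flow.γ_zero y hy
  have e1 : η 1 = M.φ y := by rw [hη 1 (by simp)]; rfl
  simp only [e0, e1] at h1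
  linarith

/-- The time-one map pulls back the contraction of `ω₁` with every symmetry of the tube for which
the contractions are closed to the contraction of `ω₀`. -/
theorem eventually_pullback_eq {Ξ : Type*} (ξ : Ξ → E → E)
    (hξs : ∀ i, DifferentiableOn ℝ (ξ i) M.T)
    (hc₀ : ∀ i, ∀ y ∈ M.T, ∀ u v, fderiv ℝ (fun y => M.ω₀ y (ξ i y)) y u v =
      fderiv ℝ (fun y => M.ω₀ y (ξ i y)) y v u)
    (hc₁ : ∀ i, ∀ y ∈ M.T, ∀ u v, fderiv ℝ (fun y => M.ω₁ y (ξ i y)) y u v =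
      fderiv ℝ (fun y => M.ω₁ y (ξ i y)) y v u)
    (hξ : ∀ᶠ y in 𝓝 M.y₀, ∀ i, ∀ s ∈ Icc (0 : ℝ) 1,
      fderiv ℝ (uncurry M.tube.r) (s, y) (0, ξ i y) = ξ i (M.tube.r s y)) :
    ∀ᶠ y in 𝓝 M.y₀, ∀ i v,
      M.ω₁ (M.φ y) (ξ i (M.φ y)) (fderiv ℝ M.φ y v) = M.ω₀ y (ξ i y) v := by
  obtain ⟨ε, hε, hBT⟩ := Metric.isOpen_iff.1 M.isOpen_T M.y₀ M.mem_T
  set B := Metric.ball M.y₀ ε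
  have hyB : M.y₀ ∈ B := Metric.mem_ball_self hε
  have hBo : IsOpen B := Metric.isOpen_ball
  have hyV : M.y₀ ∈ M.flow.V := M.flow.mem_V
  obtain ⟨C, hCsub, hC, hyC⟩ := mem_nhds_iff.1 (inter_mem (inter_mem (hBo.mem_nhds hyB)
    (M.flow.isOpen_O.mem_nhds (M.flow.V_subset hyV)))
    (inter_mem hξ (M.eventually_r_mem M.tube.mem_V M.mem_S (hBo.mem_nhds hyB))))
  have hev := M.eventually_γ_mem hyV M.mem_S (hC.mem_nhds hyC)
  filter_upwards [eventually_eventually_nhds.2 hev, M.flow.isOpen_V.mem_nhds hyV] with y hy hyV' i v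
  have hd₀ : DifferentiableOn ℝ (fun y => M.ω₀ y (ξ i y)) M.T :=
    (M.contDiffOn_ω₀.differentiableOn (by simp)).clm_apply (hξs i)
  have hd₁ : DifferentiableOn ℝ (fun y => M.ω₁ y (ξ i y)) M.T :=
    (M.contDiffOn_ω₁.differentiableOn (by simp)).clm_apply (hξs i)
  -- Poincaré lemma on a ball: the symmetric derivatives provide primitives of both contractions.
  obtain ⟨f, hf⟩ := (convex_ball M.y₀ ε).exists_forall_hasFDerivAt_of_fderiv_symmetric hBo
    (hd₀.mono hBT) (fun a ha => hc₀ i a (hBT ha))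
  obtain ⟨f', hf'⟩ := (convex_ball M.y₀ ε).exists_forall_hasFDerivAt_of_fderiv_symmetric hBo
    (hd₁.mono hBT) (fun a ha => hc₁ i a (hBT ha))
  -- Conservation with `g = f' - f` says that `f' ∘ φ` and `f` differ by a constant; the claim is
  -- the derivative of this identity.
  have key : (fun y => f' (M.φ y)) =ᶠ[𝓝 y] fun y => f y + (f' M.y₀ - f M.y₀) := by
    filter_upwards [hy, M.flow.isOpen_V.mem_nhds hyV'] with x hx hxV
    have := M.primitive_φ (convex_ball M.y₀ ε) hBT hyB (g := fun y => f' y - f y) hf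
      (fun z hz => (hf' z hz).sub (hf z hz)) (fun z hz => (hCsub hz).1.1)
      (fun z hz => (hCsub hz).1.2) (fun z hz => (hCsub hz).2.2)
      (fun z hz => (hCsub hz).2.1 i) hxV hx
    linarith
  have hφC : M.φ y ∈ C := hy.self_of_nhds 1
  have hyC' : y ∈ C := by
    have := hy.self_of_nhds 0
    rwa [M.flow.γ_zero y hyV'] at this
  have hφd : HasFDerivAt M.φ (fderiv ℝ M.φ y) y :=
    ((M.contDiffOn_φ.contDiffAt (M.flow.isOpen_V.mem_nhds hyV')).differentiableAt
      (by simp)).hasFDerivAt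
  have h1 := HasFDerivAt.comp y (hf' _ (hCsub hφC).1.1) hφd
  have h2 := ((hf y (hCsub hyC').1.1).add_const (f' M.y₀ - f M.y₀)).congr_of_eventuallyEq key
  exact congrArg (fun A : E →L[ℝ] ℝ => A v) (h1.unique h2)

end LocalModel

/-! ### Derivatives as linear maps between model spaces -/

section TangentMap

variable {E₁ : Type*} [NormedAddCommGroup E₁] [NormedSpace ℝ E₁] {M₁ : Type*} [TopologicalSpace M₁]
  [ChartedSpace E₁ M₁]
variable {E₂ : Type*} [NormedAddCommGroup E₂] [NormedSpace ℝ E₂] {M₂ : Type*} [TopologicalSpace M₂]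
  [ChartedSpace E₂ M₂]
variable {E₃ : Type*} [NormedAddCommGroup E₃] [NormedSpace ℝ E₃] {M₃ : Type*} [TopologicalSpace M₃]
  [ChartedSpace E₃ M₃]

/-- The derivative of a map between manifolds, as a map between the model spaces. -/
def tderiv (E₁ E₂ : Type*) [NormedAddCommGroup E₁] [NormedSpace ℝ E₁] {M₁ : Type*}
    [TopologicalSpace M₁] [ChartedSpace E₁ M₁] [NormedAddCommGroup E₂] [NormedSpace ℝ E₂]
    {M₂ : Type*} [TopologicalSpace M₂] [ChartedSpace E₂ M₂] (f : M₁ → M₂) (x : M₁) :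
    E₁ →L[ℝ] E₂ :=
  mfderiv 𝓘(ℝ, E₁) 𝓘(ℝ, E₂) f x

theorem tderiv_comp {g : M₂ → M₃} {f : M₁ → M₂} {x : M₁} {y : M₂}
    (hg : MDifferentiableAt 𝓘(ℝ, E₂) 𝓘(ℝ, E₃) g y)
    (hf : MDifferentiableAt 𝓘(ℝ, E₁) 𝓘(ℝ, E₂) f x) (hy : f x = y) :
    tderiv E₁ E₃ (fun x => g (f x)) x = (tderiv E₂ E₃ g y).comp (tderiv E₁ E₂ f x) := by
  subst hy
  exact mfderiv_comp x hg hf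

theorem tderiv_congr {f g : M₁ → M₂} {x : M₁} (h : f =ᶠ[𝓝 x] g) :
    tderiv E₁ E₂ f x = tderiv E₁ E₂ g x :=
  h.mfderiv_eq

theorem tderiv_id (x : M₁) : tderiv E₁ E₁ (fun x : M₁ => x) x = ContinuousLinearMap.id ℝ E₁ :=
  mfderiv_id

theorem tderiv_eq_fderiv (f : E₁ → E₂) (x : E₁) : tderiv E₁ E₂ f x = fderiv ℝ f x :=
  mfderiv_eq_fderiv

end TangentMap

section Charts

variable {E : Type*} [NormedAddCommGroup E] [NormedSpace ℝ E]
variable {X : Type*} [TopologicalSpace X] [ChartedSpace E X] [IsManifold 𝓘(ℝ, E) ∞ X]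
variable {c : OpenPartialHomeomorph X E} (hc : c ∈ IsManifold.maximalAtlas 𝓘(ℝ, E) ∞ X)

include hc

theorem contMDiffAt_chart {x : X} (hx : x ∈ c.source) :
    ContMDiffAt 𝓘(ℝ, E) 𝓘(ℝ, E) ∞ c x :=
  (contMDiffOn_of_mem_maximalAtlas hc).contMDiffAt (c.open_source.mem_nhds hx)

theorem contMDiffAt_chart_symm {y : E} (hy : y ∈ c.target) :
    ContMDiffAt 𝓘(ℝ, E) 𝓘(ℝ, E) ∞ c.symm y :=
  (contMDiffOn_symm_of_mem_maximalAtlas hc).contMDiffAt (c.open_target.mem_nhds hy)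

theorem mdifferentiableAt_chart {x : X} (hx : x ∈ c.source) :
    MDifferentiableAt 𝓘(ℝ, E) 𝓘(ℝ, E) c x :=
  (contMDiffAt_chart hc hx).mdifferentiableAt (by simp)

theorem mdifferentiableAt_chart_symm {y : E} (hy : y ∈ c.target) :
    MDifferentiableAt 𝓘(ℝ, E) 𝓘(ℝ, E) c.symm y :=
  (contMDiffAt_chart_symm hc hy).mdifferentiableAt (by simp)

theorem tderiv_chart_symm_apply {y : E} (hy : y ∈ c.target) (v : E) :
    tderiv E E c (c.symm y) (tderiv E E c.symm y v) = v := by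
  have h1 := tderiv_comp (mdifferentiableAt_chart hc (c.map_target hy))
    (mdifferentiableAt_chart_symm hc hy) rfl
  have h2 : (fun y => c (c.symm y)) =ᶠ[𝓝 y] fun y => y := by
    filter_upwards [c.open_target.mem_nhds hy] with z hz using c.right_inv hz
  rw [tderiv_congr h2, tderiv_id] at h1
  exact (congrArg (fun A : E →L[ℝ] E => A v) h1).symm

theorem tderiv_symm_chart_apply {x : X} (hx : x ∈ c.source) (v : E) :
    tderiv E E c.symm (c x) (tderiv E E c x v) = v := by
  have h1 := tderiv_comp (mdifferentiableAt_chart_symm hc (c.map_source hx))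
    (mdifferentiableAt_chart hc hx) rfl
  have h2 : (fun y => c.symm (c y)) =ᶠ[𝓝 x] fun y => y := by
    filter_upwards [c.open_source.mem_nhds hx] with z hz using c.left_inv hz
  rw [tderiv_congr h2, tderiv_id] at h1
  exact (congrArg (fun A : E →L[ℝ] E => A v) h1).symm

end Charts

/-! ### Equivariant immersions in a Hilbert space -/

section Averaging

variable {F : Type*} [NormedAddCommGroup F] [NormedSpace ℝ F] [FiniteDimensional ℝ F]
variable {K : Type v} [TopologicalSpace K] [ChartedSpace F K] [Group K]
  [LieGroup 𝓘(ℝ, F) ∞ K] [CompactSpace K]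
variable {E : Type u} [NormedAddCommGroup E] [NormedSpace ℝ E] [FiniteDimensional ℝ E]
variable {X : Type*} [TopologicalSpace X] [ChartedSpace E X] [IsManifold 𝓘(ℝ, E) ∞ X]
  [MulAction K X] [ContMDiffSMul 𝓘(ℝ, F) 𝓘(ℝ, E) ∞ K X]

variable (F) in
theorem smoothFamilyAt_smul {c : OpenPartialHomeomorph X E}
    (hc : c ∈ IsManifold.maximalAtlas 𝓘(ℝ, E) ∞ X) {i : X → E}
    (hi : ContMDiff 𝓘(ℝ, E) 𝓘(ℝ, E) ∞ i) (k : K) {y : E} (hy : y ∈ c.target) :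
    SmoothFamilyAt F (fun (k : K) (y : E) => i (k⁻¹ • c.symm y)) k y := by
  refine ⟨chartAt F k, fun z => i (((chartAt F k).symm z.1)⁻¹ • c.symm z.2),
    (chartAt F k).continuousAt (mem_chart_source F k), ?_, ?_⟩
  · rw [← contMDiffAt_iff_contDiffAt]
    have h1 : ContMDiffAt 𝓘(ℝ, F × E) 𝓘(ℝ, F) ∞ (fun z : F × E => (chartAt F k).symm z.1)
        (chartAt F k k, y) := by
      have h : ContMDiffAt 𝓘(ℝ, F) 𝓘(ℝ, F) ∞ (chartAt F k).symm (chartAt F k k) :=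
        contMDiffOn_chart_symm.contMDiffAt
          ((chartAt F k).open_target.mem_nhds (mem_chart_target F k))
      exact ContMDiffAt.comp (chartAt F k k, y) h contDiff_fst.contMDiff.contMDiffAt
    have h2 : ContMDiffAt 𝓘(ℝ, F × E) 𝓘(ℝ, E) ∞ (fun z : F × E => c.symm z.2)
        (chartAt F k k, y) := by
      exact ContMDiffAt.comp (chartAt F k k, y) (contMDiffAt_chart_symm hc hy) contDiff_snd.contMDiff.contMDiffAt
    exact ContMDiffAt.comp (chartAt F k k, y) hi.contMDiffAt (h1.inv.smul h2)
  · have h : ∀ᶠ k' in 𝓝 k, k' ∈ (chartAt F k).source :=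
      (chartAt F k).open_source.mem_nhds (mem_chart_source F k)
    filter_upwards [(continuous_fst.tendsto (k, y)).eventually h] with z hz
    simp only [(chartAt F k).left_inv hz]

/-- The orbit map `x ↦ (k ↦ i (k⁻¹ x))`. -/
def orbitMap (F : Type*) [NormedAddCommGroup F] [NormedSpace ℝ F]
    {K : Type v} [TopologicalSpace K] [ChartedSpace F K] [Group K]
    [LieGroup 𝓘(ℝ, F) ∞ K] {E : Type u} [NormedAddCommGroup E] [NormedSpace ℝ E]
    {X : Type*} [TopologicalSpace X] [ChartedSpace E X]
    [MulAction K X] [ContMDiffSMul 𝓘(ℝ, F) 𝓘(ℝ, E) ∞ K X]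
    {i : X → E} (hi : ContMDiff 𝓘(ℝ, E) 𝓘(ℝ, E) ∞ i) (x : X) : C(K, E) :=
  ⟨fun k => i (k⁻¹ • x), by
    have h1 : ContMDiff 𝓘(ℝ, F) 𝓘(ℝ, F) ∞ (fun k : K => k⁻¹) := contMDiff_inv 𝓘(ℝ, F) ∞
    have h2 : ContMDiff 𝓘(ℝ, F) 𝓘(ℝ, E) ∞ (fun k : K => k⁻¹ • x) :=
      h1.smul (I := 𝓘(ℝ, F)) contMDiff_const
    exact (hi.comp h2).continuous⟩

/-- After a cutoff in the chart, the orbit map is a superposition operator applied to constant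
functions. -/
theorem exists_orbitMap_eq {c : OpenPartialHomeomorph X E}
    (hc : c ∈ IsManifold.maximalAtlas 𝓘(ℝ, E) ∞ X) {i : X → E}
    (hi : ContMDiff 𝓘(ℝ, E) 𝓘(ℝ, E) ∞ i) {y : E} (hy : y ∈ c.target) :
    ContDiffAt ℝ ∞ (fun y => orbitMap F (K := K) hi (c.symm y)) y := by
  obtain ⟨f, hf, he⟩ := exists_isSmoothFamily_eventuallyEq (P := F)
    (f := fun (k : K) (y : E) => i (k⁻¹ • c.symm y)) c.open_target
    (fun k x hx => smoothFamilyAt_smul F hc hi k hx) hy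
  have h1 : ContDiffAt ℝ ∞ (fun y => superpose hf (constCLM K E y)) y :=
    ((contDiff_superpose hf).comp (constCLM K E).contDiff).contDiffAt
  refine h1.congr_of_eventuallyEq (he.mono fun x hx => ?_)
  ext1 k
  exact (hx k).symm

/-- A function can be averaged to a map to a Hilbert space on whose image `K` acts by isometries. -/
theorem exists_averaged
    (F : Type*) [NormedAddCommGroup F] [NormedSpace ℝ F] [FiniteDimensional ℝ F]
    (K : Type v) [TopologicalSpace K] [ChartedSpace F K] [Group K]
    [LieGroup 𝓘(ℝ, F) ∞ K] [CompactSpace K]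
    {E : Type u} [NormedAddCommGroup E] [NormedSpace ℝ E] [FiniteDimensional ℝ E]
    {X : Type*} [TopologicalSpace X] [ChartedSpace E X] [IsManifold 𝓘(ℝ, E) ∞ X]
    [MulAction K X] [ContMDiffSMul 𝓘(ℝ, F) 𝓘(ℝ, E) ∞ K X]
    {i : X → E} (hi : ContMDiff 𝓘(ℝ, E) 𝓘(ℝ, E) ∞ i) :
    ∃ (H : Type v) (_ : NormedAddCommGroup H) (_ : InnerProductSpace ℝ H) (J : X → H),
      (∀ c ∈ IsManifold.maximalAtlas 𝓘(ℝ, E) ∞ X, ContDiffOn ℝ ∞ (fun y => J (c.symm y)) c.target) ∧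
      (∀ (k : K) (x y : X), inner ℝ (J (k • x)) (J (k • y)) = inner ℝ (J x) (J y)) ∧
      ∀ c ∈ IsManifold.maximalAtlas 𝓘(ℝ, E) ∞ X, ∀ y ∈ c.target, ∀ v,
        fderiv ℝ (fun y => J (c.symm y)) y v = 0 → fderiv ℝ (fun y => i (c.symm y)) y v = 0 := by
  have : IsTopologicalGroup K := topologicalGroup_of_lieGroup 𝓘(ℝ, F) ∞
  borelize K
  let μ : MeasureTheory.Measure K := MeasureTheory.Measure.haar
  -- `E` is only normed; a Euclidean copy makes the `L²` space a Hilbert space.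
  let V := EuclideanSpace ℝ (Fin (Module.finrank ℝ E))
  let e : E ≃L[ℝ] V := toEuclidean
  let A : C(K, E) →L[ℝ] MeasureTheory.Lp V 2 μ := (ContinuousMap.toLp 2 μ ℝ).comp
    (ContinuousLinearMap.compLeftContinuous ℝ K (e : E →L[ℝ] V))
  have hA : ∀ u v : C(K, E), inner ℝ (A u) (A v) =
      ∫ k, inner ℝ (e (u k)) (e (v k)) ∂μ := by
    intro u v
    rw [MeasureTheory.L2.inner_def]
    refine MeasureTheory.integral_congr_ae ?_
    filter_upwards [ContinuousMap.coeFn_toLp (p := 2) μ (𝕜 := ℝ)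
      (ContinuousLinearMap.compLeftContinuous ℝ K (e : E →L[ℝ] V) u),
      ContinuousMap.coeFn_toLp (p := 2) μ (𝕜 := ℝ)
      (ContinuousLinearMap.compLeftContinuous ℝ K (e : E →L[ℝ] V) v)] with k h1 h2
    exact congrArg₂ (fun a b : V => (inner ℝ a b : ℝ)) h1 h2
  have hAinj : Injective A := by
    refine Injective.comp (g := ContinuousMap.toLp (E := V) 2 μ ℝ)
      (ContinuousMap.toLp_injective μ) fun u v h => ?_
    ext1 k
    have := congrArg (fun w : C(K, V) => w k) h
    exact e.injective this
  refine ⟨MeasureTheory.Lp V 2 μ, inferInstance, inferInstance,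
    fun x => A (orbitMap F hi x), ?_, ?_, ?_⟩
  · intro c hc y hy
    exact (A.contDiff.contDiffAt.comp y (exists_orbitMap_eq hc hi hy)).contDiffWithinAt
  · intro k x y
    rw [hA, hA]
    -- Left translation by `k⁻¹` turns the orbit map of `x` into that of `k • x`, because `(k⁻¹
    -- k')⁻¹ = k'⁻¹ k`.
    rw [← MeasureTheory.integral_mul_left_eq_self (μ := μ) (fun k' : K =>
      (inner ℝ (e (orbitMap F hi x k')) (e (orbitMap F hi y k')) : ℝ)) k⁻¹]
    refine MeasureTheory.integral_congr_ae (Eventually.of_forall fun k' => ?_)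
    simp only [orbitMap, ContinuousMap.coe_mk, mul_inv_rev, inv_inv, mul_smul]
  · intro c hc y hy v hv
    have hd := ((exists_orbitMap_eq (F := F) (K := K) hc hi hy).differentiableAt
      (by simp)).hasFDerivAt
    have h1 := A.hasFDerivAt.comp y hd
    have h2 : A (fderiv ℝ (fun y => orbitMap F (K := K) hi (c.symm y)) y v) = 0 := by
      rw [← hv, show fderiv ℝ (fun y => A (orbitMap F (K := K) hi (c.symm y))) y = _ from h1.fderiv]
      rfl
    -- Continuous functions embed in `L²`, so no tangent information is lost; evaluating the orbit
    -- map at `1` then recovers `i`.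
    have h3 : fderiv ℝ (fun y => orbitMap F (K := K) hi (c.symm y)) y v = 0 :=
      hAinj (by rw [h2, map_zero])
    have h4 := (evalAt E (1 : K)).hasFDerivAt.comp y hd
    have h5 : HasFDerivAt (fun y => i (c.symm y)) ((evalAt E (1 : K)).comp
        (fderiv ℝ (fun y => orbitMap F (K := K) hi (c.symm y)) y)) y := by
      refine h4.congr_of_eventuallyEq (Eventually.of_forall fun x => ?_)
      simp [orbitMap]
    rw [h5.fderiv, ContinuousLinearMap.comp_apply, h3, map_zero]

/-- A chart times a bump function is an immersion wherever the bump is locally `1`, and finitely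
many such sets cover the compact `W`. -/
theorem exists_finite_immersion [T2Space X] {W : Set X} (hW : IsCompact W) :
    ∃ (n : ℕ) (i : Fin n → X → E), (∀ j, ContMDiff 𝓘(ℝ, E) 𝓘(ℝ, E) ∞ (i j)) ∧
      ∀ q ∈ W, ∃ j, Injective (tderiv E E (i j) q) := by
  let f : ∀ q : X, SmoothBumpFunction 𝓘(ℝ, E) q := fun q => Classical.choice inferInstance
  let i : X → X → E := fun q x => f q x • extChartAt 𝓘(ℝ, E) q x
  have hi : ∀ q, ContMDiff 𝓘(ℝ, E) 𝓘(ℝ, E) ∞ (i q) := fun q =>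
    (f q).contMDiff_smul contMDiffOn_extChartAt
  let U : X → Set X := fun q => {x | (∀ᶠ x' in 𝓝 x, f q x' = 1) ∧ x ∈ (chartAt E q).source}
  have hU : ∀ q, U q ∈ 𝓝 q := fun q =>
    inter_mem (eventually_eventually_nhds.2 (f q).eventuallyEq_one) (chart_source_mem_nhds E q)
  obtain ⟨t, -, ht⟩ := hW.elim_nhds_subcover U fun q _ => hU q
  refine ⟨t.card, fun j => i (t.equivFin.symm j), fun j => hi _, fun q hq => ?_⟩
  obtain ⟨q₀, hq₀, hqU⟩ := mem_iUnion₂.1 (ht hq)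
  obtain ⟨j, hj⟩ := t.equivFin.symm.surjective ⟨q₀, hq₀⟩
  refine ⟨j, ?_⟩
  change Injective (tderiv E E (i (t.equivFin.symm j)) q)
  rw [hj]
  have h1 : i q₀ =ᶠ[𝓝 q] chartAt E q₀ := hqU.1.mono fun x hx => by
    simp only [i, hx, one_smul]; rfl
  rw [tderiv_congr h1]
  exact LeftInverse.injective (g := tderiv E E (chartAt E q₀).symm (chartAt E q₀ q))
    (tderiv_symm_chart_apply (IsManifold.chart_mem_maximalAtlas q₀) hqU.2)

/-- An immersion along `W` in a Hilbert space on whose image `K` acts by isometries. -/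
theorem exists_invariant_immersion
    (F : Type*) [NormedAddCommGroup F] [NormedSpace ℝ F] [FiniteDimensional ℝ F]
    (K : Type v) [TopologicalSpace K] [ChartedSpace F K] [Group K]
    [LieGroup 𝓘(ℝ, F) ∞ K] [CompactSpace K]
    {E : Type u} [NormedAddCommGroup E] [NormedSpace ℝ E] [FiniteDimensional ℝ E]
    {X : Type*} [TopologicalSpace X] [ChartedSpace E X] [IsManifold 𝓘(ℝ, E) ∞ X]
    [MulAction K X] [ContMDiffSMul 𝓘(ℝ, F) 𝓘(ℝ, E) ∞ K X]
    [T2Space X] {W : Set X} (hW : IsCompact W) :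
    ∃ (H : Type v) (_ : NormedAddCommGroup H) (_ : InnerProductSpace ℝ H) (J : X → H),
      (∀ c ∈ IsManifold.maximalAtlas 𝓘(ℝ, E) ∞ X, ContDiffOn ℝ ∞ (fun y => J (c.symm y)) c.target) ∧
      (∀ (k : K) (x y : X), inner ℝ (J (k • x)) (J (k • y)) = inner ℝ (J x) (J y)) ∧
      ∀ c ∈ IsManifold.maximalAtlas 𝓘(ℝ, E) ∞ X, ∀ q ∈ W, q ∈ c.source →
        Injective (fderiv ℝ (fun y => J (c.symm y)) (c q)) := by
  obtain ⟨n, i, hi, hinj⟩ := exists_finite_immersion (E := E) hW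
  choose H iH iI J hJ1 hJ2 hJ3 using fun j => exists_averaged F K (hi j)
  -- In the Hilbert sum inner products add, so invariance persists, and a vector killed by the
  -- derivative is killed in each component.
  refine ⟨PiLp 2 H, inferInstance, inferInstance, fun x => WithLp.toLp 2 fun j => J j x,
    ?_, ?_, ?_⟩
  · intro c hc
    exact (contDiffOn_piLp 2).2 fun j => hJ1 j c hc
  · intro k x y
    simp only [PiLp.inner_apply, hJ2]
  · intro c hc q hq hqc
    rw [injective_iff_map_eq_zero]
    intro v hv
    have hy : c q ∈ c.target := c.map_source hqc
    obtain ⟨j, hj⟩ := hinj q hq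
    have hd : DifferentiableAt ℝ (fun y => (WithLp.toLp 2 fun j => J j (c.symm y) : PiLp 2 H))
        (c q) :=
      (((contDiffOn_piLp 2).2 fun j => hJ1 j c hc).contDiffAt
        (c.open_target.mem_nhds hy)).differentiableAt (by simp)
    have h1 : fderiv ℝ (fun y => J j (c.symm y)) (c q) v = 0 := by
      have h2 := (PiLp.proj (𝕜 := ℝ) 2 H j).hasFDerivAt.comp (c q) hd.hasFDerivAt
      have h3 := h2.fderiv
      change fderiv ℝ (fun y => J j (c.symm y)) (c q) = _ at h3
      rw [h3, ContinuousLinearMap.comp_apply, hv, map_zero]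
    have h2 := hJ3 j c hc (c q) hy v h1
    have h3 := tderiv_comp (E₁ := E) (E₂ := E) (E₃ := E)
      ((hi j).mdifferentiableAt (by simp) (x := q))
      (mdifferentiableAt_chart_symm hc hy) (c.left_inv hqc)
    rw [tderiv_eq_fderiv] at h3
    rw [h3, ContinuousLinearMap.comp_apply] at h2
    have h4 := hj (h2.trans (map_zero _).symm)
    rw [← tderiv_chart_symm_apply hc hy v, h4, map_zero]

end Averaging

/-! ### Differential forms in charts of the maximal atlas -/

section FormsInCharts

variable {E : Type u} [NormedAddCommGroup E] [NormedSpace ℝ E]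
variable {X : Type*} [TopologicalSpace X] [ChartedSpace E X]

/-- The local expression of a form in a chart. -/
def pullForm {k : ℕ} (c : OpenPartialHomeomorph X E) (α : DiffForm E X k) (y : E) :
    E [⋀^Fin k]→L[ℝ] ℝ :=
  ContinuousAlternatingMap.compContinuousLinearMap
    (α (c.symm y) : E [⋀^Fin k]→L[ℝ] ℝ) (tderiv E E c.symm y)

theorem pullForm_apply {k : ℕ} (c : OpenPartialHomeomorph X E) (α : DiffForm E X k) (y : E)
    (w : Fin k → E) :
    pullForm c α y w = (α (c.symm y) : E [⋀^Fin k]→L[ℝ] ℝ) fun i => tderiv E E c.symm y (w i) :=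
  rfl

theorem inChart_eq_pullForm {k : ℕ} (α : DiffForm E X k) (x₀ : X) :
    α.inChart x₀ = pullForm (chartAt E x₀) α := rfl

theorem extChartAt_target_eq (x₀ : X) :
    (extChartAt 𝓘(ℝ, E) x₀).target = (chartAt E x₀).target := by
  simp [mfld_simps]

variable [IsManifold 𝓘(ℝ, E) ∞ X]

/-- The transition map from one chart to another. -/
theorem contDiffAt_transition {c e : OpenPartialHomeomorph X E}
    (hc : c ∈ IsManifold.maximalAtlas 𝓘(ℝ, E) ∞ X) (he : e ∈ IsManifold.maximalAtlas 𝓘(ℝ, E) ∞ X)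
    {y : E} (hy : y ∈ c.target) (hye : c.symm y ∈ e.source) :
    ContDiffAt ℝ ∞ (fun y => e (c.symm y)) y := by
  rw [← contMDiffAt_iff_contDiffAt]
  exact ContMDiffAt.comp y (contMDiffAt_chart he hye) (contMDiffAt_chart_symm hc hy)

theorem tderiv_symm_transition {c e : OpenPartialHomeomorph X E}
    (hc : c ∈ IsManifold.maximalAtlas 𝓘(ℝ, E) ∞ X) (he : e ∈ IsManifold.maximalAtlas 𝓘(ℝ, E) ∞ X)
    {y : E} (hy : y ∈ c.target) (hye : c.symm y ∈ e.source) :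
    tderiv E E c.symm y =
      (tderiv E E e.symm (e (c.symm y))).comp (fderiv ℝ (fun y => e (c.symm y)) y) := by
  have h1 : (fun y => e.symm (e (c.symm y))) =ᶠ[𝓝 y] c.symm := by
    have := (c.symm.continuousAt (x := y) hy).eventually_mem (e.open_source.mem_nhds hye)
    filter_upwards [this] with z hz using e.left_inv hz
  rw [← tderiv_congr h1, ← tderiv_eq_fderiv]
  exact tderiv_comp (mdifferentiableAt_chart_symm he (e.map_source hye))
    ((contDiffAt_transition hc he hy hye).contMDiffAt.mdifferentiableAt (by simp)) rfl

theorem pullForm_transition {k : ℕ} (α : DiffForm E X k) {c e : OpenPartialHomeomorph X E}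
    (hc : c ∈ IsManifold.maximalAtlas 𝓘(ℝ, E) ∞ X) (he : e ∈ IsManifold.maximalAtlas 𝓘(ℝ, E) ∞ X)
    {y : E} (hy : y ∈ c.target) (hye : c.symm y ∈ e.source) :
    pullForm c α y = (pullForm e α (e (c.symm y))).compContinuousLinearMap
      (fderiv ℝ (fun y => e (c.symm y)) y) := by
  ext w
  rw [pullForm_apply, tderiv_symm_transition hc he hy hye]
  change _ = pullForm e α (e (c.symm y)) fun i => fderiv ℝ (fun y => e (c.symm y)) y (w i)
  rw [pullForm_apply, e.left_inv hye]
  rfl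

variable [FiniteDimensional ℝ E]

/-- An alternating one-form as a covector. -/
def covector : (E [⋀^Fin 1]→L[ℝ] ℝ) →ₗ[ℝ] (E →L[ℝ] ℝ) where
  toFun f := (ContinuousAlternatingMap.ofSubsingleton ℝ E ℝ 0).symm f
  map_add' _ _ := rfl
  map_smul' _ _ := rfl

theorem covector_apply (f : E [⋀^Fin 1]→L[ℝ] ℝ) (v : E) : covector f v = f ![v] := by
  change f (fun _ => v) = _
  congr 1
  ext i
  fin_cases i
  rfl

/-- An alternating two-form as a bilinear map. -/
def bilin (f : E [⋀^Fin 2]→L[ℝ] ℝ) : E →L[ℝ] E →L[ℝ] ℝ :=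
  LinearMap.toContinuousLinearMap (covector.comp (f.curryLeft : E →ₗ[ℝ] E [⋀^Fin 1]→L[ℝ] ℝ))

theorem bilin_apply (f : E [⋀^Fin 2]→L[ℝ] ℝ) (u v : E) : bilin f u v = f ![u, v] := by
  change covector (f.curryLeft u) v = _
  rw [covector_apply]
  rfl

theorem bilin_skew (f : E [⋀^Fin 2]→L[ℝ] ℝ) (u v : E) : bilin f u v = -bilin f v u := by
  rw [bilin_apply, bilin_apply]
  have h := f.toAlternatingMap.map_swap ![v, u] (i := 0) (j := 1) (by decide)
  have h2 : (![v, u] ∘ Equiv.swap (0 : Fin 2) 1) = ![u, v] := by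
    ext i; fin_cases i <;> simp
  rw [h2] at h
  exact h

/-- The local expression of a two-form in a chart, as a family of bilinear maps. -/
def bilForm (c : OpenPartialHomeomorph X E) (α : DiffForm E X 2) (y : E) : E →L[ℝ] E →L[ℝ] ℝ :=
  bilin (pullForm c α y)

theorem bilForm_apply (c : OpenPartialHomeomorph X E) (α : DiffForm E X 2) (y u v : E) :
    bilForm c α y u v =
      (α (c.symm y) : E [⋀^Fin 2]→L[ℝ] ℝ) ![tderiv E E c.symm y u, tderiv E E c.symm y v] := by
  rw [bilForm, bilin_apply, pullForm_apply]
  congr 1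
  ext i
  fin_cases i <;> rfl

theorem contDiffOn_bilForm_chartAt {α : DiffForm E X 2} (hα : α.IsSmooth) (x₀ : X) :
    ContDiffOn ℝ ∞ (bilForm (chartAt E x₀) α) (chartAt E x₀).target := by
  have h := hα x₀
  rw [inChart_eq_pullForm, extChartAt_target_eq] at h
  refine contDiffOn_clm_apply.2 fun u => contDiffOn_clm_apply.2 fun v => ?_
  have h1 := (ContinuousAlternatingMap.apply ℝ E ℝ ![u, v]).contDiff.comp_contDiffOn h
  exact h1.congr fun y _ => bilin_apply _ u v

/-- Smoothness is defined in the preferred charts; transition maps carry it to adapted charts. -/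
theorem contDiffOn_bilForm {α : DiffForm E X 2} (hα : α.IsSmooth) {c : OpenPartialHomeomorph X E}
    (hc : c ∈ IsManifold.maximalAtlas 𝓘(ℝ, E) ∞ X) : ContDiffOn ℝ ∞ (bilForm c α) c.target := by
  intro y hy
  set x₀ := c.symm y
  set e := chartAt E x₀
  have he : e ∈ IsManifold.maximalAtlas 𝓘(ℝ, E) ∞ X := IsManifold.chart_mem_maximalAtlas x₀
  let U : Set E := c.target ∩ c.symm ⁻¹' e.source
  have hU : IsOpen U := c.symm.isOpen_inter_preimage e.open_source
  have hyU : y ∈ U := ⟨hy, mem_chart_source E x₀⟩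
  have htr : ContDiffOn ℝ ∞ (fun y => e (c.symm y)) U := fun z hz =>
    (contDiffAt_transition hc he hz.1 hz.2).contDiffWithinAt
  have hD := htr.fderiv_of_isOpen hU (m := ∞) (by simp)
  have hb : ContDiffOn ℝ ∞ (fun y => bilForm e α (e (c.symm y))) U :=
    (contDiffOn_bilForm_chartAt hα x₀).comp htr fun z hz => e.map_source hz.2
  have key : ContDiffOn ℝ ∞ (bilForm c α) U := by
    refine contDiffOn_clm_apply.2 fun u => contDiffOn_clm_apply.2 fun v => ?_
    refine ((hb.clm_apply (hD.clm_apply (contDiffOn_const (c := u)))).clm_apply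
      (hD.clm_apply (contDiffOn_const (c := v)))).congr fun z hz => ?_
    rw [bilForm_apply, bilForm_apply, tderiv_symm_transition hc he hz.1 hz.2, e.left_inv hz.2]
    rfl
  exact (key.contDiffAt (hU.mem_nhds hyU)).contDiffWithinAt

end FormsInCharts

/-! ### The action in charts -/

section ActionInCharts

variable {F : Type*} [NormedAddCommGroup F] [NormedSpace ℝ F]
variable {K : Type v} [TopologicalSpace K] [ChartedSpace F K] [Group K]
  [LieGroup 𝓘(ℝ, F) ∞ K]
variable {E : Type u} [NormedAddCommGroup E] [NormedSpace ℝ E]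
variable {X : Type*} [TopologicalSpace X] [ChartedSpace E X] [IsManifold 𝓘(ℝ, E) ∞ X]
  [MulAction K X] [ContMDiffSMul 𝓘(ℝ, F) 𝓘(ℝ, E) ∞ K X]

/-- The action of `k` in charts. -/
def act (c c' : OpenPartialHomeomorph X E) (k : K) (y : E) : E := c' (k • c.symm y)

/-- A fundamental vector field in a chart. -/
def chartField (c : OpenPartialHomeomorph X E) (ξ : GroupLieAlgebra 𝓘(ℝ, F) K) (y : E) : E :=
  tderiv E E c (c.symm y) (fundamentalField E ξ (c.symm y) : E)

/-- A curve in `K` through `1` with velocity `ξ`. -/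
def groupCurve (ξ : GroupLieAlgebra 𝓘(ℝ, F) K) (t : ℝ) : K :=
  (chartAt F (1 : K)).symm
    (chartAt F (1 : K) 1 + t • (tderiv F F (chartAt F (1 : K)) 1 (ξ : F) : F))

@[simp] theorem groupCurve_zero (ξ : GroupLieAlgebra 𝓘(ℝ, F) K) : groupCurve ξ 0 = 1 := by
  rw [groupCurve, zero_smul, add_zero]
  exact (chartAt F (1 : K)).left_inv (mem_chart_source F 1)

theorem contMDiffAt_groupCurve (ξ : GroupLieAlgebra 𝓘(ℝ, F) K) :
    ContMDiffAt 𝓘(ℝ, ℝ) 𝓘(ℝ, F) ∞ (groupCurve ξ) 0 := by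
  have h1 : ContMDiffAt 𝓘(ℝ, F) 𝓘(ℝ, F) ∞ (chartAt F (1 : K)).symm
      (chartAt F (1 : K) 1 + (0 : ℝ) • (tderiv F F (chartAt F (1 : K)) 1 (ξ : F) : F)) := by
    rw [zero_smul, add_zero]
    exact contMDiffAt_chart_symm (IsManifold.chart_mem_maximalAtlas (1 : K)) (mem_chart_target F 1)
  refine ContMDiffAt.comp (0 : ℝ) h1 (ContDiffAt.contMDiffAt ?_)
  exact contDiffAt_const.add (contDiffAt_id.smul contDiffAt_const)

theorem tderiv_groupCurve (ξ : GroupLieAlgebra 𝓘(ℝ, F) K) :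
    tderiv ℝ F (groupCurve ξ) 0 1 = (ξ : F) := by
  set v : F := tderiv F F (chartAt F (1 : K)) 1 (ξ : F)
  have hc : chartAt F (1 : K) ∈ IsManifold.maximalAtlas 𝓘(ℝ, F) ∞ K :=
    IsManifold.chart_mem_maximalAtlas (1 : K)
  have hl : HasDerivAt (fun t : ℝ => chartAt F (1 : K) 1 + t • v) v 0 := by
    simpa using ((hasDerivAt_id (0 : ℝ)).smul_const v).const_add (chartAt F (1 : K) 1)
  have h := tderiv_comp (E₁ := ℝ) (E₂ := F) (E₃ := F)
    (mdifferentiableAt_chart_symm hc (mem_chart_target F 1))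
    (f := fun t : ℝ => chartAt F (1 : K) 1 + t • v) (x := 0)
    hl.differentiableAt.mdifferentiableAt (by simp)
  rw [tderiv_eq_fderiv] at h
  have h2 := congrArg (fun A : ℝ →L[ℝ] F => A 1) h
  refine h2.trans ?_
  rw [ContinuousLinearMap.comp_apply, fderiv_apply_one_eq_deriv, hl.deriv]
  exact tderiv_symm_chart_apply hc (mem_chart_source F 1) ξ

theorem tendsto_groupCurve (ξ : GroupLieAlgebra 𝓘(ℝ, F) K) :
    Tendsto (groupCurve ξ) (𝓝 0) (𝓝 1) := by
  have := (contMDiffAt_groupCurve ξ).continuousAt.tendsto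
  rwa [groupCurve_zero] at this

variable {c c' : OpenPartialHomeomorph X E}
  (hc : c ∈ IsManifold.maximalAtlas 𝓘(ℝ, E) ∞ X) (hc' : c' ∈ IsManifold.maximalAtlas 𝓘(ℝ, E) ∞ X)

include hc in
theorem hasDerivAt_act_groupCurve (ξ : GroupLieAlgebra 𝓘(ℝ, F) K) {y : E} (hy : y ∈ c.target) :
    HasDerivAt (fun t => act c c (groupCurve ξ t) y) (chartField c ξ y) 0 := by
  obtain ⟨h1, h2⟩ := hasMFDerivAt_smul_of_velocity (E := E) ξ (c.symm y) (groupCurve ξ)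
    (groupCurve_zero ξ) ((contMDiffAt_groupCurve ξ).mdifferentiableAt (by simp))
    (tderiv_groupCurve ξ)
  have h3 : groupCurve ξ 0 • c.symm y = c.symm y := by rw [groupCurve_zero, one_smul]
  have h4 := mdifferentiableAt_chart hc (c.map_target hy)
  have h5 := tderiv_comp (E₁ := ℝ) h4 h1 h3
  have hd : DifferentiableAt ℝ (fun t => act c c (groupCurve ξ t) y) 0 := by
    rw [← mdifferentiableAt_iff_differentiableAt]
    exact MDifferentiableAt.comp (g := c) (0 : ℝ) (by rw [h3]; exact h4) h1
  have h6 := congrArg (fun A : ℝ →L[ℝ] E => A 1) h5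
  rw [tderiv_eq_fderiv] at h6
  have h7 : deriv (fun t => act c c (groupCurve ξ t) y) 0 = chartField c ξ y := by
    rw [← fderiv_apply_one_eq_deriv]
    refine h6.trans ?_
    rw [ContinuousLinearMap.comp_apply]
    exact congrArg (tderiv E E c (c.symm y)) h2
  rw [← h7]
  exact hd.hasDerivAt

include hc in
-- The field is the `t`-derivative at `0` of the jointly smooth map `(t, y) ↦ groupCurve ξ t • y`
-- read in the chart.
theorem contDiffOn_chartField (ξ : GroupLieAlgebra 𝓘(ℝ, F) K) :
    ContDiffOn ℝ ∞ (chartField c ξ) c.target := by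
  have hG : ∀ y ∈ c.target,
      ContDiffAt ℝ ∞ (fun z : ℝ × E => act c c (groupCurve ξ z.1) z.2) (0, y) := by
    intro y hy
    rw [← contMDiffAt_iff_contDiffAt]
    have h1 : ContMDiffAt 𝓘(ℝ, ℝ × E) 𝓘(ℝ, F) ∞ (fun z : ℝ × E => groupCurve ξ z.1) (0, y) :=
      ContMDiffAt.comp (g := groupCurve ξ) (f := Prod.fst) ((0 : ℝ), y) (contMDiffAt_groupCurve ξ)
        contDiff_fst.contMDiff.contMDiffAt
    have h2 : ContMDiffAt 𝓘(ℝ, ℝ × E) 𝓘(ℝ, E) ∞ (fun z : ℝ × E => c.symm z.2) (0, y) :=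
      ContMDiffAt.comp ((0 : ℝ), y) (contMDiffAt_chart_symm hc hy)
        contDiff_snd.contMDiff.contMDiffAt
    have h3 : groupCurve ξ 0 • c.symm y = c.symm y := by rw [groupCurve_zero, one_smul]
    have h4 : ContMDiffAt 𝓘(ℝ, E) 𝓘(ℝ, E) ∞ c (groupCurve ξ 0 • c.symm y) := by
      rw [h3]; exact contMDiffAt_chart hc (c.map_target hy)
    exact ContMDiffAt.comp (g := c) ((0 : ℝ), y) h4 (h1.smul h2)
  intro y hy
  refine ContDiffAt.contDiffWithinAt ?_
  have h1 := ((hG y hy).fderiv_right (m := ∞) (by simp))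
  have h2 : ContDiffAt ℝ ∞ (fun y : E =>
      fderiv ℝ (fun z : ℝ × E => act c c (groupCurve ξ z.1) z.2) (0, y) (1, 0)) y :=
    (ContDiffAt.comp y h1 (contDiffAt_const.prodMk contDiffAt_id)).clm_apply contDiffAt_const
  refine h2.congr_of_eventuallyEq ?_
  filter_upwards [c.open_target.mem_nhds hy] with z hz
  have h3 := ((hG z hz).differentiableAt (by simp)).hasFDerivAt.comp_hasDerivAt (0 : ℝ)
    ((hasDerivAt_id (0 : ℝ)).prodMk (hasDerivAt_const (0 : ℝ) z))
  exact (hasDerivAt_act_groupCurve hc ξ hz).unique h3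

include hc in
theorem tderiv_symm_chartField (ξ : GroupLieAlgebra 𝓘(ℝ, F) K) {y : E} (hy : y ∈ c.target) :
    tderiv E E c.symm y (chartField c ξ y) = (fundamentalField E ξ (c.symm y) : E) := by
  have h := tderiv_symm_chart_apply hc (c.map_target hy) (fundamentalField E ξ (c.symm y) : E)
  rw [c.right_inv hy] at h
  exact h

variable (F) in
include F in
theorem mdifferentiable_smul (k : K) :
    MDifferentiable 𝓘(ℝ, E) 𝓘(ℝ, E) (fun x : X => k • x) :=
  (ContMDiffSMul.contMDiff_const_smul (I := 𝓘(ℝ, F)) (I' := 𝓘(ℝ, E)) (n := ∞) k).mdifferentiable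
    (by simp)

variable (F) in
include F hc hc' in
theorem contDiffAt_act {k : K} {y : E} (hy : y ∈ c.target) (hk : k • c.symm y ∈ c'.source) :
    ContDiffAt ℝ ∞ (act c c' k) y := by
  rw [← contMDiffAt_iff_contDiffAt]
  have h1 : ContMDiff 𝓘(ℝ, E) 𝓘(ℝ, E) ∞ (fun x : X => k • x) :=
    ContMDiffSMul.contMDiff_const_smul (I := 𝓘(ℝ, F)) (I' := 𝓘(ℝ, E)) (n := ∞) k
  exact ContMDiffAt.comp y (contMDiffAt_chart hc' hk)
    (h1.contMDiffAt.comp y (contMDiffAt_chart_symm hc hy))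

theorem act_mem_target {k : K} {y : E} (hk : k • c.symm y ∈ c'.source) :
    act c c' k y ∈ c'.target := c'.map_source hk

theorem symm_act {k : K} {y : E} (hk : k • c.symm y ∈ c'.source) :
    c'.symm (act c c' k y) = k • c.symm y := c'.left_inv hk

theorem act_inv_act {k : K} {y : E} (hy : y ∈ c.target) (hk : k • c.symm y ∈ c'.source) :
    act c' c k⁻¹ (act c c' k y) = y := by
  rw [act, symm_act hk, inv_smul_smul, c.right_inv hy]

variable (F) in
include F hc hc' in
theorem tderiv_symm_act [ContinuousConstSMul K X] {k : K} {y : E} (hy : y ∈ c.target)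
    (hk : k • c.symm y ∈ c'.source) (v : E) :
    tderiv E E c'.symm (act c c' k y) (fderiv ℝ (act c c' k) y v) =
      tderiv E E (fun x : X => k • x) (c.symm y) (tderiv E E c.symm y v) := by
  have hcont : ContinuousAt (fun y => k • c.symm y) y :=
    (c.symm.continuousAt (x := y) hy).const_smul k
  have h1 : (fun y => c'.symm (act c c' k y)) =ᶠ[𝓝 y] fun y => k • c.symm y := by
    filter_upwards [hcont.eventually_mem (c'.open_source.mem_nhds hk)] with z hz
    exact symm_act hz
  have h2 := tderiv_comp (E₁ := E) (E₂ := E) (E₃ := E)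
    (mdifferentiableAt_chart_symm hc' (act_mem_target hk))
    ((contDiffAt_act F hc hc' hy hk).contMDiffAt.mdifferentiableAt (by simp)) rfl
  have h3 := tderiv_comp (E₁ := E) (E₂ := E) (E₃ := E)
    (mdifferentiable_smul F k (c.symm y)) (mdifferentiableAt_chart_symm hc hy) rfl
  rw [tderiv_congr h1, h3, tderiv_eq_fderiv] at h2
  exact (congrArg (fun A : E →L[ℝ] E => A v) h2).symm

variable (F) in
include F hc hc' in
theorem fderiv_act_inv [ContinuousConstSMul K X] {k : K} {y : E} (hy : y ∈ c.target)
    (hk : k • c.symm y ∈ c'.source) (v : E) :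
    fderiv ℝ (act c c' k) y (fderiv ℝ (act c' c k⁻¹) (act c c' k y) v) = v := by
  have hk' : k⁻¹ • c'.symm (act c c' k y) ∈ c.source := by
    rw [symm_act hk, inv_smul_smul]; exact c.map_target hy
  have e1 := tderiv_symm_act F hc' hc (act_mem_target hk) hk' v
  rw [act_inv_act hy hk] at e1
  have e2 := tderiv_symm_act F hc hc' hy hk (fderiv ℝ (act c' c k⁻¹) (act c c' k y) v)
  rw [e1, symm_act hk] at e2
  have e3 := tderiv_comp (E₁ := E) (E₂ := E) (E₃ := E) (mdifferentiable_smul F k (c.symm y))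
    (mdifferentiable_smul F k⁻¹ (k • c.symm y)) (inv_smul_smul k _)
  have e4 : (fun x : X => k • k⁻¹ • x) = fun x => x := funext fun x => smul_inv_smul k x
  rw [e4, tderiv_id] at e3
  have e5 := congrArg (fun A : E →L[ℝ] E => A (tderiv E E c'.symm (act c c' k y) v)) e3
  simp only [ContinuousLinearMap.comp_apply] at e5
  rw [← e5] at e2
  have e6 := congrArg (tderiv E E c' (c'.symm (act c c' k y))) e2
  rw [tderiv_chart_symm_apply hc' (act_mem_target hk)] at e6
  rw [e6]
  exact tderiv_chart_symm_apply hc' (act_mem_target hk) v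

variable (F) in
include F hc hc' in
theorem bilForm_act [FiniteDimensional ℝ E] [ContinuousConstSMul K X] {α : DiffForm E X 2}
    (hα : IsInvariantForm K α) {k : K} {y : E} (hy : y ∈ c.target)
    (hk : k • c.symm y ∈ c'.source) (u v : E) :
    bilForm c' α (act c c' k y) (fderiv ℝ (act c c' k) y u) (fderiv ℝ (act c c' k) y v) =
      bilForm c α y u v := by
  rw [bilForm_apply, bilForm_apply, tderiv_symm_act F hc hc' hy hk, tderiv_symm_act F hc hc' hy hk,
    symm_act hk]
  have h := congrArg (fun β : DiffForm E X 2 => (β (c.symm y) : E [⋀^Fin 2]→L[ℝ] ℝ)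
    ![tderiv E E c.symm y u, tderiv E E c.symm y v]) (hα k)
  refine Eq.trans ?_ h
  change _ = (α (k • c.symm y) : E [⋀^Fin 2]→L[ℝ] ℝ) fun i =>
    tderiv E E (fun x : X => k • x) (c.symm y)
      (![tderiv E E c.symm y u, tderiv E E c.symm y v] i)
  congr 1
  ext i
  fin_cases i <;> rfl

/-! ### Closedness of the contractions with fundamental vector fields -/

theorem pullForm_contract [FiniteDimensional ℝ E] (α : DiffForm E X 2)
    (hc : c ∈ IsManifold.maximalAtlas 𝓘(ℝ, E) ∞ X) (ξ : GroupLieAlgebra 𝓘(ℝ, F) K) {y : E}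
    (hy : y ∈ c.target) :
    pullForm c (α.contract (fundamentalField E ξ)) y =
      (pullForm c α y).curryLeft (chartField c ξ y) := by
  ext w
  rw [pullForm_apply, ContinuousAlternatingMap.curryLeft_apply_apply, pullForm_apply]
  change (α (c.symm y) : E [⋀^Fin 2]→L[ℝ] ℝ) (Matrix.vecCons (fundamentalField E ξ (c.symm y) : E)
    fun i => tderiv E E c.symm y (w i)) = _
  congr 1
  ext i
  fin_cases i
  · exact (tderiv_symm_chartField hc ξ hy).symm
  · rfl

theorem differentiableAt_pullForm_contract_chartAt [FiniteDimensional ℝ E] {α : DiffForm E X 2}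
    (hα : α.IsSmooth) (ξ : GroupLieAlgebra 𝓘(ℝ, F) K) {x₀ : X} {y : E}
    (hy : y ∈ (chartAt E x₀).target) :
    DifferentiableAt ℝ (pullForm (chartAt E x₀) (α.contract (fundamentalField E ξ))) y := by
  have he : chartAt E x₀ ∈ IsManifold.maximalAtlas 𝓘(ℝ, E) ∞ X :=
    IsManifold.chart_mem_maximalAtlas x₀
  have h := hα x₀
  rw [inChart_eq_pullForm, extChartAt_target_eq] at h
  have h1 : DifferentiableAt ℝ (pullForm (chartAt E x₀) α) y :=
    (h.contDiffAt ((chartAt E x₀).open_target.mem_nhds hy)).differentiableAt (by simp)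
  have h2 : DifferentiableAt ℝ (chartField (chartAt E x₀) ξ) y :=
    ((contDiffOn_chartField he ξ).contDiffAt
      ((chartAt E x₀).open_target.mem_nhds hy)).differentiableAt (by simp)
  have h3 : DifferentiableAt ℝ (fun y => (pullForm (chartAt E x₀) α y).curryLeft) y :=
    DifferentiableAt.comp y (ContinuousAlternatingMap.curryLeftLI (𝕜 := ℝ) (E := E) (F := ℝ)
      (n := 1)).toContinuousLinearMap.differentiableAt h1
  refine (h3.clm_apply h2).congr_of_eventuallyEq ?_
  filter_upwards [(chartAt E x₀).open_target.mem_nhds hy] with z hz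
  exact pullForm_contract α he ξ hz

/-- `DiffForm.d` at a point only sees the preferred chart there. Naturality of `extDeriv` under the
transition map moves closedness to an arbitrary chart. -/
theorem extDeriv_pullForm_contract [FiniteDimensional ℝ E] {α : DiffForm E X 2}
    (hα : α.IsSmooth) (hmc : IsMomentumlyClosed F K α)
    (hc : c ∈ IsManifold.maximalAtlas 𝓘(ℝ, E) ∞ X) (ξ : GroupLieAlgebra 𝓘(ℝ, F) K) {y : E}
    (hy : y ∈ c.target) :
    DifferentiableAt ℝ (pullForm c (α.contract (fundamentalField E ξ))) y ∧
      extDeriv (pullForm c (α.contract (fundamentalField E ξ))) y = 0 := by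
  set β := α.contract (fundamentalField E ξ)
  set x₀ := c.symm y
  set e := chartAt E x₀
  have he : e ∈ IsManifold.maximalAtlas 𝓘(ℝ, E) ∞ X := IsManifold.chart_mem_maximalAtlas x₀
  have hx₀ : x₀ ∈ e.source := mem_chart_source E x₀
  have hd : DifferentiableAt ℝ (pullForm e β) (e x₀) :=
    differentiableAt_pullForm_contract_chartAt hα ξ (e.map_source hx₀)
  have h0 : extDeriv (pullForm e β) (e x₀) = 0 := by
    have h1 : β.d x₀ = 0 := congrFun (hmc ξ) x₀
    ext w
    have h2 := congrArg (fun γ : TangentSpace 𝓘(ℝ, E) x₀ [⋀^Fin 2]→L[ℝ] ℝ =>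
      (γ : E [⋀^Fin 2]→L[ℝ] ℝ) fun i => tderiv E E e.symm (e x₀) (w i)) h1
    change extDeriv (pullForm e β) (e x₀) (fun i => tderiv E E e x₀
      (tderiv E E e.symm (e x₀) (w i))) = 0 at h2
    have h3 : ∀ i, tderiv E E e x₀ (tderiv E E e.symm (e x₀) (w i)) = w i := fun i => by
      have := tderiv_chart_symm_apply he (e.map_source hx₀) (w i)
      rwa [e.left_inv hx₀] at this
    simp only [h3] at h2
    exact h2
  have htr := contDiffAt_transition hc he hy hx₀
  have heq : pullForm c β =ᶠ[𝓝 y] fun y => (pullForm e β (e (c.symm y))).compContinuousLinearMap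
      (fderiv ℝ (fun y => e (c.symm y)) y) := by
    filter_upwards [c.open_target.mem_nhds hy,
      (c.symm.continuousAt (x := y) hy).eventually_mem (e.open_source.mem_nhds hx₀)] with z hz hz'
    exact pullForm_transition β hc he hz hz'
  constructor
  · refine DifferentiableAt.congr_of_eventuallyEq ?_ heq
    refine DifferentiableAt.continuousAlternatingMapCompContinuousLinearMap ?_ ?_
    · exact DifferentiableAt.comp y (g := pullForm e β) hd (htr.differentiableAt (by simp))
    · exact (htr.fderiv_right (m := ∞) (by simp)).differentiableAt (by simp)
  · rw [heq.extDeriv_eq, extDeriv_pullback (r := ∞) (f := fun y => e (c.symm y)) hd htr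
      (by simpa using WithTop.coe_le_coe.2 (le_top (a := (2 : ℕ∞)))), h0]
    rfl

/-- In charts, the contraction of a momentumly closed form with a fundamental vector field has
symmetric derivative. -/
theorem fderiv_bilForm_chartField_symm [FiniteDimensional ℝ E] {α : DiffForm E X 2}
    (hα : α.IsSmooth) (hmc : IsMomentumlyClosed F K α)
    (hc : c ∈ IsManifold.maximalAtlas 𝓘(ℝ, E) ∞ X) (ξ : GroupLieAlgebra 𝓘(ℝ, F) K) {y : E}
    (hy : y ∈ c.target) (u v : E) :
    fderiv ℝ (fun y => bilForm c α y (chartField c ξ y)) y u v =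
      fderiv ℝ (fun y => bilForm c α y (chartField c ξ y)) y v u := by
  obtain ⟨hd, h0⟩ := extDeriv_pullForm_contract hα hmc hc ξ hy
  -- For a one-form the exterior derivative is the antisymmetrised derivative, so its vanishing is
  -- symmetry.
  have h1 := extDeriv_apply hd ![u, v]
  rw [h0, Fin.sum_univ_two] at h1
  have hD : DifferentiableAt ℝ (fun y => bilForm c α y (chartField c ξ y)) y :=
    (((contDiffOn_bilForm hα hc).contDiffAt (c.open_target.mem_nhds hy)).differentiableAt
      (by simp)).clm_apply (((contDiffOn_chartField hc ξ).contDiffAt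
        (c.open_target.mem_nhds hy)).differentiableAt (by simp))
  have h2 : ∀ w : E, fderiv ℝ
      (fun y => pullForm c (α.contract (fundamentalField E ξ)) y ![w]) y =
      (fderiv ℝ (fun y => bilForm c α y (chartField c ξ y)) y).flip w := by
    intro w
    have h3 : (fun y => pullForm c (α.contract (fundamentalField E ξ)) y ![w]) =ᶠ[𝓝 y]
        fun y => bilForm c α y (chartField c ξ y) w := by
      filter_upwards [c.open_target.mem_nhds hy] with z hz
      rw [pullForm_contract α hc ξ hz, bilForm, bilin_apply]
      rfl
    rw [h3.fderiv_eq]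
    have h4 := (hD.hasFDerivAt.clm_apply (hasFDerivAt_const w y)).fderiv
    rw [h4]
    ext a
    simp
  have e0 : Fin.removeNth (0 : Fin 2) ![u, v] = ![v] := by
    ext i; fin_cases i; rfl
  have e1 : Fin.removeNth (1 : Fin 2) ![u, v] = ![u] := by
    ext i; fin_cases i; rfl
  rw [e0, e1, h2, h2] at h1
  simp at h1
  linarith

end ActionInCharts

/-! ### Local models around the points of an invariant submanifold -/

/-- A differentiable map sending a subspace to a subspace has a derivative that does so. -/
theorem fderiv_mem_of_eventually_mem {E E' : Type*} [NormedAddCommGroup E] [NormedSpace ℝ E]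
    [NormedAddCommGroup E'] [NormedSpace ℝ E'] [FiniteDimensional ℝ E']
    {S : Submodule ℝ E} {S' : Submodule ℝ E'} {h : E → E'} {y : E} (hd : DifferentiableAt ℝ h y)
    (hy : y ∈ S) (hS : ∀ᶠ z in 𝓝 y, z ∈ S → h z ∈ S') {v : E} (hv : v ∈ S) :
    fderiv ℝ h y v ∈ S' := by
  have hl : HasDerivAt (fun t : ℝ => y + t • v) v 0 := by
    simpa using ((hasDerivAt_id (0 : ℝ)).smul_const v).const_add y
  have hl0 : Tendsto (fun t : ℝ => y + t • v) (𝓝 0) (𝓝 y) := by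
    simpa using hl.continuousAt.tendsto
  have h1 : HasDerivAt (fun t : ℝ => h (y + t • v)) (fderiv ℝ h y v) 0 :=
    HasFDerivAt.comp_hasDerivAt (l := h) (0 : ℝ) (by simpa using hd.hasFDerivAt) hl
  have h2 := h1.tendsto_slope
  refine S'.closed_of_finiteDimensional.mem_of_tendsto h2 ?_
  filter_upwards [(hl0.eventually hS).filter_mono nhdsWithin_le_nhds] with t ht
  rw [slope_def_module]
  refine S'.smul_mem _ (S'.sub_mem (ht (S.add_mem hy (S.smul_mem _ hv))) ?_)
  simpa using hS.self_of_nhds hy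

/-- A chart around a point of `W` in which `W` is a linear subspace. -/
structure AdaptedChart (E : Type*) [NormedAddCommGroup E] [NormedSpace ℝ E]
    {X : Type*} [TopologicalSpace X] [ChartedSpace E X] (W : Set X) where
  c : OpenPartialHomeomorph X E
  S : Submodule ℝ E
  q : X
  mem_atlas : c ∈ IsManifold.maximalAtlas 𝓘(ℝ, E) ∞ X
  mem_source : q ∈ c.source
  mem_W : q ∈ W
  image_eq : c '' (W ∩ c.source) = (S : Set E) ∩ c.target

namespace AdaptedChart

variable {E : Type*} [NormedAddCommGroup E] [NormedSpace ℝ E]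
  {X : Type*} [TopologicalSpace X] [ChartedSpace E X] {W : Set X} (A : AdaptedChart E W)

theorem mem_S_iff {x : X} (hx : x ∈ A.c.source) : A.c x ∈ A.S ↔ x ∈ W := by
  constructor
  · intro h
    have h1 : A.c x ∈ A.c '' (W ∩ A.c.source) := by
      rw [A.image_eq]; exact ⟨h, A.c.map_source hx⟩
    obtain ⟨x', hx', he⟩ := h1
    rw [← A.c.injOn hx'.2 hx he]
    exact hx'.1
  · intro h
    have h1 : A.c x ∈ A.c '' (W ∩ A.c.source) := ⟨x, ⟨h, hx⟩, rfl⟩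
    rw [A.image_eq] at h1
    exact h1.1

theorem symm_mem_W_iff {y : E} (hy : y ∈ A.c.target) : A.c.symm y ∈ W ↔ y ∈ A.S := by
  rw [← A.mem_S_iff (A.c.map_target hy), A.c.right_inv hy]

end AdaptedChart

/-- The data of an equivariant Moser argument: two forms and an immersion with invariant inner
products near a compact invariant set. -/
structure MoserData (F : Type*) [NormedAddCommGroup F] [NormedSpace ℝ F]
    (K : Type*) [TopologicalSpace K] [ChartedSpace F K] [Group K]
    (E : Type*) [NormedAddCommGroup E] [NormedSpace ℝ E]
    {X : Type*} [TopologicalSpace X] [ChartedSpace E X] [MulAction K X]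
    (H : Type*) [NormedAddCommGroup H] [InnerProductSpace ℝ H] where
  W : Set X
  ω₀ : DiffForm E X 2
  ω₁ : DiffForm E X 2
  J : X → H
  isInvariant_W : IsInvariantSet K W
  isSmooth₀ : ω₀.IsSmooth
  isSmooth₁ : ω₁.IsSmooth
  isInvariant₀ : IsInvariantForm K ω₀
  isInvariant₁ : IsInvariantForm K ω₁
  isClosed₀ : IsMomentumlyClosed F K ω₀
  isClosed₁ : IsMomentumlyClosed F K ω₁
  nondegenerate₀ : ω₀.Nondegenerate
  eq_on : ∀ p ∈ W, ω₀ p = ω₁ p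
  contDiffOn_J : ∀ c ∈ IsManifold.maximalAtlas 𝓘(ℝ, E) ∞ X,
    ContDiffOn ℝ ∞ (fun y => J (c.symm y)) c.target
  inner_J : ∀ (k : K) (x y : X), inner ℝ (J (k • x)) (J (k • y)) = inner ℝ (J x) (J y)
  injective_J : ∀ c ∈ IsManifold.maximalAtlas 𝓘(ℝ, E) ∞ X, ∀ q ∈ W, q ∈ c.source →
    Injective (fderiv ℝ (fun y => J (c.symm y)) (c q))

/-! ### Compatibility of the local models with the action -/

namespace MoserData

variable {F : Type*} [NormedAddCommGroup F] [NormedSpace ℝ F]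
variable {K : Type*} [TopologicalSpace K] [ChartedSpace F K] [Group K] [LieGroup 𝓘(ℝ, F) ∞ K]
variable {E : Type u} [NormedAddCommGroup E] [NormedSpace ℝ E] [FiniteDimensional ℝ E]
variable {X : Type*} [TopologicalSpace X] [ChartedSpace E X] [IsManifold 𝓘(ℝ, E) ∞ X]
  [MulAction K X] [ContMDiffSMul 𝓘(ℝ, F) 𝓘(ℝ, E) ∞ K X] [ContinuousSMul K X]
variable {H : Type*} [NormedAddCommGroup H] [InnerProductSpace ℝ H]
variable (D : MoserData F K E (X := X) H)

/-- The local model in an adapted chart. -/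
def model (A : AdaptedChart E D.W) : LocalModel E H where
  S := A.S
  T := A.c.target
  J := fun y => D.J (A.c.symm y)
  ω₀ := bilForm A.c D.ω₀
  ω₁ := bilForm A.c D.ω₁
  y₀ := A.c A.q
  isOpen_T := A.c.open_target
  mem_S := (A.mem_S_iff A.mem_source).2 A.mem_W
  mem_T := A.c.map_source A.mem_source
  contDiffOn_J := D.contDiffOn_J A.c A.mem_atlas
  injective_J := D.injective_J A.c A.mem_atlas A.q A.mem_W A.mem_source
  contDiffOn_ω₀ := contDiffOn_bilForm D.isSmooth₀ A.mem_atlas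
  contDiffOn_ω₁ := contDiffOn_bilForm D.isSmooth₁ A.mem_atlas
  skew₀ := fun _ _ _ => bilin_skew _ _ _
  skew₁ := fun _ _ _ => bilin_skew _ _ _
  nondegenerate := fun u hu => by
    have hq := A.mem_source
    have hy := A.c.map_source hq
    have h1 : tderiv E E A.c.symm (A.c A.q) u = 0 := by
      refine D.nondegenerate₀ (A.c.symm (A.c A.q)) _ fun w => ?_
      have h2 := hu (tderiv E E A.c (A.c.symm (A.c A.q)) (w : E))
      rw [bilForm_apply] at h2
      have h3 := tderiv_symm_chart_apply A.mem_atlas (A.c.map_target hy) (w : E)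
      rw [A.c.right_inv hy] at h3
      rw [h3] at h2
      exact h2
    have h4 := tderiv_chart_symm_apply A.mem_atlas hy u
    rw [h1, map_zero] at h4
    exact h4.symm
  eq_on := fun y hy hyS => by
    ext u v
    rw [bilForm_apply, bilForm_apply, D.eq_on _ ((A.symm_mem_W_iff hy).2 hyS)]

/-- Since `W` is invariant under `k` and `k⁻¹`, both derivatives preserve the model subspaces;
surjectivity on `S` comes from the derivative of the inverse. -/
theorem isMorphism_act (A A' : AdaptedChart E D.W) (k : K) {B : Set E} (hB : IsOpen B)
    (hBT : B ⊆ A.c.target) (hk : ∀ y ∈ B, k • A.c.symm y ∈ A'.c.source) :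
    LocalModel.IsMorphism (D.model A) (D.model A') (act A.c A'.c k) B := by
  have hS : ∀ (A A' : AdaptedChart E D.W) (k : K) (y : E), y ∈ A.c.target →
      k • A.c.symm y ∈ A'.c.source → y ∈ A.S → act A.c A'.c k y ∈ A'.S :=
    fun A A' k y hy hk hyS =>
      (A'.mem_S_iff hk).2 (D.isInvariant_W k _ ((A.symm_mem_W_iff hy).2 hyS))
  have hD : ∀ (A A' : AdaptedChart E D.W) (k : K) (y : E), y ∈ A.c.target →
      k • A.c.symm y ∈ A'.c.source → y ∈ A.S → ∀ v ∈ A.S,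
      fderiv ℝ (act A.c A'.c k) y v ∈ A'.S := by
    intro A A' k y hy hk hyS v hv
    refine fderiv_mem_of_eventually_mem
      ((contDiffAt_act F A.mem_atlas A'.mem_atlas hy hk).differentiableAt (by simp)) hyS ?_ hv
    have hc : ContinuousAt (fun z => k • A.c.symm z) y :=
      (A.c.symm.continuousAt (x := y) hy).const_smul k
    filter_upwards [A.c.open_target.mem_nhds hy,
      hc.eventually_mem (A'.c.open_source.mem_nhds hk)] with z hz hz' hzS
    exact hS A A' k z hz hz' hzS
  refine ⟨hB, hBT, fun y hy => act_mem_target (hk y hy), fun y hy =>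
    (contDiffAt_act F A.mem_atlas A'.mem_atlas (hBT hy) (hk y hy)).contDiffWithinAt,
    fun y hy v => ⟨_, fderiv_act_inv F A.mem_atlas A'.mem_atlas (hBT hy) (hk y hy) v⟩,
    fun y hy hyS => hS A A' k y (hBT hy) (hk y hy) hyS,
    fun y hy hyS v' hv' => ⟨fderiv ℝ (act A'.c A.c k⁻¹) (act A.c A'.c k y) v', ?_,
      fderiv_act_inv F A.mem_atlas A'.mem_atlas (hBT hy) (hk y hy) v'⟩, fun a ha b hb => ?_,
    fun y hy u v => bilForm_act F A.mem_atlas A'.mem_atlas D.isInvariant₀ (hBT hy) (hk y hy) u v,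
    fun y hy u v => bilForm_act F A.mem_atlas A'.mem_atlas D.isInvariant₁ (hBT hy) (hk y hy) u v⟩
  · refine hD A' A k⁻¹ _ (act_mem_target (hk y hy)) ?_ (hS A A' k y (hBT hy) (hk y hy) hyS) v' hv'
    rw [symm_act (hk y hy), inv_smul_smul]
    exact A.c.map_target (hBT hy)
  · change inner ℝ (D.J (A'.c.symm (act A.c A'.c k a))) (D.J (A'.c.symm (act A.c A'.c k b))) = _
    rw [symm_act (hk a ha), symm_act (hk b hb)]
    exact D.inner_J k _ _

/-- The homotopies and the time-one maps of the local models correspond under the action. -/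
theorem eventually_act (A A' : AdaptedChart E D.W) (k₀ : K) {y₁ : E}
    (hyV : y₁ ∈ (D.model A).flow.V) (hyS : y₁ ∈ A.S) (hk : k₀ • A.c.symm y₁ ∈ A'.c.source)
    (hyV' : act A.c A'.c k₀ y₁ ∈ (D.model A').flow.V) :
    ∀ᶠ z : K × E in 𝓝 (k₀, y₁),
      (∀ s ∈ Icc (0 : ℝ) 1, (D.model A').tube.r s (act A.c A'.c z.1 z.2) =
        act A.c A'.c z.1 ((D.model A).tube.r s z.2)) ∧
      (D.model A').φ (act A.c A'.c z.1 z.2) = act A.c A'.c z.1 ((D.model A).φ z.2) := by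
  set M := D.model A
  set M' := D.model A'
  have hyT : y₁ ∈ A.c.target := M.flow_V_subset hyV
  have hc1 : ContinuousAt (fun z : K × E => z.1 • A.c.symm z.2) (k₀, y₁) :=
    continuousAt_fst.smul (ContinuousAt.comp (x := (k₀, y₁)) (A.c.symm.continuousAt (x := y₁) hyT)
      continuousAt_snd)
  have hc2 : ContinuousAt (fun z : K × E => act A.c A'.c z.1 z.2) (k₀, y₁) :=
    ContinuousAt.comp (x := (k₀, y₁)) (g := A'.c) (A'.c.continuousAt hk) hc1
  have hev : ∀ᶠ z : K × E in 𝓝 (k₀, y₁), z.2 ∈ M.flow.V ∧ z.1 • A.c.symm z.2 ∈ A'.c.source ∧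
      act A.c A'.c z.1 z.2 ∈ M'.flow.V := by
    filter_upwards [continuousAt_snd.eventually_mem (M.flow.isOpen_V.mem_nhds hyV),
      hc1.eventually_mem (A'.c.open_source.mem_nhds hk),
      hc2.eventually_mem (M'.flow.isOpen_V.mem_nhds hyV')] with z h1 h2 h3 using ⟨h1, h2, h3⟩
  -- A product neighbourhood makes every `k` in `P` a morphism on the same `B`; inside it `C` is
  -- chosen so that the homotopy starting in `C` stays in `B`.
  obtain ⟨P, B, hP, hkP, hB, hyB, hPB⟩ := mem_nhds_prod_iff'.1 hev
  have hBV : B ⊆ M.flow.V := fun y hy => (hPB (mk_mem_prod hkP hy)).1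
  obtain ⟨C, hCsub, hC, hyC⟩ := mem_nhds_iff.1 (inter_mem (hB.mem_nhds hyB)
    (M.eventually_r_mem (M.flow_V_subset_tube hyV) hyS (hB.mem_nhds hyB)))
  have hγ := M.eventually_γ_mem hyV hyS (hC.mem_nhds hyC)
  have hmem : ∀ᶠ z : K × E in 𝓝 (k₀, y₁), z.1 ∈ P ∧ z.2 ∈ C ∧ ∀ t, M.flow.γ z.2 t ∈ C := by
    filter_upwards [continuousAt_fst.eventually_mem (hP.mem_nhds hkP),
      continuousAt_snd.eventually_mem (hC.mem_nhds hyC), continuousAt_snd.eventually hγ]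
      with z h1 h2 h3 using ⟨h1, h2, h3⟩
  filter_upwards [hmem] with ⟨k, y⟩ ⟨hkP, hyC, hyγ⟩
  have hBV' : ∀ x ∈ B, act A.c A'.c k x ∈ M'.flow.V := fun x hx => (hPB (mk_mem_prod hkP hx)).2.2
  have hBO' : ∀ x ∈ B, act A.c A'.c k x ∈ M'.tube.O := fun x hx =>
    M'.tube.V_subset (M'.flow_V_subset_tube (hBV' x hx))
  have hmor := D.isMorphism_act A A' k hB (hBV.trans M.flow_V_subset)
    fun x hx => (hPB (mk_mem_prod hkP hx)).2.1
  have hr : ∀ x ∈ C, ∀ s ∈ Icc (0 : ℝ) 1, M.tube.r s x ∈ B ∧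
      M'.tube.r s (act A.c A'.c k x) = act A.c A'.c k (M.tube.r s x) := by
    intro x hx s hs
    have hxB : x ∈ B := (hCsub hx).1
    have hxV : x ∈ M.tube.V := M.flow_V_subset_tube (hBV hxB)
    have hrB := (hCsub hx).2
    have hpB : M.tube.p x ∈ B := by
      rw [← M.tube.r_zero hxV]; exact hrB 0 (by simp)
    exact ⟨hrB s hs, hmor.r_eq hxB hxV hpB (LocalModel.Icc_subset_strip hs) (hrB s hs)
      (M'.flow_V_subset_tube (hBV' x hxB)) (hBO' _ hpB) (hBO' _ (hrB s hs))⟩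
  have hCB : C ⊆ B := fun x hx => (hCsub hx).1
  exact ⟨fun s hs => (hr y hyC s hs).2, hmor.φ_eq hC hCB
    ((hCB.trans hBV).trans M.flow.V_subset) (fun x hx => M'.flow.V_subset (hBV' x (hCB hx))) hr
    (hBV (hCB hyC)) (hBV' y (hCB hyC)) hyγ⟩

variable (A : AdaptedChart E D.W)

theorem act_one_center : act A.c A.c (1 : K) (A.c A.q) = A.c A.q := by
  rw [act, one_smul, A.c.left_inv A.mem_source]

/-- The homotopy and the time-one map of a local model preserve the fundamental vector fields. -/
theorem eventually_fderiv_chartField :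
    ∀ᶠ y in 𝓝 (A.c A.q), ∀ ξ : GroupLieAlgebra 𝓘(ℝ, F) K,
      (∀ s ∈ Icc (0 : ℝ) 1, fderiv ℝ (uncurry (D.model A).tube.r) (s, y) (0, chartField A.c ξ y) =
        chartField A.c ξ ((D.model A).tube.r s y)) ∧
      fderiv ℝ (D.model A).φ y (chartField A.c ξ y) = chartField A.c ξ ((D.model A).φ y) := by
  set M := D.model A
  have hV : A.c A.q ∈ M.flow.V := M.flow.mem_V
  have hS : A.c A.q ∈ A.S := M.mem_S
  have hT : A.c A.q ∈ A.c.target := M.mem_T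
  have h := D.eventually_act A A (1 : K) hV hS
    (by rw [one_smul, A.c.left_inv A.mem_source]; exact A.mem_source)
    (by rw [D.act_one_center A]; exact hV)
  have h' : ∀ᶠ z : E × K in 𝓝 (A.c A.q) ×ˢ 𝓝 (1 : K),
      (∀ s ∈ Icc (0 : ℝ) 1, M.tube.r s (act A.c A.c z.2 z.1) =
        act A.c A.c z.2 (M.tube.r s z.1)) ∧
      M.φ (act A.c A.c z.2 z.1) = act A.c A.c z.2 (M.φ z.1) := by
    rw [← nhds_prod_eq]
    exact (continuous_swap.tendsto (A.c A.q, (1 : K))).eventually h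
  have hφ : ∀ᶠ y in 𝓝 (A.c A.q), M.φ y ∈ A.c.target := by
    have h1 : ContinuousAt M.φ (A.c A.q) := M.hasFDerivAt_φ.continuousAt
    refine h1.eventually_mem ?_
    rw [M.φ_of_mem hV hS]
    exact A.c.open_target.mem_nhds hT
  -- For each fixed `y`, equivariance holds for all `k` near `1`, hence along every curve
  -- `groupCurve ξ`; its derivative at `t = 0` is the claim for all `ξ` at once.
  filter_upwards [h'.curry, M.flow.isOpen_V.mem_nhds hV, hφ,
    M.eventually_r_mem (M.flow_V_subset_tube hV) hS (A.c.open_target.mem_nhds hT)]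
    with y hy hyV hyφ hyr ξ
  have hyT : y ∈ A.c.target := M.flow_V_subset hyV
  have hev := (tendsto_groupCurve ξ).eventually hy
  have hact := hasDerivAt_act_groupCurve A.mem_atlas ξ hyT
  have h0 : act A.c A.c (groupCurve ξ 0) y = y := by
    rw [groupCurve_zero, act, one_smul, A.c.right_inv hyT]
  constructor
  · intro s hs
    have h1 : HasFDerivAt (M.tube.r s) ((fderiv ℝ (uncurry M.tube.r) (s, y)).comp
        (ContinuousLinearMap.inr ℝ ℝ E)) (act A.c A.c (groupCurve ξ 0) y) := by
      rw [h0]; exact M.hasFDerivAt_r_right hs (M.flow_V_subset_tube hyV)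
    have h2 := h1.comp_hasDerivAt (0 : ℝ) hact
    have h3 := hasDerivAt_act_groupCurve A.mem_atlas ξ (hyr s hs)
    have h4 := h2.unique (h3.congr_of_eventuallyEq (by
      filter_upwards [hev] with t ht using ht.1 s hs))
    simpa using h4
  · have h1 : HasFDerivAt M.φ (fderiv ℝ M.φ y) (act A.c A.c (groupCurve ξ 0) y) := by
      rw [h0]
      exact ((M.contDiffOn_φ.contDiffAt (M.flow.isOpen_V.mem_nhds hyV)).differentiableAt
        (by simp)).hasFDerivAt
    have h2 := h1.comp_hasDerivAt (0 : ℝ) hact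
    have h3 := hasDerivAt_act_groupCurve A.mem_atlas ξ hyφ
    exact h2.unique (h3.congr_of_eventuallyEq (by filter_upwards [hev] with t ht using ht.2))

/-- The time-one map of a local model pulls back the contractions of `ω₁` with the fundamental
vector fields to those of `ω₀`. -/
theorem eventually_bilForm_eq :
    ∀ᶠ y in 𝓝 (A.c A.q), ∀ (ξ : GroupLieAlgebra 𝓘(ℝ, F) K) (v : E),
      bilForm A.c D.ω₁ ((D.model A).φ y) (fderiv ℝ (D.model A).φ y (chartField A.c ξ y))
        (fderiv ℝ (D.model A).φ y v) = bilForm A.c D.ω₀ y (chartField A.c ξ y) v := by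
  have h := D.eventually_fderiv_chartField A
  have h1 := (D.model A).eventually_pullback_eq
    (fun ξ : GroupLieAlgebra 𝓘(ℝ, F) K => chartField A.c ξ)
    (fun ξ => (contDiffOn_chartField A.mem_atlas ξ).differentiableOn (by simp))
    (fun ξ y hy u v => fderiv_bilForm_chartField_symm D.isSmooth₀ D.isClosed₀ A.mem_atlas ξ hy u v)
    (fun ξ y hy u v => fderiv_bilForm_chartField_symm D.isSmooth₁ D.isClosed₁ A.mem_atlas ξ hy u v)
    (h.mono fun y hy ξ => (hy ξ).1)
  filter_upwards [h, h1] with y hy hy1 ξ v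
  rw [(hy ξ).2]
  exact hy1 ξ v

end MoserData

/-! ### Gluing along a compact set -/

/-- Local maps with the same germs along a compact set come from one map. -/
theorem exists_eventuallyEq_of_germs {X Y : Type*} [TopologicalSpace X] [T2Space X]
    [LocallyCompactSpace X] [Nonempty Y] {W : Set X} (hW : IsCompact W) (V : W → Set X)
    (ψ : W → X → Y) (hV : ∀ q : W, V q ∈ 𝓝 (q : X))
    (hψ : ∀ q q' : W, (q' : X) ∈ V q → ψ q =ᶠ[𝓝 (q' : X)] ψ q') :
    ∃ Φ : X → Y, ∀ q : W, Φ =ᶠ[𝓝 (q : X)] ψ q := by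
  classical
  have h1 : ∀ q : W, ∃ C ∈ 𝓝 (q : X), IsClosed C ∧ C ⊆ V q := fun q => by
    obtain ⟨C, hC, hCc, hCV⟩ := exists_mem_nhds_isClosed_subset (hV q)
    exact ⟨C, hC, hCc, hCV⟩
  choose C hC hCc hCV using h1
  obtain ⟨t, hcov⟩ : ∃ t : Finset W, ∀ q ∈ W, ∃ i ∈ t, q ∈ interior (C i) := by
    obtain ⟨t, ht⟩ := hW.elim_nhds_subcover' (fun q hq => interior (C ⟨q, hq⟩))
      fun q hq => interior_mem_nhds.2 (hC ⟨q, hq⟩)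
    exact ⟨t, fun q hq => by simpa using ht hq⟩
  let Φ : X → Y := fun x =>
    if h : ∃ i ∈ t, x ∈ C i then ψ h.choose x else Classical.arbitrary Y
  refine ⟨Φ, fun q => ?_⟩
  obtain ⟨j, hj, hqj⟩ := hcov q q.2
  -- Because the `C i` are closed, near `q` only indices with `q ∈ C i` matter, and their maps have
  -- the same germ at `q`. So the index chosen in `Φ` is irrelevant.
  have h2 : ∀ᶠ x in 𝓝 (q : X), ∀ i ∈ t, x ∈ C i → ψ i x = ψ q x := by
    refine (t.eventually_all).2 fun i _ => ?_
    by_cases hq : (q : X) ∈ C i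
    · filter_upwards [hψ i q (hCV i hq)] with x hx _ using hx
    · filter_upwards [(hCc i).isOpen_compl.mem_nhds hq] with x hx hx' using absurd hx' hx
  filter_upwards [h2, isOpen_interior.mem_nhds hqj] with x hx hxj
  have h : ∃ i ∈ t, x ∈ C i := ⟨j, hj, interior_subset hxj⟩
  change dite _ _ _ = _
  rw [dif_pos h]
  exact hx _ h.choose_spec.1 h.choose_spec.2

/-- `f` coincides near `x` with a diffeomorphism between open sets. -/
def IsLocalDiffeoAt (E : Type*) [NormedAddCommGroup E] [NormedSpace ℝ E] {X : Type*}
    [TopologicalSpace X] [ChartedSpace E X] (f : X → X) (x : X) : Prop :=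
  ∃ Θ : OpenPartialHomeomorph X X, x ∈ Θ.source ∧ EqOn f Θ Θ.source ∧
    ContMDiffOn 𝓘(ℝ, E) 𝓘(ℝ, E) ∞ Θ Θ.source ∧ ContMDiffOn 𝓘(ℝ, E) 𝓘(ℝ, E) ∞ Θ.symm Θ.target

/-! ### From a germ along `W` to an equivariant diffeomorphism -/

section Globalization

variable {K : Type*} [TopologicalSpace K] [Group K] [CompactSpace K]
variable {E : Type*} [NormedAddCommGroup E] [NormedSpace ℝ E]
variable {X : Type*} [TopologicalSpace X] [ChartedSpace E X]

theorem IsLocalDiffeoAt.congr {f g : X → X} {x : X} (h : IsLocalDiffeoAt E f x)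
    (hfg : g =ᶠ[𝓝 x] f) : IsLocalDiffeoAt E g x := by
  obtain ⟨Θ, hx, heq, h1, h2⟩ := h
  obtain ⟨U, hU, hUo, hxU⟩ := mem_nhds_iff.1 hfg
  refine ⟨Θ.restrOpen U hUo, ⟨hx, hxU⟩, fun y hy => (hU hy.2).trans (heq hy.1),
    h1.mono inter_subset_left, h2.mono ?_⟩
  intro y hy
  exact hy.1

theorem IsLocalDiffeoAt.eventually {f : X → X} {x : X} (h : IsLocalDiffeoAt E f x) :
    ∀ᶠ y in 𝓝 x, IsLocalDiffeoAt E f y := by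
  obtain ⟨Θ, hx, h⟩ := h
  filter_upwards [Θ.open_source.mem_nhds hx] with y hy using ⟨Θ, hy, h⟩

theorem IsLocalDiffeoAt.contMDiffAt {f : X → X} {x : X} (h : IsLocalDiffeoAt E f x) :
    ContMDiffAt 𝓘(ℝ, E) 𝓘(ℝ, E) ∞ f x := by
  obtain ⟨Θ, hx, heq, h1, _⟩ := h
  have hs := Θ.open_source.mem_nhds hx
  exact (h1.contMDiffAt hs).congr_of_eventuallyEq (heq.eventuallyEq_of_mem hs)

theorem IsLocalDiffeoAt.image_mem_nhds {f : X → X} {x : X} (h : IsLocalDiffeoAt E f x)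
    {U : Set X} (hU : U ∈ 𝓝 x) : f '' U ∈ 𝓝 (f x) := by
  obtain ⟨Θ, hx, heq, _, _⟩ := h
  have hs := Θ.open_source.mem_nhds hx
  rw [heq hx, ← Θ.map_nhds_eq hx]
  filter_upwards [image_mem_map (inter_mem hU hs)] with y hy
  obtain ⟨z, hz, rfl⟩ := hy
  exact ⟨z, hz.1, heq hz.2⟩

/-- A map that is the identity on `W` and an equivariant local diffeomorphism near `W` restricts to
an equivariant diffeomorphism of invariant neighbourhoods of `W`. -/
theorem exists_equivariant_openPartialHomeomorph [MulAction K X] [ContinuousSMul K X] [T2Space X]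
    {W : Set X} (hW : IsCompact W) (hWinv : IsInvariantSet K W) {f : X → X}
    (hid : ∀ q ∈ W, f q = q) (hloc : ∀ q ∈ W, IsLocalDiffeoAt E f q)
    (hequiv : ∀ q ∈ W, ∀ᶠ x in 𝓝 q, ∀ k : K, f (k • x) = k • f x)
    {P : X → Prop} (hP : ∀ q ∈ W, ∀ᶠ x in 𝓝 q, P x) :
    ∃ φ : OpenPartialHomeomorph X X, ⇑φ = f ∧ W ⊆ φ.source ∧ W ⊆ φ.target ∧
      IsInvariantSet K φ.source ∧ IsInvariantSet K φ.target ∧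
      ContMDiffOn 𝓘(ℝ, E) 𝓘(ℝ, E) ∞ φ φ.source ∧
      ContMDiffOn 𝓘(ℝ, E) 𝓘(ℝ, E) ∞ φ.symm φ.target ∧
      (∀ k : K, ∀ x ∈ φ.source, φ (k • x) = k • φ x) ∧ ∀ x ∈ φ.source, P x := by
  classical
  -- A map injective on a compact set and locally injective at its points is injective on a
  -- neighbourhood of it.
  obtain ⟨N₁, hN₁, hinj⟩ := InjOn.exists_mem_nhdsSet (f := f) (s := W)
    (fun a ha b hb hab => by rwa [hid a ha, hid b hb] at hab) hW
    (fun q hq => (hloc q hq).contMDiffAt.continuousAt) fun q hq => by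
      obtain ⟨Θ, hx, heq, _, _⟩ := hloc q hq
      exact ⟨Θ.source, Θ.open_source.mem_nhds hx, Θ.injOn.congr heq.symm⟩
  have hN₂ : {x | (x ∈ N₁ ∧ IsLocalDiffeoAt E f x) ∧ (∀ k : K, f (k • x) = k • f x) ∧ P x} ∈
      𝓝ˢ W := by
    rw [mem_nhdsSet_iff_forall]
    intro q hq
    filter_upwards [mem_nhdsSet_iff_forall.1 hN₁ q hq, (hloc q hq).eventually, hequiv q hq,
      hP q hq] with x h1 h2 h3 h4 using ⟨⟨h1, h2⟩, h3, h4⟩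
  obtain ⟨N, hNo, hWN, hN⟩ := mem_nhdsSet_iff_exists.1 hN₂
  -- This is the largest invariant subset of `N`; it is open by compactness of `K`.
  let U : Set X := {x | ∀ k : K, k • x ∈ N}
  have hUo : IsOpen U := by
    rw [isOpen_iff_mem_nhds]
    intro x hx
    have h1 := isCompact_univ.eventually_forall_of_forall_eventually
      (P := fun x (k : K) => k • x ∈ N) (x₀ := x) fun k _ => ?_
    · filter_upwards [h1] with y hy k using hy k (mem_univ k)
    · have hc : Continuous fun z : X × K => z.2 • z.1 := continuous_snd.smul continuous_fst
      exact hc.continuousAt.eventually_mem (hNo.mem_nhds (hx k))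
  have hUN : U ⊆ N := fun x hx => by simpa using hx 1
  have hWU : W ⊆ U := fun q hq k => hWN (hWinv k q hq)
  have hUinv : IsInvariantSet K U := fun k x hx k' => by
    rw [smul_smul]; exact hx _
  have hUinj : InjOn f U := hinj.mono fun x hx => (hN (hUN hx)).1.1
  have hUloc : ∀ x ∈ U, IsLocalDiffeoAt E f x := fun x hx => (hN (hUN hx)).1.2
  have hUequiv : ∀ k : K, ∀ x ∈ U, f (k • x) = k • f x := fun k x hx => (hN (hUN hx)).2.1 k
  rcases isEmpty_or_nonempty X with hX | hX
  · exact ⟨OpenPartialHomeomorph.refl X, Subsingleton.elim _ _, fun x => hX.elim x,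
      fun x => hX.elim x, fun k x => hX.elim x, fun k x => hX.elim x, fun x => hX.elim x,
      fun x => hX.elim x, fun k x => hX.elim x, fun x => hX.elim x⟩
  have hopen : ∀ s ⊆ U, IsOpen s → IsOpen (f '' s) := by
    intro s hs hso
    rw [isOpen_iff_mem_nhds]
    rintro _ ⟨x, hx, rfl⟩
    exact (hUloc x (hs hx)).image_mem_nhds (hso.mem_nhds hx)
  have hfc : ContinuousOn f U := fun x hx => (hUloc x hx).contMDiffAt.continuousAt.continuousWithinAt
  let e : PartialEquiv X X := hUinj.toPartialEquiv f U
  let φ : OpenPartialHomeomorph X X := OpenPartialHomeomorph.ofContinuousOpenRestrict e hfc (by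
    intro s hs
    have h1 : (e.source.domRestrict e) '' s = f '' (Subtype.val '' s) := by
      rw [image_image]; rfl
    rw [h1]
    refine hopen _ ?_ (hUo.isOpenMap_subtype_val s hs)
    rintro _ ⟨x, _, rfl⟩
    exact x.2) hUo
  have hφs : φ.source = U := rfl
  have hφt : φ.target = f '' U := rfl
  have hφf : ⇑φ = f := rfl
  refine ⟨φ, hφf, hWU, fun q hq => ⟨q, hWU hq, hid q hq⟩, hUinv, ?_, ?_, ?_, hUequiv,
    fun x hx => (hN (hUN hx)).2.2⟩
  · rintro k _ ⟨x, hx, rfl⟩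
    exact ⟨k • x, hUinv k x hx, hUequiv k x hx⟩
  · exact fun x hx => (hUloc x hx).contMDiffAt.contMDiffWithinAt
  · rintro _ ⟨x, hx, rfl⟩
    obtain ⟨Θ, hxΘ, heq, _, h2⟩ := hUloc x hx
    have hfx : f x ∈ Θ.target := by rw [heq hxΘ]; exact Θ.map_source hxΘ
    have h3 : φ.symm =ᶠ[𝓝 (f x)] Θ.symm := by
      have hn := (hUloc x hx).image_mem_nhds (inter_mem (hUo.mem_nhds hx)
        (Θ.open_source.mem_nhds hxΘ))
      filter_upwards [hn] with y hy
      obtain ⟨z, hz, rfl⟩ := hy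
      have e1 : φ.symm (f z) = z := φ.left_inv hz.1
      rw [e1, heq hz.2, Θ.left_inv hz.2]
    exact ((h2.contMDiffAt (Θ.open_target.mem_nhds hfx)).congr_of_eventuallyEq
      h3).contMDiffWithinAt

end Globalization

/-! ### The time-one maps as maps of the manifold -/

namespace MoserData

variable {F : Type*} [NormedAddCommGroup F] [NormedSpace ℝ F]
variable {K : Type*} [TopologicalSpace K] [ChartedSpace F K] [Group K] [LieGroup 𝓘(ℝ, F) ∞ K]
variable {E : Type u} [NormedAddCommGroup E] [NormedSpace ℝ E] [FiniteDimensional ℝ E]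
variable {X : Type*} [TopologicalSpace X] [ChartedSpace E X] [IsManifold 𝓘(ℝ, E) ∞ X]
  [MulAction K X] [ContMDiffSMul 𝓘(ℝ, F) 𝓘(ℝ, E) ∞ K X] [ContinuousSMul K X]
variable {H : Type*} [NormedAddCommGroup H] [InnerProductSpace ℝ H]
variable (D : MoserData F K E (X := X) H) (A : AdaptedChart E D.W)

/-- The time-one map of a local model on the manifold. -/
def localMap (x : X) : X := A.c.symm ((D.model A).φ (A.c x))

/-- The domain of `localMap`. -/
def localDomain : Set X := A.c.source ∩ A.c ⁻¹' (D.model A).flow.V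

theorem isOpen_localDomain : IsOpen (D.localDomain A) :=
  A.c.isOpen_inter_preimage (D.model A).flow.isOpen_V

theorem mem_localDomain : A.q ∈ D.localDomain A := ⟨A.mem_source, (D.model A).flow.mem_V⟩

variable {A} in
theorem localMap_of_mem {x : X} (hx : x ∈ D.localDomain A) (hxW : x ∈ D.W) :
    D.localMap A x = x := by
  rw [localMap, (D.model A).φ_of_mem hx.2 ((A.mem_S_iff hx.1).2 hxW), A.c.left_inv hx.1]

variable {A} in
theorem continuousAt_localMap {x : X} (hx : x ∈ D.localDomain A) (hxW : x ∈ D.W) :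
    ContinuousAt (D.localMap A) x := by
  have h1 : ContinuousAt (fun x => (D.model A).φ (A.c x)) x :=
    ContinuousAt.comp (((D.model A).contDiffOn_φ.continuousOn).continuousAt
      ((D.model A).flow.isOpen_V.mem_nhds hx.2)) (A.c.continuousAt hx.1)
  refine ContinuousAt.comp (g := A.c.symm) (A.c.symm.continuousAt ?_) h1
  change (D.model A).φ (A.c x) ∈ A.c.target
  rw [(D.model A).φ_of_mem hx.2 ((A.mem_S_iff hx.1).2 hxW)]
  exact A.c.map_source hx.1

/-- The local maps intertwine the action. -/
theorem eventually_localMap_smul (A' : AdaptedChart E D.W) (k₀ : K) {x₁ : X}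
    (hx : x₁ ∈ D.localDomain A) (hxW : x₁ ∈ D.W) (hx' : k₀ • x₁ ∈ D.localDomain A') :
    ∀ᶠ z : K × X in 𝓝 (k₀, x₁), D.localMap A' (z.1 • z.2) = z.1 • D.localMap A z.2 := by
  have hsymm := A.c.left_inv hx.1
  have h := D.eventually_act A A' k₀ hx.2 ((A.mem_S_iff hx.1).2 hxW)
    (by rw [hsymm]; exact hx'.1) (by rw [act, hsymm]; exact hx'.2)
  have hc : ContinuousAt (fun z : K × X => (z.1, A.c z.2)) (k₀, x₁) :=
    continuousAt_fst.prodMk (ContinuousAt.comp (x := (k₀, x₁)) (A.c.continuousAt hx.1)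
      continuousAt_snd)
  have hc2 : ContinuousAt (fun z : K × X => z.1 • D.localMap A z.2) (k₀, x₁) :=
    continuousAt_fst.smul (ContinuousAt.comp (x := (k₀, x₁)) (g := D.localMap A)
      (D.continuousAt_localMap hx hxW)
      continuousAt_snd)
  have hm : k₀ • D.localMap A x₁ ∈ A'.c.source := by
    rw [D.localMap_of_mem hx hxW]; exact hx'.1
  filter_upwards [hc.eventually h, hc2.eventually_mem (A'.c.open_source.mem_nhds hm),
    continuousAt_snd.eventually_mem (A.c.open_source.mem_nhds hx.1)] with z hz hz2 hz3
  have h1 := congrArg A'.c.symm hz.2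
  simp only [act] at h1
  rw [A.c.left_inv hz3] at h1
  exact h1.trans (A'.c.left_inv hz2)

/-- The derivative of `φ` at the base point is the identity. The centre suffices, since every point
of `W` is the centre of some adapted chart. -/
theorem isLocalDiffeoAt_localMap : IsLocalDiffeoAt E (D.localMap A) A.q := by
  set M := D.model A
  obtain ⟨Ψ, hyΨ, hΨV, hΨφ, hΨs, -⟩ := exists_smooth_localInverse M.flow.isOpen_V
    M.contDiffOn_φ M.flow.mem_V (ContinuousLinearEquiv.refl ℝ E) M.hasFDerivAt_φ
  have hΨc : ContMDiffOn 𝓘(ℝ, E) 𝓘(ℝ, E) ∞ Ψ Ψ.source :=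
    ((M.contDiffOn_φ.mono hΨV).congr fun x _ => hΨφ x).contMDiffOn
  have hc := contMDiffOn_of_mem_maximalAtlas A.mem_atlas
  have hcs := contMDiffOn_symm_of_mem_maximalAtlas A.mem_atlas
  refine ⟨(A.c.trans Ψ).trans A.c.symm, ⟨⟨A.mem_source, hyΨ⟩, ?_⟩, fun x _ => ?_, ?_, ?_⟩
  · change Ψ (A.c A.q) ∈ A.c.target
    rw [hΨφ, show M.φ (A.c A.q) = A.c A.q from M.φ_of_mem M.flow.mem_V M.mem_S]
    exact A.c.map_source A.mem_source
  · change A.c.symm (M.φ (A.c x)) = A.c.symm (Ψ (A.c x))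
    rw [hΨφ]
  · intro x hx
    exact ((hcs.contMDiffAt (A.c.open_target.mem_nhds hx.2)).comp x
      ((hΨc.contMDiffAt (Ψ.open_source.mem_nhds hx.1.2)).comp x
        (hc.contMDiffAt (A.c.open_source.mem_nhds hx.1.1)))).contMDiffWithinAt
  · intro x hx
    have h1 : x ∈ A.c.source := hx.1
    have h2 : A.c x ∈ Ψ.target := hx.2.1
    have h3 : Ψ.symm (A.c x) ∈ A.c.target := hx.2.2
    exact ((hcs.contMDiffAt (A.c.open_target.mem_nhds h3)).comp x
      ((hΨs.contMDiffOn.contMDiffAt (Ψ.open_target.mem_nhds h2)).comp x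
        (hc.contMDiffAt (A.c.open_source.mem_nhds h1)))).contMDiffWithinAt

theorem eventually_pullback_localMap :
    ∀ᶠ x in 𝓝 A.q, ∀ ξ : GroupLieAlgebra 𝓘(ℝ, F) K,
      D.ω₀.contract (fundamentalField E ξ) x =
        (D.ω₁.pullback (D.localMap A)).contract (fundamentalField E ξ) x := by
  set M := D.model A
  have hT : A.c A.q ∈ A.c.target := M.mem_T
  have hφc : ∀ᶠ y in 𝓝 (A.c A.q), M.φ y ∈ A.c.target := by
    have h1 : ContinuousAt M.φ (A.c A.q) := M.hasFDerivAt_φ.continuousAt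
    refine h1.eventually_mem ?_
    rw [show M.φ (A.c A.q) = A.c A.q from M.φ_of_mem M.flow.mem_V M.mem_S]
    exact A.c.open_target.mem_nhds hT
  have hψ : ∀ᶠ y in 𝓝 (A.c A.q), IsLocalDiffeoAt E (D.localMap A) (A.c.symm y) := by
    have h1 := A.c.symm.continuousAt (x := A.c A.q) hT
    refine h1.eventually ?_
    rw [A.c.left_inv A.mem_source]
    exact (D.isLocalDiffeoAt_localMap A).eventually
  have key : ∀ᶠ y in 𝓝 (A.c A.q), ∀ ξ : GroupLieAlgebra 𝓘(ℝ, F) K,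
      D.ω₀.contract (fundamentalField E ξ) (A.c.symm y) =
        (D.ω₁.pullback (D.localMap A)).contract (fundamentalField E ξ) (A.c.symm y) := by
    filter_upwards [D.eventually_bilForm_eq A, hφc, hψ, A.c.open_target.mem_nhds hT,
      M.flow.isOpen_V.mem_nhds M.flow.mem_V] with y hy hyφ hyψ hyT hyV ξ
    have hval : D.localMap A (A.c.symm y) = A.c.symm (M.φ y) := by
      rw [localMap, A.c.right_inv hyT]
    -- The chain rule for `localMap ∘ c.symm = c.symm ∘ φ` translates the identity in the chart into
    -- one on tangent spaces of `X`.
    have hd : (tderiv E E (D.localMap A) (A.c.symm y)).comp (tderiv E E A.c.symm y) =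
        (tderiv E E A.c.symm (M.φ y)).comp (fderiv ℝ M.φ y) := by
      have h1 := tderiv_comp (E₁ := E) (E₂ := E) (E₃ := E)
        (hyψ.contMDiffAt.mdifferentiableAt (by simp))
        (mdifferentiableAt_chart_symm A.mem_atlas hyT) rfl
      have h2 := tderiv_comp (E₁ := E) (E₂ := E) (E₃ := E)
        (mdifferentiableAt_chart_symm A.mem_atlas hyφ) (f := M.φ) (x := y)
        ((M.contDiffOn_φ.contDiffAt (M.flow.isOpen_V.mem_nhds hyV)).contMDiffAt.mdifferentiableAt
          (by simp)) rfl
      rw [← h1, ← tderiv_eq_fderiv, ← h2]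
      refine tderiv_congr ?_
      filter_upwards [A.c.open_target.mem_nhds hyT] with z hz
      change A.c.symm (M.φ (A.c (A.c.symm z))) = _
      rw [A.c.right_inv hz]
    have hdv : ∀ v : E, tderiv E E A.c.symm (M.φ y) (fderiv ℝ M.φ y v) =
        tderiv E E (D.localMap A) (A.c.symm y) (tderiv E E A.c.symm y v) := fun v =>
      (congrArg (fun L : E →L[ℝ] E => L v) hd).symm
    ext w
    have h := hy ξ (tderiv E E A.c (A.c.symm y) (w 0 : E))
    rw [bilForm_apply, bilForm_apply, hdv, hdv, tderiv_symm_chartField A.mem_atlas ξ hyT] at h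
    have hw : tderiv E E A.c.symm y (tderiv E E A.c (A.c.symm y) (w 0 : E)) = (w 0 : E) := by
      have := tderiv_symm_chart_apply A.mem_atlas (A.c.map_target hyT) (w 0 : E)
      rwa [A.c.right_inv hyT] at this
    rw [hw, ← hval] at h
    refine Eq.trans ?_ (h.symm.trans ?_)
    · change (D.ω₀ (A.c.symm y) : E [⋀^Fin 2]→L[ℝ] ℝ)
        (Matrix.vecCons (fundamentalField E ξ (A.c.symm y) : E) w) = _
      congr 1
      ext i
      fin_cases i <;> rfl
    · change _ = (D.ω₁ (D.localMap A (A.c.symm y)) : E [⋀^Fin 2]→L[ℝ] ℝ) fun i =>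
        tderiv E E (D.localMap A) (A.c.symm y)
          (Matrix.vecCons (fundamentalField E ξ (A.c.symm y) : E) w i)
      congr 1
      ext i
      fin_cases i <;> rfl
  filter_upwards [(A.c.continuousAt A.mem_source).eventually key,
    A.c.open_source.mem_nhds A.mem_source] with x hx hxs
  rwa [A.c.left_inv hxs] at hx

/-- The equivariant Moser argument along a compact submanifold. -/
theorem exists_openPartialHomeomorph [CompactSpace K] [T2Space X] (hW : IsCompact D.W)
    (hWsub : IsSubmanifold E D.W) :
    ∃ φ : OpenPartialHomeomorph X X, W D ⊆ φ.source ∧ W D ⊆ φ.target ∧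
      IsInvariantSet K φ.source ∧ IsInvariantSet K φ.target ∧
      ContMDiffOn 𝓘(ℝ, E) 𝓘(ℝ, E) ∞ φ φ.source ∧
      ContMDiffOn 𝓘(ℝ, E) 𝓘(ℝ, E) ∞ φ.symm φ.target ∧
      (∀ k : K, ∀ x ∈ φ.source, φ (k • x) = k • φ x) ∧ (∀ p ∈ D.W, φ p = p) ∧
      ∀ ξ : GroupLieAlgebra 𝓘(ℝ, F) K, ∀ x ∈ φ.source,
        D.ω₀.contract (fundamentalField E ξ) x =
          (D.ω₁.pullback φ).contract (fundamentalField E ξ) x := by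
  rcases isEmpty_or_nonempty X with hX | hX
  · exact ⟨OpenPartialHomeomorph.refl X, fun x => hX.elim x,
      fun x => hX.elim x, fun k x => hX.elim x, fun k x => hX.elim x, fun x => hX.elim x,
      fun x => hX.elim x, fun k x => hX.elim x, fun x => hX.elim x, fun ξ x => hX.elim x⟩
  have hA : ∀ q : D.W, ∃ A : AdaptedChart E D.W, A.q = q := by
    intro q
    obtain ⟨c, hc, hqc, S, hS⟩ := hWsub q q.2
    exact ⟨⟨c, S, q, hc, hqc, q.2, hS⟩, rfl⟩
  choose A hAq using hA
  have : LocallyCompactSpace X := Manifold.locallyCompact_of_finiteDimensional 𝓘(ℝ, E)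
  have hmem : ∀ q : D.W, (q : X) ∈ D.localDomain (A q) := fun q => by
    have := D.mem_localDomain (A q)
    rwa [hAq] at this
  -- The case `k = 1` of the intertwining property is independence of the adapted chart.
  have hgerm : ∀ q q' : D.W, (q' : X) ∈ D.localDomain (A q) →
      D.localMap (A q) =ᶠ[𝓝 (q' : X)] D.localMap (A q') := by
    intro q q' hq'
    have h := D.eventually_localMap_smul (A q') (A q) (1 : K) (hmem q') q'.2
      (by rwa [one_smul])
    have hc : ContinuousAt (fun x : X => ((1 : K), x)) (q' : X) :=
      continuousAt_const.prodMk continuousAt_id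
    filter_upwards [hc.eventually h] with x hx
    simpa using hx
  obtain ⟨f, hf⟩ := exists_eventuallyEq_of_germs hW (fun q => D.localDomain (A q))
    (fun q => D.localMap (A q)) (fun q => (D.isOpen_localDomain (A q)).mem_nhds (hmem q)) hgerm
  have hid : ∀ q ∈ D.W, f q = q := fun q hq =>
    (hf ⟨q, hq⟩).self_of_nhds.trans (D.localMap_of_mem (hmem ⟨q, hq⟩) hq)
  have hloc : ∀ q ∈ D.W, IsLocalDiffeoAt E f q := fun q hq => by
    have h := D.isLocalDiffeoAt_localMap (A ⟨q, hq⟩)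
    rw [hAq] at h
    exact h.congr (hf ⟨q, hq⟩)
  -- Near `(k, q)` the intertwining property compares the charts centred at `q` and at `k • q`;
  -- compactness of `K` gives one neighbourhood of `q` for all `k`.
  have hequiv : ∀ q ∈ D.W, ∀ᶠ x in 𝓝 q, ∀ k : K, f (k • x) = k • f x := by
    intro q hq
    have h := isCompact_univ.eventually_forall_of_forall_eventually
      (P := fun x (k : K) => f (k • x) = k • f x) (x₀ := q) fun k _ => ?_
    · filter_upwards [h] with x hx k using hx k (mem_univ k)
    · have hkq : k • q ∈ D.W := D.isInvariant_W k q hq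
      have h1 := D.eventually_localMap_smul (A ⟨q, hq⟩) (A ⟨k • q, hkq⟩) k (hmem ⟨q, hq⟩) hq
        (hmem ⟨k • q, hkq⟩)
      have hs : ContinuousAt (fun z : X × K => z.2 • z.1) (q, k) :=
        (continuous_snd.smul continuous_fst).continuousAt
      filter_upwards [(continuous_swap.tendsto (q, k)).eventually h1,
        hs.eventually (hf ⟨k • q, hkq⟩), continuousAt_fst.eventually (hf ⟨q, hq⟩)] with z h2 h3 h4
      rw [h3, h4]
      exact h2
  have hP : ∀ q ∈ D.W, ∀ᶠ x in 𝓝 q, ∀ ξ : GroupLieAlgebra 𝓘(ℝ, F) K,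
      D.ω₀.contract (fundamentalField E ξ) x =
        (D.ω₁.pullback f).contract (fundamentalField E ξ) x := by
    intro q hq
    have h := D.eventually_pullback_localMap (A ⟨q, hq⟩)
    rw [hAq] at h
    filter_upwards [h, eventually_eventually_nhds.2 (hf ⟨q, hq⟩)] with x hx hxf ξ
    have e : D.ω₁.pullback f x = D.ω₁.pullback (D.localMap (A ⟨q, hq⟩)) x := by
      have e1 : tderiv E E f x = tderiv E E (D.localMap (A ⟨q, hq⟩)) x := tderiv_congr hxf
      have e2 : f x = D.localMap (A ⟨q, hq⟩) x := hxf.self_of_nhds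
      change ContinuousAlternatingMap.compContinuousLinearMap
        (D.ω₁ (f x) : E [⋀^Fin 2]→L[ℝ] ℝ) (tderiv E E f x) = _
      rw [e1, e2]
      rfl
    rw [hx ξ, DiffForm.contract, DiffForm.contract, e]
  obtain ⟨φ, hφ, h1, h2, h3, h4, h5, h6, h7, h8⟩ :=
    exists_equivariant_openPartialHomeomorph (E := E) hW D.isInvariant_W hid hloc hequiv hP
  refine ⟨φ, h1, h2, h3, h4, h5, h6, h7, fun p hp => ?_, fun ξ x hx => ?_⟩
  · rw [hφ, hid p hp]
  · rw [hφ]; exact h8 x hx ξ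

end MoserData

end MomentumDarboux

end

theorem mainTheorem2
    -- a connected compact Lie group `K`
    {F : Type*} [NormedAddCommGroup F] [NormedSpace ℝ F] [FiniteDimensional ℝ F]
    {K : Type*} [TopologicalSpace K] [ChartedSpace F K] [Group K]
    [LieGroup 𝓘(ℝ, F) ∞ K] [T2Space K] [CompactSpace K] [ConnectedSpace K]
    -- acting smoothly on a smooth manifold `X`
    {E : Type*} [NormedAddCommGroup E] [NormedSpace ℝ E] [FiniteDimensional ℝ E]
    {X : Type*} [TopologicalSpace X] [ChartedSpace E X] [IsManifold 𝓘(ℝ, E) ∞ X]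
    [T2Space X] [SecondCountableTopology X]
    [MulAction K X] [ContMDiffSMul 𝓘(ℝ, F) 𝓘(ℝ, E) ∞ K X]
    (W : Set X) (hWsub : IsSubmanifold E W) (hWcomp : IsCompact W) (hWinv : IsInvariantSet K W)
    (ω₀ ω₁ : DiffForm E X 2)
    (hs₀ : ω₀.IsSmooth) (hs₁ : ω₁.IsSmooth)
    (hinv₀ : IsInvariantForm K ω₀) (hinv₁ : IsInvariantForm K ω₁)
    (hmc₀ : IsMomentumlyClosed F K ω₀) (hmc₁ : IsMomentumlyClosed F K ω₁)
    (hnd₀ : ω₀.Nondegenerate) (hnd₁ : ω₁.Nondegenerate)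
    (hW : ∀ p ∈ W, ω₀ p = ω₁ p) :
    -- an equivariant diffeomorphism `φ : U₀ → U₁` between invariant open neighbourhoods of `W`,
    -- where `U₀ = φ.source` and `U₁ = φ.target`
    ∃ φ : OpenPartialHomeomorph X X,
      W ⊆ φ.source ∧ W ⊆ φ.target ∧
      IsInvariantSet K φ.source ∧ IsInvariantSet K φ.target ∧
      ContMDiffOn 𝓘(ℝ, E) 𝓘(ℝ, E) ∞ φ φ.source ∧
      ContMDiffOn 𝓘(ℝ, E) 𝓘(ℝ, E) ∞ φ.symm φ.target ∧
      (∀ k : K, ∀ x ∈ φ.source, φ (k • x) = k • φ x) ∧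
      (∀ p ∈ W, φ p = p) ∧
      ∀ ξ : GroupLieAlgebra 𝓘(ℝ, F) K, ∀ x ∈ φ.source,
        ω₀.contract (fundamentalField E ξ) x =
          (ω₁.pullback φ).contract (fundamentalField E ξ) x := by
  obtain ⟨H, _, _, J, hJ₁, hJ₂, hJ₃⟩ := exists_invariant_immersion F K (E := E) hWcomp
  have : ContinuousSMul K X := ContMDiffSMul.continuousSMul (I := 𝓘(ℝ, F)) (I' := 𝓘(ℝ, E)) ∞
  exact MoserData.exists_openPartialHomeomorph
    (D := { W := W, ω₀ := ω₀, ω₁ := ω₁, J := J, isInvariant_W := hWinv, isSmooth₀ := hs₀,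
            isSmooth₁ := hs₁, isInvariant₀ := hinv₀, isInvariant₁ := hinv₁, isClosed₀ := hmc₀,
            isClosed₁ := hmc₁, nondegenerate₀ := hnd₀, eq_on := hW, contDiffOn_J := hJ₁,
            inner_J := hJ₂, injective_J := hJ₃ }) hWcomp hWsub
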